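/- **Setting.** Let $d\in\{2,3\}$, let $\Omega\subset\mathbb R^d$ be a bounded polyhedral domain with boundary $\Gamma=\partial\Omega$, and let $\alpha\in L^\infty(\Omega)$, $\kappa\in L^\infty(\Gamma)$ be uniformly positive, $\alpha\le\alpha_1$. Let $\mathcal T_\Omega$ be a conforming simplicial triangulation of $\overline\Omega$ which restricts to a triangulation of $\Gamma$ and has mesh width $h$ (maximal diameter). Assume it is quasi-uniform with uniformity parameter $\sigma>0$: every $d$-simplex contains a ball of radius $h/\sigma$. Let $V_h$ be the space of continuous functions that are polynomials of degree at most $k\ge1$ on each simplex, with nodal (Lagrange) basis $(\varphi_i)$, the basis functions of the nodes on $\Gamma$ being numbered last. Let $M_h=V_h|_\Gamma$, with the basis $(\chi_i)$ formed by the traces of the basis functions of the boundary nodes. Let $Q_h$, with basis $(\psi_i)$, be any space of continuous piecewise polynomials on a simplicial mesh of $\Gamma$. Put $$(M_u)_{ij}=\int_\Omega\varphi_i\varphi_j\,dx,\quad (K_u)_{ij}=\int_\Omega\alpha\nabla\varphi_i\cdot\nabla\varphi_j\,dx,\quad (M_p)_{ij}=\int_\Gamma\psi_i\psi_j\,d\sigma,\quad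 (K_p)_{ij}=\int_\Gamma\kappa\nabla_\Gamma\psi_i\cdot\nabla_\Gamma\psi_j\,d\sigma,$$ $$(B_u)_{ij}=\int_\Gamma\chi_i\varphi_j\,d\sigma,\quad (B_p)_{ij}=\int_\Gamma\chi_i\psi_j\,d\sigma,\quad (M_\lambda)_{ij}=\int_\Gamma\chi_i\chi_j\,d\sigma,$$ and $\|x\|_M^2=x^TMx$. According to interior and boundary nodes, write $u=(u_1,u_2)$, and write $M_{ij}$, $K_{ij}$, $i,j\in\{1,2\}$, for the blocks of $M_u$, $K_u$. **Semi-discrete problem.** Let $T>0$, let $\tau>0$ be the time step, $t^n=n\tau$, and let $f_u=(f_1,f_2)$, $f_p$ be given functions of time (the linear case). Let $(u,p,\lambda)$ satisfy on $[-2\tau,T]$ (that is, the solution is extended to negative times) $$M_u\dot u+K_uu-B_u^T\lambda=f_u,\qquad M_p\dot p+K_pp+B_p^T\lambda=f_p,\qquad B_uu=B_pp .$$ Sufficient regularity means: $u,p$ are four times continuously differentiable on $[-2\tau,T]$ and, for a constant $R$ and all $t\in[-2\tau,T]$, $\|u^{(j)}(t)\|_{M_u}^2\le R$ and $\|p^{(j)}(t)\|_{M_p}^2\le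 R$ for $j=2,3,4$, and $\|u^{(j)}(t)\|_{K_u}^2\le R$ for $j=2,3$. **Splitting scheme.** Let $D x^n=\frac1{2\tau}(3x^n-4x^{n-1}+x^{n-2})$ and $\tilde D x^n=\frac1{2\tau}(5x^n-8x^{n-1}+3x^{n-2})$. Given $u^k$, $p^k$ for $k=-2,-1,0$, let $(u^{n+3},\lambda^{n+3},w^{n+3},p^{n+3})$ satisfy, for all $n\ge-2$ with $t^{n+3}\le T$, $$\begin{aligned} M_{11}Du_1^{n+3}+K_{11}u_1^{n+3}&=f_1(t^{n+3})-M_{12}w^{n+3}-K_{12}u_2^{n+3},\\ M_{21}Du_1^{n+3}+K_{21}u_1^{n+3}-M_\lambda\lambda^{n+3}&=f_2(t^{n+3})-M_{22}w^{n+3}-K_{22}u_2^{n+3},\\ M_\lambda u_2^{n+3}&=B_p(2p^{n+2}-p^{n+1}),\\ M_\lambda w^{n+3}&=B_p\tilde Dp^{n+2},\\ M_pDp^{n+3}+K_pp^{n+3}+B_p^T\lambda^{n+3}&=f_p(t^{n+3}). \end{aligned}$$ **Theorem (second-order convergence).** There are constants $c>0$ and $h_0>0$, depending only on $d,k,\sigma,\alpha_1$,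 such that for all $T>0$, $C_0$, $R$ there is a constant $C$, depending only on $d,k,\sigma,\alpha_1,T,C_0,R$ (in particular not on $h$, $\tau$, $n$), with the following property. If $h\le h_0$ and the weak CFL condition $\tau\le c\,h$ holds, if the extended semi-discrete solution is sufficiently regular with bound $R$, and if the initial data are consistent, $B_uu^k=B_pp^k$, and satisfy $$\|u^k-u(t^k)\|_{M_u}^2+\tau\|u^k-u(t^k)\|_{K_u}^2+\|p^k-p(t^k)\|_{M_p}^2+\tau\|p^k-p(t^k)\|_{K_p}^2\le C_0\,\tau^5\qquad(k=-2,-1,0),$$ then, for every $n\ge0$ with $t^n\le T$, $$\|u^n-u(t^n)\|_{M_u}^2+\|p^n-p(t^n)\|_{M_p}^2+\tau\sum_{k=1}^n\Big(\|u^k-u(t^k)\|_{K_u}^2+\|p^k-p(t^k)\|_{K_p}^2\Big)\le C\,\tau^4 .$$ -/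

import Mathlib

open MeasureTheory Set Matrix

noncomputable section

namespace BulkSurface

/-! ### Meshes -/

/-- The `n`-dimensional simplices of a simplicial complex in `ℝ^d` (given by their vertices). -/
def cells {d : ℕ} (K : Geometry.SimplicialComplex ℝ (EuclideanSpace ℝ (Fin d))) (n : ℕ) :
    Set (Finset (EuclideanSpace ℝ (Fin d))) :=
  {s | s ∈ K.faces ∧ s.card = n + 1}

/-- `K` is a (conforming, finite, simplicial) mesh of the `n`-dimensional set `S`. -/
structure IsMesh {d : ℕ} (K : Geometry.SimplicialComplex ℝ (EuclideanSpace ℝ (Fin d))) (n : ℕ)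
    (S : Set (EuclideanSpace ℝ (Fin d))) : Prop where
  finite : K.faces.Finite
  pure : ∀ s ∈ K.faces, ∃ t ∈ cells K n, s ⊆ t
  space_eq : K.space = S

/-- `K` is a triangulation of the polyhedral open set `Ω`: its `d`-simplices cover the closure of
`Ω`, and its restriction to the boundary, i.e. the collection of its `(d-1)`-simplices that lie
in `∂Ω`, covers `∂Ω`. -/
structure IsTriangulation {d : ℕ} (K : Geometry.SimplicialComplex ℝ (EuclideanSpace ℝ (Fin d)))
    (Ω : Set (EuclideanSpace ℝ (Fin d))) : Prop where
  isMesh : IsMesh K d (closure Ω)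
  boundary : ∀ x ∈ frontier Ω, ∃ s ∈ cells K (d - 1),
    x ∈ convexHull ℝ (s : Set (EuclideanSpace ℝ (Fin d))) ∧
      convexHull ℝ (s : Set (EuclideanSpace ℝ (Fin d))) ⊆ frontier Ω

/-- The mesh width: the maximal diameter of a simplex. -/
def meshWidth {d : ℕ} (K : Geometry.SimplicialComplex ℝ (EuclideanSpace ℝ (Fin d))) : ℝ :=
  ⨆ s : K.faces, Metric.diam (convexHull ℝ ((s : Finset (EuclideanSpace ℝ (Fin d))) :
    Set (EuclideanSpace ℝ (Fin d))))

/-- Quasi-uniformity with uniformity parameter `σ`: every `d`-simplex contains a ball of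
radius `h / σ`, where `h` is the mesh width. -/
def IsQuasiUniform {d : ℕ} (K : Geometry.SimplicialComplex ℝ (EuclideanSpace ℝ (Fin d)))
    (σ : ℝ) : Prop :=
  ∀ s ∈ cells K d, ∃ x, Metric.closedBall x (meshWidth K / σ) ⊆
    convexHull ℝ (s : Set (EuclideanSpace ℝ (Fin d)))

/-! ### Finite element spaces -/

/-- `v` is continuous and piecewise polynomial of degree at most `k` on the mesh `K`. Only the
values of `v` on the underlying set of `K` matter. -/
def IsPiecewisePolynomial {d : ℕ}
    (K : Geometry.SimplicialComplex ℝ (EuclideanSpace ℝ (Fin d))) (k : ℕ)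
    (v : EuclideanSpace ℝ (Fin d) → ℝ) : Prop :=
  ContinuousOn v K.space ∧
    ∀ s ∈ K.faces, ∃ P : MvPolynomial (Fin d) ℝ, P.totalDegree ≤ k ∧
      ∀ x ∈ convexHull ℝ (s : Set (EuclideanSpace ℝ (Fin d))),
        v x = MvPolynomial.eval (fun i => x i) P

/-- The Lagrange nodes of degree `k`: the points of the simplices whose barycentric coordinates
are integer multiples of `1 / k`. -/
def lagrangeNodes {d : ℕ} (K : Geometry.SimplicialComplex ℝ (EuclideanSpace ℝ (Fin d)))
    (k : ℕ) : Set (EuclideanSpace ℝ (Fin d)) :=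
  {z | ∃ s ∈ K.faces, ∃ a : EuclideanSpace ℝ (Fin d) → ℕ,
    ∑ v ∈ s, a v = k ∧ z = ∑ v ∈ s, ((a v : ℝ) / (k : ℝ)) • v}

/-- `φ` is the nodal basis of the Lagrange space of degree `k` on `K`, with respect to an
enumeration `node` of the Lagrange nodes in which the nodes on `Γ` come last. -/
structure IsNodalBasis {d : ℕ} (K : Geometry.SimplicialComplex ℝ (EuclideanSpace ℝ (Fin d)))
    (k : ℕ) (Γ : Set (EuclideanSpace ℝ (Fin d))) {N₁ Nl : ℕ}
    (node : Fin N₁ ⊕ Fin Nl → EuclideanSpace ℝ (Fin d))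
    (φ : Fin N₁ ⊕ Fin Nl → EuclideanSpace ℝ (Fin d) → ℝ) : Prop where
  injective : Function.Injective node
  range_eq : range node = lagrangeNodes K k
  interior_node : ∀ i : Fin N₁, node (Sum.inl i) ∉ Γ
  boundary_node : ∀ j : Fin Nl, node (Sum.inr j) ∈ Γ
  mem_space : ∀ i, IsPiecewisePolynomial K k (φ i)
  nodal : ∀ i j, φ i (node j) = if i = j then 1 else 0

/-- `ψ` is a basis of a conforming finite element space on the surface `Γ` with mesh `KΓ`, i.e. of
some space of continuous piecewise polynomials of degree at most `m`. -/
structure IsSurfaceBasis {d : ℕ} (KΓ : Geometry.SimplicialComplex ℝ (EuclideanSpace ℝ (Fin d)))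
    (m : ℕ) (Γ : Set (EuclideanSpace ℝ (Fin d))) {Np : ℕ}
    (ψ : Fin Np → EuclideanSpace ℝ (Fin d) → ℝ) : Prop where
  mem_space : ∀ i, IsPiecewisePolynomial KΓ m (ψ i)
  linearIndependent : LinearIndependent ℝ (fun i => Γ.domRestrict (ψ i))

/-! ### Mass, stiffness and trace matrices -/

/-- `∫_Ω φ_i φ_j dx`. -/
def bulkMass {d : ℕ} {ι : Type} (Ω : Set (EuclideanSpace ℝ (Fin d)))
    (φ : ι → EuclideanSpace ℝ (Fin d) → ℝ) : Matrix ι ι ℝ :=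
  Matrix.of fun i j => ∫ x in Ω, φ i x * φ j x

/-- `∫_Ω α ∇φ_i · ∇φ_j dx`. -/
def bulkStiffness {d : ℕ} {ι : Type} (Ω : Set (EuclideanSpace ℝ (Fin d)))
    (α : EuclideanSpace ℝ (Fin d) → ℝ)
    (φ : ι → EuclideanSpace ℝ (Fin d) → ℝ) : Matrix ι ι ℝ :=
  Matrix.of fun i j => ∫ x in Ω, α x * inner ℝ (gradient (φ i) x) (gradient (φ j) x)

/-- `∫_Γ χ_i ψ_j dσ`, with the surface measure on `Γ`, i.e. the `(d-1)`-dimensional Hausdorff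
measure in its Euclidean normalization. -/
def surfaceMass {d : ℕ} {ι ι' : Type} (Γ : Set (EuclideanSpace ℝ (Fin d)))
    (χ : ι → EuclideanSpace ℝ (Fin d) → ℝ)
    (ψ : ι' → EuclideanSpace ℝ (Fin d) → ℝ) : Matrix ι ι' ℝ :=
  Matrix.of fun i j => ∫ x in Γ, χ i x * ψ j x ∂(Measure.euclideanHausdorffMeasure (d - 1))

/-- The gradient of `g` at `x` in the directions of the linear subspace `W`. -/
def tangentialGradient {d : ℕ} (W : Submodule ℝ (EuclideanSpace ℝ (Fin d)))
    (g : EuclideanSpace ℝ (Fin d) → ℝ) (x : EuclideanSpace ℝ (Fin d)) :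
    EuclideanSpace ℝ (Fin d) :=
  ((gradient (fun w : W => g (x + (w : EuclideanSpace ℝ (Fin d)))) 0 : W) :
    EuclideanSpace ℝ (Fin d))

/-- `∫_Γ κ ∇_Γ ψ_i · ∇_Γ ψ_j dσ` for a polyhedral surface `Γ` with mesh `KΓ`; the integral is the
sum of the integrals over the flat facets of the mesh. -/
def surfaceStiffness {d : ℕ} {ι : Type}
    (KΓ : Geometry.SimplicialComplex ℝ (EuclideanSpace ℝ (Fin d)))
    (κ : EuclideanSpace ℝ (Fin d) → ℝ)
    (ψ : ι → EuclideanSpace ℝ (Fin d) → ℝ) : Matrix ι ι ℝ :=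
  Matrix.of fun i j => ∑ᶠ s ∈ cells KΓ (d - 1),
    ∫ x in convexHull ℝ (s : Set (EuclideanSpace ℝ (Fin d))),
      κ x * inner ℝ
        (tangentialGradient (vectorSpan ℝ (s : Set (EuclideanSpace ℝ (Fin d)))) (ψ i) x)
        (tangentialGradient (vectorSpan ℝ (s : Set (EuclideanSpace ℝ (Fin d)))) (ψ j) x)
      ∂(Measure.euclideanHausdorffMeasure (d - 1))

/-- The matrices of the semi-discrete bulk-surface problem; `ι₁`, `ι₂` index the interior and the
boundary degrees of freedom of the bulk variable and `ιp` those of the surface variable. -/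
structure FEMatrices (ι₁ ι₂ ιp : Type) where
  Mu : Matrix (ι₁ ⊕ ι₂) (ι₁ ⊕ ι₂) ℝ
  Ku : Matrix (ι₁ ⊕ ι₂) (ι₁ ⊕ ι₂) ℝ
  Mp : Matrix ιp ιp ℝ
  Kp : Matrix ιp ιp ℝ
  Bu : Matrix ι₂ (ι₁ ⊕ ι₂) ℝ
  Bp : Matrix ι₂ ιp ℝ
  Ml : Matrix ι₂ ι₂ ℝ

/-- The finite element matrices on `Ω` and `Γ = ∂Ω`. The multiplier space is the trace space of the
bulk space, with the traces of the boundary nodal functions as its basis. -/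
def feMatrices {d : ℕ} {ι₁ ι₂ ιp : Type} (Ω : Set (EuclideanSpace ℝ (Fin d)))
    (KΓ : Geometry.SimplicialComplex ℝ (EuclideanSpace ℝ (Fin d)))
    (α κ : EuclideanSpace ℝ (Fin d) → ℝ)
    (φ : ι₁ ⊕ ι₂ → EuclideanSpace ℝ (Fin d) → ℝ)
    (ψ : ιp → EuclideanSpace ℝ (Fin d) → ℝ) : FEMatrices ι₁ ι₂ ιp where
  Mu := bulkMass Ω φ
  Ku := bulkStiffness Ω α φ
  Mp := surfaceMass (frontier Ω) ψ ψ
  Kp := surfaceStiffness KΓ κ ψ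
  Bu := surfaceMass (frontier Ω) (fun j => φ (Sum.inr j)) φ
  Bp := surfaceMass (frontier Ω) (fun j => φ (Sum.inr j)) ψ
  Ml := surfaceMass (frontier Ω) (fun j => φ (Sum.inr j)) (fun j => φ (Sum.inr j))

/-- The squared (semi-)norm `‖x‖²_M = xᵀ M x`. -/
def sqNorm {ι : Type} [Fintype ι] (M : Matrix ι ι ℝ) (x : ι → ℝ) : ℝ :=
  x ⬝ᵥ (M *ᵥ x)

/-! ### The semi-discrete problem and the splitting scheme -/

/-- `(u, p, lam)` solves the semi-discrete problem with right-hand sides `fu`, `fp` on the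
interval `I`. -/
structure IsSemidiscreteSolution {ι₁ ι₂ ιp : Type} [Fintype ι₁] [Fintype ι₂] [Fintype ιp]
    (A : FEMatrices ι₁ ι₂ ιp) (fu : ℝ → ι₁ ⊕ ι₂ → ℝ) (fp : ℝ → ιp → ℝ) (I : Set ℝ)
    (u : ℝ → ι₁ ⊕ ι₂ → ℝ) (p : ℝ → ιp → ℝ) (lam : ℝ → ι₂ → ℝ) : Prop where
  bulk : ∀ t ∈ I, A.Mu *ᵥ derivWithin u I t + A.Ku *ᵥ u t - A.Buᵀ *ᵥ lam t = fu t
  surface : ∀ t ∈ I, A.Mp *ᵥ derivWithin p I t + A.Kp *ᵥ p t + A.Bpᵀ *ᵥ lam t = fp t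
  constraint : ∀ t ∈ I, A.Bu *ᵥ u t = A.Bp *ᵥ p t

/-- `D x^n = (3 x^n - 4 x^(n-1) + x^(n-2)) / (2τ)`. -/
def bdf {ι : Type} (τ : ℝ) (x : ℤ → ι → ℝ) (n : ℤ) : ι → ℝ :=
  (1 / (2 * τ)) • ((3 : ℝ) • x n - (4 : ℝ) • x (n - 1) + x (n - 2))

/-- `D̃ x^n = (5 x^n - 8 x^(n-1) + 3 x^(n-2)) / (2τ)`. -/
def altDiff {ι : Type} (τ : ℝ) (x : ℤ → ι → ℝ) (n : ℤ) : ι → ℝ :=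
  (1 / (2 * τ)) • ((5 : ℝ) • x n - (8 : ℝ) • x (n - 1) + (3 : ℝ) • x (n - 2))

/-- The 3-step bulk-surface splitting scheme on the time interval `[0, T]` with step size `τ`:
for all `n ≥ -2` with `(n + 3) τ ≤ T` the iterates with index `n + 3` satisfy the equations of the
bulk problem and of the surface problem. Here `u^n = (u₁^n, u₂^n)`. -/
structure IsSplittingScheme {ι₁ ι₂ ιp : Type} [Fintype ι₁] [Fintype ι₂] [Fintype ιp]
    (A : FEMatrices ι₁ ι₂ ιp) (fu : ℝ → ι₁ ⊕ ι₂ → ℝ) (fp : ℝ → ιp → ℝ) (T τ : ℝ)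
    (u : ℤ → ι₁ ⊕ ι₂ → ℝ) (lam w : ℤ → ι₂ → ℝ) (p : ℤ → ιp → ℝ) : Prop where
  bulk_interior : ∀ n : ℤ, -2 ≤ n → ((n + 3 : ℤ) : ℝ) * τ ≤ T →
    A.Mu.toBlocks₁₁ *ᵥ bdf τ (fun k => u k ∘ Sum.inl) (n + 3)
        + A.Ku.toBlocks₁₁ *ᵥ (u (n + 3) ∘ Sum.inl)
      = fu (((n + 3 : ℤ) : ℝ) * τ) ∘ Sum.inl
        - A.Mu.toBlocks₁₂ *ᵥ w (n + 3) - A.Ku.toBlocks₁₂ *ᵥ (u (n + 3) ∘ Sum.inr)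
  bulk_boundary : ∀ n : ℤ, -2 ≤ n → ((n + 3 : ℤ) : ℝ) * τ ≤ T →
    A.Mu.toBlocks₂₁ *ᵥ bdf τ (fun k => u k ∘ Sum.inl) (n + 3)
        + A.Ku.toBlocks₂₁ *ᵥ (u (n + 3) ∘ Sum.inl) - A.Ml *ᵥ lam (n + 3)
      = fu (((n + 3 : ℤ) : ℝ) * τ) ∘ Sum.inr
        - A.Mu.toBlocks₂₂ *ᵥ w (n + 3) - A.Ku.toBlocks₂₂ *ᵥ (u (n + 3) ∘ Sum.inr)
  constraint : ∀ n : ℤ, -2 ≤ n → ((n + 3 : ℤ) : ℝ) * τ ≤ T →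
    A.Ml *ᵥ (u (n + 3) ∘ Sum.inr) = A.Bp *ᵥ ((2 : ℝ) • p (n + 2) - p (n + 1))
  constraint_deriv : ∀ n : ℤ, -2 ≤ n → ((n + 3 : ℤ) : ℝ) * τ ≤ T →
    A.Ml *ᵥ w (n + 3) = A.Bp *ᵥ altDiff τ p (n + 2)
  surface : ∀ n : ℤ, -2 ≤ n → ((n + 3 : ℤ) : ℝ) * τ ≤ T →
    A.Mp *ᵥ bdf τ p (n + 3) + A.Kp *ᵥ p (n + 3) + A.Bpᵀ *ᵥ lam (n + 3)
      = fp (((n + 3 : ℤ) : ℝ) * τ)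

/-- Regularity of a semi-discrete solution on the interval `I`: it is four times continuously
differentiable in time, and `R` bounds the squared `L²` norms of the time derivatives of orders two
to four and the squared bulk energy norms of those of orders two and three. -/
structure IsRegular {ι₁ ι₂ ιp : Type} [Fintype ι₁] [Fintype ι₂] [Fintype ιp]
    (A : FEMatrices ι₁ ι₂ ιp) (I : Set ℝ) (R : ℝ)
    (u : ℝ → ι₁ ⊕ ι₂ → ℝ) (p : ℝ → ιp → ℝ) : Prop where
  contDiffOn_bulk : ContDiffOn ℝ 4 u I
  contDiffOn_surface : ContDiffOn ℝ 4 p I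
  bulk_mass : ∀ t ∈ I, ∀ j ∈ Finset.Icc 2 4, sqNorm A.Mu (iteratedDerivWithin j u I t) ≤ R
  bulk_energy : ∀ t ∈ I, ∀ j ∈ Finset.Icc 2 3, sqNorm A.Ku (iteratedDerivWithin j u I t) ≤ R
  surface_mass : ∀ t ∈ I, ∀ j ∈ Finset.Icc 2 4, sqNorm A.Mp (iteratedDerivWithin j p I t) ≤ R

end BulkSurface

end

/-!
The proof has a part about finite elements and a part about the time discretization, joined by the
structure `IsAdmissible`.

*Finite elements.* On a quasi-uniform mesh of width `h` two bounds are needed with constants that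
depend only on `d`, `k`, `σ`, `α₁`: the extension by zero of boundary values satisfies
`‖(0, x)‖² ≤ a h ‖x‖²_Γ` in `L²(Ω)`, and the inverse estimate `h² ‖v‖²_K ≤ b ‖v‖²_M` holds. Both
come from the equivalence of norms on polynomials of degree at most `k` on the reference simplex,
transported by affine parametrizations (`exists_bulkMass_le_sum_sq`, `exists_sum_sq_le_surfaceMass`,
`exists_inverse_estimate`). Unisolvence of the Lagrange nodes shows that interior basis functions
vanish on the boundary, so the trace matrix is `(0, M_λ)`; hence the multiplier drops out of the
error equations if the bulk test function has boundary values `Q q`, where `q` is the surface test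
function and `Q` the `L²(Γ)`-projection onto the trace space (`exists_isAdmissible`,
`error_equation`).

*Time discretization.* The scheme is a two-step backward differentiation formula in which the
boundary velocity of the bulk variable is an extrapolation. Let `P = Q e_p` be the projected surface
error, and write `∂` for backward differences. The velocity error is the two-step difference
quotient of `P + r`, where the correction `r` solves `3 rⁿ = rⁿ⁻¹ - 3 ∂²Pⁿ` (`corr`). Replacing the
boundary values of the bulk error by `P + r`, and adding `∂²u` in the interior so that boundary and
interior agree up to second differences, gives the variable `y` (`correctedError`). The error
equation is tested with `y - E r`, which has the admissible boundary values `P`; here `E` is the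
extension orthogonal, in the mass inner product, to all functions that vanish on the boundary.
This orthogonality turns the leading splitting error into the inner product of `E r` and `E ∂P`,
which is a discrete time derivative up to quadratic terms (`telescoping_identity`). These carry the
small factor `a h`, the terms in the energy norm carry `τ a b / h`, and both are absorbed by the
numerical dissipation `‖∂²e_p‖²` and by the decay of `r` once `h ≤ h₀` and `τ ≤ c h`
(`energy_step`). A discrete Gronwall inequality and the Taylor expansion of the exact solution then
yield the estimate (`error_bound`, `error_estimate_of_isAdmissible`).
-/

open Measure

namespace BulkSurface

/-! ### Unisolvence of the principal lattice -/

/-- The Lagrange polynomial (up to normalization) of the lattice point `a / k`: the product of the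
affine functions that vanish on the lattice hyperplanes between `a / k` and the faces of the
reference simplex. -/
noncomputable def latticeLagrange {n : ℕ} (k : ℕ) (a : Fin n → ℕ) : MvPolynomial (Fin n) ℝ :=
  (∏ i, ∏ j ∈ Finset.range (a i), (MvPolynomial.X i - MvPolynomial.C ((j : ℝ) / k))) *
    ∏ j ∈ Finset.range (k - ∑ i, a i),
      (MvPolynomial.C (1 - (j : ℝ) / k) - ∑ i, MvPolynomial.X i)

theorem totalDegree_latticeLagrange_le {n k : ℕ} {a : Fin n → ℕ} (ha : ∑ i, a i ≤ k) :
    (latticeLagrange k a).totalDegree ≤ k := by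
  have h1 : (∏ i, ∏ j ∈ Finset.range (a i),
      (MvPolynomial.X i - MvPolynomial.C ((j : ℝ) / k) : MvPolynomial (Fin n) ℝ)).totalDegree
      ≤ ∑ i, a i := by
    refine (MvPolynomial.totalDegree_finsetProd _ _).trans (Finset.sum_le_sum fun i _ => ?_)
    refine (MvPolynomial.totalDegree_finsetProd _ _).trans ?_
    refine (Finset.sum_le_card_nsmul _ _ 1 fun j _ => ?_).trans (by simp)
    refine (MvPolynomial.totalDegree_sub_C_le _ _).trans (by simp)
  have h2 : (∏ j ∈ Finset.range (k - ∑ i, a i),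
      (MvPolynomial.C (1 - (j : ℝ) / k) - ∑ i, MvPolynomial.X i :
        MvPolynomial (Fin n) ℝ)).totalDegree ≤ k - ∑ i, a i := by
    refine (MvPolynomial.totalDegree_finsetProd _ _).trans ?_
    refine (Finset.sum_le_card_nsmul _ _ 1 fun j _ => ?_).trans (by simp)
    refine (MvPolynomial.totalDegree_sub _ _).trans
      (max_le (by rw [MvPolynomial.totalDegree_C]; exact Nat.zero_le _) ?_)
    exact MvPolynomial.totalDegree_finsetSum_le fun i _ => by simp
  refine (MvPolynomial.totalDegree_mul _ _).trans ((add_le_add h1 h2).trans ?_)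
  omega

theorem eval_latticeLagrange {n k : ℕ} (a : Fin n → ℕ) (x : Fin n → ℝ) :
    MvPolynomial.eval x (latticeLagrange k a) =
      (∏ i, ∏ j ∈ Finset.range (a i), (x i - (j : ℝ) / k)) *
        ∏ j ∈ Finset.range (k - ∑ i, a i), (1 - (j : ℝ) / k - ∑ i, x i) := by
  simp [latticeLagrange, map_prod]

theorem eval_latticeLagrange_of_ne {n k : ℕ} (hk : 1 ≤ k) {a b : Fin n → ℕ} (hb : ∑ i, b i ≤ k)
    (hab : a ≠ b) : MvPolynomial.eval (fun i => (b i : ℝ) / k) (latticeLagrange k a) = 0 := by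
  have hk' : (k : ℝ) ≠ 0 := by positivity
  rw [eval_latticeLagrange]
  by_cases h : ∃ i, b i < a i
  · obtain ⟨i, hi⟩ := h
    apply mul_eq_zero_of_left
    apply Finset.prod_eq_zero (Finset.mem_univ i)
    exact Finset.prod_eq_zero (Finset.mem_range.2 hi) (by simp)
  · push Not at h
    have hlt : ∑ i, a i < ∑ i, b i := by
      obtain ⟨i, hi⟩ := Function.ne_iff.1 hab
      exact Finset.sum_lt_sum (fun i _ => h i) ⟨i, Finset.mem_univ i, lt_of_le_of_ne (h i) hi⟩
    apply mul_eq_zero_of_right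
    refine Finset.prod_eq_zero (i := k - ∑ i, b i) (Finset.mem_range.2 (by omega)) ?_
    rw [← Finset.sum_div, Nat.cast_sub hb]
    push_cast
    field_simp
    ring

theorem eval_latticeLagrange_self {n k : ℕ} (hk : 1 ≤ k) {a : Fin n → ℕ} (ha : ∑ i, a i ≤ k) :
    MvPolynomial.eval (fun i => (a i : ℝ) / k) (latticeLagrange k a) ≠ 0 := by
  have hk' : (0 : ℝ) < k := by positivity
  rw [eval_latticeLagrange]
  refine mul_ne_zero (Finset.prod_ne_zero_iff.2 fun i _ => Finset.prod_ne_zero_iff.2 fun j hj => ?_)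
    (Finset.prod_ne_zero_iff.2 fun j hj => ?_)
  · have : (j : ℝ) < a i := by exact_mod_cast Finset.mem_range.1 hj
    rw [← sub_div]
    exact (div_pos (by linarith) hk').ne'
  · have hj' : j + ∑ i, a i < k := by have := Finset.mem_range.1 hj; omega
    have : (j : ℝ) + ∑ i, (a i : ℝ) < k := by exact_mod_cast hj'
    rw [← Finset.sum_div, sub_sub, ← add_div]
    have := (div_lt_one hk').2 this
    linarith

/-- Unisolvence of the principal lattice: a polynomial of degree at most `k` that vanishes at all
lattice points `a / k` of the reference simplex is zero. There are as many lattice points as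
monomials of degree at most `k`, and the Lagrange polynomials show that all values at the lattice
points are attained. -/
theorem eq_zero_of_eval_lattice_eq_zero {n k : ℕ} (hk : 1 ≤ k) {P : MvPolynomial (Fin n) ℝ}
    (hP : P.totalDegree ≤ k)
    (h : ∀ a : Fin n → ℕ, ∑ i, a i ≤ k → MvPolynomial.eval (fun i => (a i : ℝ) / k) P = 0) :
    P = 0 := by
  classical
  let S := {m : Fin n →₀ ℕ | (m.sum fun _ e => e) ≤ k}
  have hfin : Module.Finite ℝ (MvPolynomial.restrictTotalDegree (Fin n) ℝ k) := inferInstance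
  let b : Module.Basis S ℝ (MvPolynomial.restrictTotalDegree (Fin n) ℝ k) :=
    MvPolynomial.basisRestrictSupport ℝ S
  have : Finite S := Module.Finite.finite_basis b
  have := Fintype.ofFinite S
  have hS : ∀ m : S, ∑ i, (m : Fin n →₀ ℕ) i ≤ k := fun m => by
    have := m.2
    simpa [S, Finsupp.sum_fintype] using this
  let f : MvPolynomial.restrictTotalDegree (Fin n) ℝ k →ₗ[ℝ] (S → ℝ) :=
    { toFun := fun P m => MvPolynomial.eval (fun i => ((m : Fin n →₀ ℕ) i : ℝ) / k) P.1
      map_add' := fun P Q => by ext; simp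
      map_smul' := fun c P => by ext; simp [MvPolynomial.smul_eval] }
  have hsurj : Function.Surjective f := by
    rw [← LinearMap.range_eq_top, eq_top_iff, ← (Pi.basisFun ℝ S).span_eq, Submodule.span_le]
    rintro _ ⟨m, rfl⟩
    refine ⟨(MvPolynomial.eval (fun i => ((m : Fin n →₀ ℕ) i : ℝ) / k)
      (latticeLagrange k (m : Fin n →₀ ℕ)))⁻¹ • ⟨latticeLagrange k (m : Fin n →₀ ℕ),
      (MvPolynomial.mem_restrictTotalDegree _ _ _).2 (totalDegree_latticeLagrange_le (hS m))⟩, ?_⟩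
    ext m'
    by_cases hm : m = m'
    · subst hm
      simpa [f, MvPolynomial.smul_eval] using
        inv_mul_cancel₀ (eval_latticeLagrange_self hk (hS m))
    · have hne : (m : Fin n → ℕ) ≠ (m' : Fin n →₀ ℕ) := fun h =>
        hm (Subtype.ext (DFunLike.coe_injective h))
      simp [f, MvPolynomial.smul_eval, eval_latticeLagrange_of_ne hk (hS m') hne,
        Ne.symm hm]
  have hinj : Function.Injective f := by
    refine (LinearMap.injective_iff_surjective_of_finrank_eq_finrank ?_).2 hsurj
    rw [Module.finrank_eq_card_basis b, Module.finrank_fintype_fun_eq_card]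
  have h0 : f ⟨P, (MvPolynomial.mem_restrictTotalDegree _ _ _).2 hP⟩ = 0 := by
    ext m
    exact h _ (hS m)
  have := hinj (h0.trans (map_zero f).symm)
  simpa using congrArg Subtype.val this

/-! ### Polynomials on the reference simplex -/

/-- The reference simplex in `ℝ^n`, the convex hull of the origin and the unit vectors. -/
def refSimplex (n : ℕ) : Set (EuclideanSpace ℝ (Fin n)) :=
  {y | (∀ i, 0 ≤ y i) ∧ ∑ i, y i ≤ 1}

theorem convex_refSimplex (n : ℕ) : Convex ℝ (refSimplex n) := by
  rintro x ⟨hx, hx'⟩ y ⟨hy, hy'⟩ a b ha hb hab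
  refine ⟨fun i => ?_, ?_⟩
  · have := hx i
    have := hy i
    simp only [PiLp.add_apply, PiLp.smul_apply, smul_eq_mul]
    positivity
  · simp only [PiLp.add_apply, PiLp.smul_apply, smul_eq_mul, Finset.sum_add_distrib,
      ← Finset.mul_sum]
    nlinarith

theorem norm_le_one_of_mem_refSimplex {n : ℕ} {y : EuclideanSpace ℝ (Fin n)}
    (hy : y ∈ refSimplex n) : ‖y‖ ≤ 1 := by
  rw [← sq_le_one_iff₀ (norm_nonneg _), EuclideanSpace.real_norm_sq_eq]
  have h1 : ∀ i, y i ≤ 1 := fun i =>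
    (Finset.single_le_sum (fun i _ => hy.1 i) (Finset.mem_univ i)).trans hy.2
  refine (Finset.sum_le_sum fun i _ => ?_).trans hy.2
  nlinarith [h1 i, hy.1 i]

theorem isCompact_refSimplex (n : ℕ) : IsCompact (refSimplex n) := by
  refine Metric.isCompact_of_isClosed_isBounded ?_ ?_
  · have : refSimplex n = (⋂ i, {y | 0 ≤ y i}) ∩ {y | ∑ i, y i ≤ 1} := by
      ext y; simp [refSimplex]
    rw [this]
    refine (isClosed_iInter fun i => isClosed_le continuous_const (by fun_prop)).inter
      (isClosed_le (by fun_prop) continuous_const)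
  · exact (Metric.isBounded_closedBall (x := 0) (r := 1)).subset fun y hy => by
      simpa using norm_le_one_of_mem_refSimplex hy

theorem nonempty_interior_refSimplex (n : ℕ) : (interior (refSimplex n)).Nonempty := by
  have hopen : IsOpen ((⋂ i, {y : EuclideanSpace ℝ (Fin n) | 0 < y i}) ∩ {y | ∑ i, y i < 1}) :=
    (isOpen_iInter_of_finite fun i => isOpen_lt continuous_const (by fun_prop)).inter
      (isOpen_lt (by fun_prop) continuous_const)
  refine ⟨WithLp.toLp 2 fun _ => 1 / ((n : ℝ) + 1), interior_maximal ?_ hopen ?_⟩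
  · rintro y ⟨h1, h2⟩
    simp only [mem_iInter, mem_ofPred_eq] at h1 h2
    exact ⟨fun i => (h1 i).le, h2.le⟩
  · simp only [mem_inter_iff, mem_iInter, mem_ofPred_eq, Finset.sum_const, Finset.card_univ,
      Fintype.card_fin, nsmul_eq_mul]
    refine ⟨fun _ => by positivity, ?_⟩
    rw [mul_one_div, div_lt_one (by positivity)]
    linarith

theorem closure_interior_refSimplex (n : ℕ) :
    closure (interior (refSimplex n)) = refSimplex n := by
  rw [(convex_refSimplex n).closure_interior_eq_closure_of_nonempty_interior
    (nonempty_interior_refSimplex n), (isCompact_refSimplex n).isClosed.closure_eq]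

theorem lattice_mem_refSimplex {n k : ℕ} (hk : 1 ≤ k) {a : Fin n → ℕ} (ha : ∑ i, a i ≤ k) :
    (WithLp.toLp 2 fun i => (a i : ℝ) / k) ∈ refSimplex n := by
  refine ⟨fun i => by simp only; positivity, ?_⟩
  simp only [← Finset.sum_div]
  exact div_le_one_of_le₀ (by exact_mod_cast ha) (by positivity)

/-- The polynomial function on Euclidean space given by a multivariate polynomial. -/
noncomputable def polyFun {n : ℕ} (P : MvPolynomial (Fin n) ℝ) (x : EuclideanSpace ℝ (Fin n)) : ℝ :=
  MvPolynomial.eval (fun i => x i) P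

/-- The gradient of a multivariate polynomial. -/
noncomputable def polyGrad {n : ℕ} (P : MvPolynomial (Fin n) ℝ) (x : EuclideanSpace ℝ (Fin n)) :
    EuclideanSpace ℝ (Fin n) :=
  WithLp.toLp 2 fun i => polyFun (MvPolynomial.pderiv i P) x

theorem continuous_polyFun {n : ℕ} (P : MvPolynomial (Fin n) ℝ) : Continuous (polyFun P) :=
  (MvPolynomial.continuous_eval P).comp (by fun_prop)

theorem continuous_polyGrad {n : ℕ} (P : MvPolynomial (Fin n) ℝ) : Continuous (polyGrad P) := by
  have := fun i => continuous_polyFun (MvPolynomial.pderiv i P)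
  unfold polyGrad
  fun_prop

theorem hasGradientAt_polyFun {n : ℕ} (P : MvPolynomial (Fin n) ℝ)
    (x : EuclideanSpace ℝ (Fin n)) : HasGradientAt (polyFun P) (polyGrad P x) x := by
  rw [hasGradientAt_iff_hasFDerivAt]
  induction P using MvPolynomial.induction_on with
  | C a =>
    have h1 : polyFun (MvPolynomial.C a : MvPolynomial (Fin n) ℝ) = fun _ => a := by
      ext; simp [polyFun]
    have h2 : polyGrad (MvPolynomial.C a : MvPolynomial (Fin n) ℝ) x = 0 := by
      ext; simp [polyFun, polyGrad]
    rw [h1, h2, map_zero]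
    exact hasFDerivAt_const a x
  | add P Q hP hQ =>
    have h1 : polyFun (P + Q) = polyFun P + polyFun Q := by ext; simp [polyFun]
    have h2 : polyGrad (P + Q) x = polyGrad P x + polyGrad Q x := by
      ext; simp [polyFun, polyGrad]
    rw [h1, h2, map_add]
    exact hP.add hQ
  | mul_X P i hP =>
    have h1 : polyFun (P * MvPolynomial.X i) = fun x => polyFun P x * x i := by
      ext; simp [polyFun]
    have h3 : HasFDerivAt (fun x : EuclideanSpace ℝ (Fin n) => x i)
        (EuclideanSpace.proj i : EuclideanSpace ℝ (Fin n) →L[ℝ] ℝ) x :=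
      (EuclideanSpace.proj (𝕜 := ℝ) i).hasFDerivAt
    rw [h1]
    refine (hP.mul h3).congr_fderiv ?_
    ext w
    have h4 : ∀ j, polyFun (MvPolynomial.pderiv j (P * MvPolynomial.X i)) x =
        polyFun (MvPolynomial.pderiv j P) x * x i + polyFun P x * (Pi.single i 1 : Fin n → ℝ) j := by
      intro j
      rcases eq_or_ne i j with rfl | hij
      · simp [polyFun]
        ring
      · simp [polyFun, MvPolynomial.pderiv_X, hij, Ne.symm hij]
        ring
    simp only [_root_.add_apply, _root_.smul_apply, InnerProductSpace.toDual_apply_apply,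
      PiLp.inner_apply, polyGrad, h4, smul_eq_mul]
    simp only [RCLike.inner_apply, conj_trivial, mul_add, Finset.sum_add_distrib, Finset.mul_sum,
      PiLp.proj_apply]
    rw [add_comm]
    congr 1
    · exact Finset.sum_congr rfl fun j _ => by ring
    · rw [Finset.sum_eq_single i (fun j _ hj => by simp [hj]) (by simp)]
      simp [mul_comm]

theorem polyFun_eq_zero_of_eqOn {n k : ℕ} (hk : 1 ≤ k) {P : MvPolynomial (Fin n) ℝ}
    (hP : P.totalDegree ≤ k) (h : ∀ y ∈ refSimplex n, polyFun P y = 0) : P = 0 := by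
  refine eq_zero_of_eval_lattice_eq_zero hk hP fun a ha => ?_
  have := h (WithLp.toLp 2 fun i => (a i : ℝ) / k) (lattice_mem_refSimplex hk ha)
  exact this

/-- On a finite-dimensional space, an injective linear map controls every other linear map. -/
theorem exists_norm_le_of_injective {V W U : Type*} [AddCommGroup V] [Module ℝ V]
    [Module.Finite ℝ V] [NormedAddCommGroup W] [NormedSpace ℝ W] [NormedAddCommGroup U]
    [NormedSpace ℝ U] (f : V →ₗ[ℝ] W) (g : V →ₗ[ℝ] U) (hf : Function.Injective f) :
    ∃ C, 0 ≤ C ∧ ∀ v, ‖g v‖ ≤ C * ‖f v‖ := by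
  let b := Module.finBasis ℝ V
  let e := b.equivFun.symm
  obtain ⟨K, -, hK⟩ :=
    (LinearMap.injective_iff_antilipschitz (f ∘ₗ e.toLinearMap)).1 (hf.comp e.injective)
  let g' := (g ∘ₗ e.toLinearMap).toContinuousLinearMap
  refine ⟨‖g'‖ * K, by positivity, fun v => ?_⟩
  have h1 := hK.le_mul_dist (e.symm v) 0
  simp only [dist_zero_right, map_zero, LinearMap.comp_apply, LinearEquiv.coe_coe,
    LinearEquiv.apply_symm_apply] at h1
  have h2 := g'.le_opNorm (e.symm v)
  simp only [g', LinearMap.coe_toContinuousLinearMap', LinearMap.comp_apply, LinearEquiv.coe_coe,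
    LinearEquiv.apply_symm_apply] at h2
  refine h2.trans ?_
  rw [mul_assoc]
  gcongr

/-- The restriction of polynomials of bounded degree to the reference simplex, after applying
a linear map. -/
noncomputable def restrictPoly {n k : ℕ} (D : MvPolynomial (Fin n) ℝ →ₗ[ℝ] MvPolynomial (Fin n) ℝ) :
    MvPolynomial.restrictTotalDegree (Fin n) ℝ k →ₗ[ℝ] C(refSimplex n, ℝ) where
  toFun P := ⟨fun y => polyFun (D P.1) y, (continuous_polyFun _).comp continuous_subtype_val⟩
  map_add' P Q := by ext; simp [polyFun]
  map_smul' c P := by ext; simp [polyFun, MvPolynomial.smul_eval]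

instance (n : ℕ) : CompactSpace (refSimplex n) :=
  isCompact_iff_compactSpace.1 (isCompact_refSimplex n)

theorem abs_polyFun_le_norm_restrictPoly {n k : ℕ}
    (D : MvPolynomial (Fin n) ℝ →ₗ[ℝ] MvPolynomial (Fin n) ℝ)
    (P : MvPolynomial.restrictTotalDegree (Fin n) ℝ k) {y} (hy : y ∈ refSimplex n) :
    |polyFun (D P.1) y| ≤ ‖restrictPoly D P‖ :=
  (restrictPoly D P).norm_coe_le_norm ⟨y, hy⟩

/-- On the reference simplex, a polynomial is bounded by its values at the lattice points, by
unisolvence and the equivalence of norms. -/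
theorem exists_abs_polyFun_le_nodes (n : ℕ) {k : ℕ} (hk : 1 ≤ k) :
    ∃ C, 0 ≤ C ∧ ∀ P : MvPolynomial (Fin n) ℝ, P.totalDegree ≤ k → ∀ M : ℝ, 0 ≤ M →
      (∀ a : Fin n → ℕ, ∑ i, a i ≤ k →
        |polyFun P (WithLp.toLp 2 fun i => (a i : ℝ) / k)| ≤ M) →
      ∀ y ∈ refSimplex n, |polyFun P y| ≤ C * M := by
  let S := {a : Fin n → Fin (k + 1) // ∑ i, (a i : ℕ) ≤ k}
  let f : MvPolynomial.restrictTotalDegree (Fin n) ℝ k →ₗ[ℝ] (S → ℝ) :=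
    { toFun := fun P a => polyFun P.1 (WithLp.toLp 2 fun i => ((a.1 i : ℕ) : ℝ) / k)
      map_add' := fun P Q => by ext; simp [polyFun]
      map_smul' := fun c P => by ext; simp [polyFun, MvPolynomial.smul_eval] }
  have hf : Function.Injective f := by
    refine (injective_iff_map_eq_zero f).2 fun P hP => Subtype.ext ?_
    refine eq_zero_of_eval_lattice_eq_zero hk
      ((MvPolynomial.mem_restrictTotalDegree _ _ _).1 P.2) fun a ha => ?_
    have hak : ∀ i, a i < k + 1 := fun i =>
      Nat.lt_succ_of_le ((Finset.single_le_sum (fun i _ => Nat.zero_le (a i))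
        (Finset.mem_univ i)).trans ha)
    exact congrFun hP (⟨fun i => ⟨a i, hak i⟩, ha⟩ : S)
  obtain ⟨C, hC, h⟩ := exists_norm_le_of_injective f (restrictPoly LinearMap.id) hf
  refine ⟨C, hC, fun P hP M hM hPM y hy => ?_⟩
  let P' : MvPolynomial.restrictTotalDegree (Fin n) ℝ k :=
    ⟨P, (MvPolynomial.mem_restrictTotalDegree _ _ _).2 hP⟩
  refine (abs_polyFun_le_norm_restrictPoly LinearMap.id P' hy).trans ((h P').trans ?_)
  refine mul_le_mul_of_nonneg_left ((pi_norm_le_iff_of_nonneg hM).2 fun a => ?_) hC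
  exact hPM (fun i => a.1 i) a.2

/-- The embedding of polynomials of bounded degree into `L²` of the reference simplex. -/
theorem exists_injective_toL2 (n : ℕ) {k : ℕ} (hk : 1 ≤ k) :
    ∃ f : MvPolynomial.restrictTotalDegree (Fin n) ℝ k →ₗ[ℝ]
        Lp ℝ 2 (volume.restrict (refSimplex n)),
      Function.Injective f ∧ ∀ P, ‖f P‖ ^ 2 = ∫ y in refSimplex n, polyFun P.1 y ^ 2 := by
  have hfin : IsFiniteMeasure (volume.restrict (refSimplex n)) :=
    ⟨by simpa using (isCompact_refSimplex n).measure_lt_top⟩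
  have hmem : ∀ P : MvPolynomial (Fin n) ℝ,
      MemLp (polyFun P) 2 (volume.restrict (refSimplex n)) := by
    intro P
    obtain ⟨C, hC⟩ := (isCompact_refSimplex n).exists_bound_of_continuousOn
      (continuous_polyFun P).continuousOn
    refine MemLp.of_bound (continuous_polyFun P).aestronglyMeasurable C ?_
    exact (ae_restrict_iff' (isCompact_refSimplex n).measurableSet).2 (.of_forall hC)
  let f : MvPolynomial.restrictTotalDegree (Fin n) ℝ k →ₗ[ℝ]
        Lp ℝ 2 (volume.restrict (refSimplex n)) :=
    { toFun := fun P => (hmem P.1).toLp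
      map_add' := fun P Q => by
        rw [← MemLp.toLp_add]
        congr 1
        ext; simp [polyFun]
      map_smul' := fun c P => by
        rw [RingHom.id_apply, ← MemLp.toLp_const_smul]
        congr 1
        ext; simp [polyFun, MvPolynomial.smul_eval] }
  refine ⟨f, (injective_iff_map_eq_zero f).2 fun P hP => Subtype.ext ?_, fun P => ?_⟩
  · have h0 : polyFun P.1 =ᵐ[volume.restrict (refSimplex n)] 0 := by
      have h1 := MemLp.coeFn_toLp (hmem P.1)
      have h2 : (hmem P.1).toLp = 0 := hP
      rw [h2] at h1
      exact h1.symm.trans (Lp.coeFn_zero _ _ _)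
    have h1 : EqOn (polyFun P.1) 0 (interior (refSimplex n)) :=
      Measure.eqOn_open_of_ae_eq (ae_restrict_of_ae_restrict_of_subset interior_subset h0)
        isOpen_interior (continuous_polyFun _).continuousOn continuousOn_const
    have h2 := h1.closure (continuous_polyFun _) continuous_const
    rw [closure_interior_refSimplex] at h2
    exact polyFun_eq_zero_of_eqOn hk ((MvPolynomial.mem_restrictTotalDegree _ _ _).1 P.2) h2
  · rw [← real_inner_self_eq_norm_sq, L2.inner_def]
    refine integral_congr_ae ?_
    filter_upwards [MemLp.coeFn_toLp (hmem P.1)] with y hy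
    have : ((f P : Lp ℝ 2 (volume.restrict (refSimplex n))) : _ → ℝ) y = polyFun P.1 y := hy
    simp [this, sq]

/-- Pointwise values of linear images of a polynomial of degree at most `k` on the reference simplex
are controlled by its `L²` norm. -/
theorem exists_sq_polyFun_le_integral (n : ℕ) {k : ℕ} (hk : 1 ≤ k)
    (D : MvPolynomial (Fin n) ℝ →ₗ[ℝ] MvPolynomial (Fin n) ℝ) :
    ∃ C, 0 ≤ C ∧ ∀ P : MvPolynomial (Fin n) ℝ, P.totalDegree ≤ k → ∀ y ∈ refSimplex n,
      polyFun (D P) y ^ 2 ≤ C * ∫ y in refSimplex n, polyFun P y ^ 2 := by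
  obtain ⟨f, hf, hf2⟩ := exists_injective_toL2 n hk
  obtain ⟨C, hC, h⟩ := exists_norm_le_of_injective f (restrictPoly D) hf
  refine ⟨C ^ 2, by positivity, fun P hP y hy => ?_⟩
  let P' : MvPolynomial.restrictTotalDegree (Fin n) ℝ k :=
    ⟨P, (MvPolynomial.mem_restrictTotalDegree _ _ _).2 hP⟩
  rw [← hf2 P', ← mul_pow, ← sq_abs]
  gcongr
  exact (abs_polyFun_le_norm_restrictPoly D P' hy).trans (h P')

theorem exists_sq_norm_polyGrad_le_integral (n : ℕ) {k : ℕ} (hk : 1 ≤ k) :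
    ∃ C, 0 ≤ C ∧ ∀ P : MvPolynomial (Fin n) ℝ, P.totalDegree ≤ k → ∀ y ∈ refSimplex n,
      ‖polyGrad P y‖ ^ 2 ≤ C * ∫ y in refSimplex n, polyFun P y ^ 2 := by
  choose C hC h using fun i : Fin n =>
    exists_sq_polyFun_le_integral n hk (MvPolynomial.pderiv (R := ℝ) i).toLinearMap
  refine ⟨∑ i, C i, Finset.sum_nonneg fun i _ => hC i, fun P hP y hy => ?_⟩
  rw [EuclideanSpace.real_norm_sq_eq, Finset.sum_mul]
  exact Finset.sum_le_sum fun i _ => h i P hP y hy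

/-! ### Affine parametrizations of simplices -/

/-- The linear part of the affine parametrization of the simplex with vertices `v`. -/
noncomputable def edgeMap {d n : ℕ} (v : Fin (n + 1) → EuclideanSpace ℝ (Fin d)) :
    EuclideanSpace ℝ (Fin n) →ₗ[ℝ] EuclideanSpace ℝ (Fin d) where
  toFun y := ∑ i, y i • (v i.succ - v 0)
  map_add' x y := by simp [add_smul, Finset.sum_add_distrib]
  map_smul' c x := by simp [mul_smul, Finset.smul_sum]

theorem edgeMap_apply {d n : ℕ} (v : Fin (n + 1) → EuclideanSpace ℝ (Fin d)) (y) :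
    edgeMap v y = ∑ i, y i • (v i.succ - v 0) := rfl

/-- The affine parametrization of the simplex with vertices `v` by the reference simplex. -/
noncomputable def param {d n : ℕ} (v : Fin (n + 1) → EuclideanSpace ℝ (Fin d))
    (y : EuclideanSpace ℝ (Fin n)) : EuclideanSpace ℝ (Fin d) :=
  v 0 + edgeMap v y

theorem param_eq_sum {d n : ℕ} (v : Fin (n + 1) → EuclideanSpace ℝ (Fin d))
    (y : EuclideanSpace ℝ (Fin n)) :
    param v y = ∑ i, (Fin.cons (1 - ∑ i, y i) (fun i => y i) : Fin (n + 1) → ℝ) i • v i := by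
  simp only [param, edgeMap_apply, Fin.sum_univ_succ, Fin.cons_zero, Fin.cons_succ, smul_sub,
    Finset.sum_sub_distrib, sub_smul, one_smul, Finset.sum_smul]
  abel

theorem continuous_param {d n : ℕ} (v : Fin (n + 1) → EuclideanSpace ℝ (Fin d)) :
    Continuous (param v) :=
  continuous_const.add (LinearMap.continuous_of_finiteDimensional _)

theorem image_param_refSimplex {d n : ℕ} (v : Fin (n + 1) → EuclideanSpace ℝ (Fin d)) :
    param v '' refSimplex n = convexHull ℝ (range v) := by
  rw [convexHull_range_eq_exists_affineCombination]
  ext x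
  constructor
  · rintro ⟨y, hy, rfl⟩
    have hsum : ∑ i, (Fin.cons (1 - ∑ i, y i) (fun i => y i) : Fin (n + 1) → ℝ) i = 1 := by
      simp [Fin.sum_univ_succ]
    refine ⟨Finset.univ, Fin.cons (1 - ∑ i, y i) (fun i => y i), fun i _ => ?_, hsum, ?_⟩
    · refine Fin.cases ?_ (fun j => ?_) i
      · simpa using hy.2
      · simpa using hy.1 j
    · rw [Finset.affineCombination_eq_linear_combination _ _ _ hsum, param_eq_sum]
  · rintro ⟨s, w, hw, hsum, rfl⟩
    classical
    let w' : Fin (n + 1) → ℝ := fun i => if i ∈ s then w i else 0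
    have hw' : ∑ i, w' i = 1 := by simpa [w', Finset.sum_ite_mem] using hsum
    have hnn : ∀ i, 0 ≤ w' i := fun i => by
      by_cases hi : i ∈ s
      · simpa [w', hi] using hw i hi
      · simp [w', hi]
    rw [Fin.sum_univ_succ] at hw'
    refine ⟨WithLp.toLp 2 fun i => w' i.succ, ⟨fun i => hnn _, ?_⟩, ?_⟩
    · have := hnn 0
      simp only
      linarith
    · rw [Finset.affineCombination_eq_linear_combination _ _ _ hsum, param_eq_sum]
      have h0 : (Fin.cons (1 - ∑ i : Fin n, w' i.succ) (fun i => w' i.succ) : Fin (n + 1) → ℝ)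
          = w' := by
        ext i
        refine Fin.cases ?_ (fun j => ?_) i
        · simp only [Fin.cons_zero]; linarith
        · simp
      simp only [h0, w', ite_smul, zero_smul, Finset.sum_ite_mem, Finset.univ_inter]

theorem injective_edgeMap {d n : ℕ} {v : Fin (n + 1) → EuclideanSpace ℝ (Fin d)}
    (hv : AffineIndependent ℝ v) : Function.Injective (edgeMap v) := by
  refine (injective_iff_map_eq_zero _).2 fun y hy => ?_
  have h1 := hv.eq_zero_of_sum_eq_zero (s := Finset.univ)
    (w := Fin.cons (-∑ i, y i) (fun i => y i)) (by simp [Fin.sum_univ_succ]) (by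
      rw [edgeMap_apply] at hy
      simp only [Fin.sum_univ_succ, Fin.cons_zero, Fin.cons_succ, neg_smul, Finset.sum_smul]
      simp only [smul_sub, Finset.sum_sub_distrib] at hy
      rw [← hy]; abel)
  ext i
  simpa using h1 i.succ (Finset.mem_univ _)

theorem injective_param {d n : ℕ} {v : Fin (n + 1) → EuclideanSpace ℝ (Fin d)}
    (hv : AffineIndependent ℝ v) : Function.Injective (param v) :=
  fun _ _ h => injective_edgeMap hv (add_left_cancel h)

theorem measurableEmbedding_param {d n : ℕ} {v : Fin (n + 1) → EuclideanSpace ℝ (Fin d)}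
    (hv : AffineIndependent ℝ v) : MeasurableEmbedding (param v) := by
  have h : Topology.IsClosedEmbedding (edgeMap v) :=
    LinearMap.isClosedEmbedding_of_injective (LinearMap.ker_eq_bot.2 (injective_edgeMap hv))
  exact ((Homeomorph.addLeft (v 0)).isClosedEmbedding.comp h).measurableEmbedding

/-- Polynomials pull back to polynomials under affine parametrizations of simplices. -/
noncomputable def pullPoly {d n : ℕ} (v : Fin (n + 1) → EuclideanSpace ℝ (Fin d))
    (P : MvPolynomial (Fin d) ℝ) : MvPolynomial (Fin n) ℝ :=
  MvPolynomial.bind₁ (fun j => MvPolynomial.C (v 0 j) +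
    ∑ i, MvPolynomial.C ((v i.succ - v 0) j) * MvPolynomial.X i) P

theorem polyFun_pullPoly {d n : ℕ} (v : Fin (n + 1) → EuclideanSpace ℝ (Fin d))
    (P : MvPolynomial (Fin d) ℝ) (y) : polyFun (pullPoly v P) y = polyFun P (param v y) := by
  unfold polyFun pullPoly
  rw [MvPolynomial.eval, MvPolynomial.eval₂Hom_bind₁]
  congr 2
  ext j
  simp [param, edgeMap_apply, mul_comm]

theorem totalDegree_pullPoly_le {d n : ℕ} (v : Fin (n + 1) → EuclideanSpace ℝ (Fin d))
    (P : MvPolynomial (Fin d) ℝ) : (pullPoly v P).totalDegree ≤ P.totalDegree := by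
  unfold pullPoly
  rw [MvPolynomial.bind₁, MvPolynomial.aeval_def, MvPolynomial.eval₂_eq']
  refine MvPolynomial.totalDegree_finsetSum_le fun m hm => ?_
  refine (MvPolynomial.totalDegree_mul _ _).trans ?_
  rw [MvPolynomial.algebraMap_eq, MvPolynomial.totalDegree_C, zero_add]
  refine (MvPolynomial.totalDegree_finsetProd _ _).trans ?_
  have hle : ∀ j, (MvPolynomial.C (v 0 j) +
    ∑ i, MvPolynomial.C ((v i.succ - v 0) j) * MvPolynomial.X i :
      MvPolynomial (Fin n) ℝ).totalDegree ≤ 1 := fun j => by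
    refine (MvPolynomial.totalDegree_add _ _).trans (max_le (by simp) ?_)
    refine MvPolynomial.totalDegree_finsetSum_le fun i _ => ?_
    refine (MvPolynomial.totalDegree_mul _ _).trans ?_
    rw [MvPolynomial.totalDegree_C, MvPolynomial.totalDegree_X]
  have h2 : ∑ j, m j ≤ P.totalDegree := by
    have := MvPolynomial.le_totalDegree hm
    rwa [Finsupp.sum_fintype _ _ (fun _ => rfl)] at this
  refine le_trans (Finset.sum_le_sum fun j _ => ?_) h2
  refine (MvPolynomial.totalDegree_pow _ _).trans ?_
  calc m j * _ ≤ m j * 1 := Nat.mul_le_mul_left _ (hle j)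
    _ = m j := mul_one _

/-- Chain rule for the pull-back of a polynomial. -/
theorem inner_polyGrad_pullPoly {d n : ℕ} (v : Fin (n + 1) → EuclideanSpace ℝ (Fin d))
    (P : MvPolynomial (Fin d) ℝ) (y w) :
    inner ℝ (polyGrad (pullPoly v P) y) w = inner ℝ (polyGrad P (param v y)) (edgeMap v w) := by
  have h1 := (hasGradientAt_iff_hasFDerivAt.1 (hasGradientAt_polyFun (pullPoly v P) y))
  have h2 := (hasGradientAt_iff_hasFDerivAt.1 (hasGradientAt_polyFun P (param v y)))
  have h3 : HasFDerivAt (param v) (edgeMap v).toContinuousLinearMap y :=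
    ((edgeMap v).toContinuousLinearMap.hasFDerivAt).const_add (v 0)
  have h4 := h2.comp y h3
  have h5 : polyFun P ∘ param v = polyFun (pullPoly v P) := by
    ext y; exact (polyFun_pullPoly v P y).symm
  rw [h5] at h4
  have := congrArg (fun f => f w) (h1.unique h4)
  simpa using this

/-! ### Integration over simplices -/

theorem euclideanHausdorffMeasure_image_param {d n : ℕ}
    (v : Fin (n + 1) → EuclideanSpace ℝ (Fin d)) (B : Set (EuclideanSpace ℝ (Fin n))) :
    μHE[n] (param v '' B) = ENNReal.ofReal (edgeMap v).normDet * volume B := by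
  have h := (edgeMap v).euclideanHausdorffMeasure_image_eq_normDet_mul_volume B
  rw [finrank_euclideanSpace_fin] at h
  rw [← h]
  have : param v '' B = IsometryEquiv.addLeft (v 0) '' (edgeMap v '' B) := by
    rw [image_image]; rfl
  rw [this, (IsometryEquiv.addLeft (v 0)).isometry.euclideanHausdorffMeasure_image]

theorem restrict_convexHull_eq_map {d n : ℕ} {v : Fin (n + 1) → EuclideanSpace ℝ (Fin d)}
    (hv : AffineIndependent ℝ v) :
    (μHE[n] : Measure (EuclideanSpace ℝ (Fin d))).restrict (convexHull ℝ (range v)) =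
      (ENNReal.ofReal (edgeMap v).normDet • volume.restrict (refSimplex n)).map (param v) := by
  ext B hB
  rw [Measure.restrict_apply hB, Measure.map_apply (measurableEmbedding_param hv).measurable hB,
    Measure.smul_apply, Measure.restrict_apply ((measurableEmbedding_param hv).measurable hB),
    smul_eq_mul, ← euclideanHausdorffMeasure_image_param, ← image_param_refSimplex,
    image_preimage_inter]

theorem setIntegral_convexHull {d n : ℕ} {v : Fin (n + 1) → EuclideanSpace ℝ (Fin d)}
    (hv : AffineIndependent ℝ v) (f : EuclideanSpace ℝ (Fin d) → ℝ) :
    ∫ x in convexHull ℝ (range v), f x ∂μHE[n] =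
      (edgeMap v).normDet * ∫ y in refSimplex n, f (param v y) := by
  rw [restrict_convexHull_eq_map hv, (measurableEmbedding_param hv).integral_map,
    integral_smul_measure, ENNReal.toReal_ofReal (LinearMap.normDet_nonneg _), smul_eq_mul]

theorem euclideanHausdorffMeasure_convexHull {d n : ℕ}
    (v : Fin (n + 1) → EuclideanSpace ℝ (Fin d)) :
    μHE[n] (convexHull ℝ (range v)) =
      ENNReal.ofReal (edgeMap v).normDet * volume (refSimplex n) := by
  rw [← image_param_refSimplex, euclideanHausdorffMeasure_image_param]

theorem exists_enumeration {d n : ℕ} {s : Finset (EuclideanSpace ℝ (Fin d))}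
    (hs : s.card = n + 1) (hind : AffineIndependent ℝ ((↑) : s → EuclideanSpace ℝ (Fin d))) :
    ∃ v : Fin (n + 1) → EuclideanSpace ℝ (Fin d), AffineIndependent ℝ v ∧
      range v = (s : Set (EuclideanSpace ℝ (Fin d))) := by
  let e := s.equivFinOfCardEq hs
  refine ⟨fun i => e.symm i, hind.comp_embedding e.symm.toEmbedding, ?_⟩
  ext x
  constructor
  · rintro ⟨i, rfl⟩
    exact (e.symm i).2
  · intro hx
    exact ⟨e ⟨x, hx⟩, by simp⟩

theorem euclideanHausdorffMeasure_convexHull_lt_top {d n : ℕ}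
    {s : Finset (EuclideanSpace ℝ (Fin d))} (hs : s.card = n + 1)
    (hind : AffineIndependent ℝ ((↑) : s → EuclideanSpace ℝ (Fin d))) :
    μHE[n] (convexHull ℝ (s : Set (EuclideanSpace ℝ (Fin d)))) < ⊤ := by
  obtain ⟨v, -, hvs⟩ := exists_enumeration hs hind
  rw [← hvs, euclideanHausdorffMeasure_convexHull]
  exact ENNReal.mul_lt_top ENNReal.ofReal_lt_top (isCompact_refSimplex n).measure_lt_top

theorem euclideanHausdorffMeasure_convexHull_eq_zero {d n : ℕ}
    {s : Finset (EuclideanSpace ℝ (Fin d))} (hs : s.card ≤ n)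
    (hind : AffineIndependent ℝ ((↑) : s → EuclideanSpace ℝ (Fin d))) :
    μHE[n] (convexHull ℝ (s : Set (EuclideanSpace ℝ (Fin d)))) = 0 := by
  rcases Nat.eq_zero_or_pos s.card with h0 | h0
  · simp [Finset.card_eq_zero.1 h0]
  · obtain ⟨m, hm⟩ : ∃ m, s.card = m + 1 := ⟨s.card - 1, by omega⟩
    exact (euclideanHausdorffMeasure_zero_or_top (show m < n by omega) _).resolve_right
      (euclideanHausdorffMeasure_convexHull_lt_top hm hind).ne

/-! ### Quantitative nondegeneracy -/

/-- If a simplex contains a ball of radius `ρ`, then its barycentric coordinates have Lipschitz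
constant at most `1 / (2ρ)`: along a diameter of the ball they change by at most one. -/
theorem abs_weight_mul_le_norm {d : ℕ} {t : Finset (EuclideanSpace ℝ (Fin d))}
    (hind : AffineIndependent ℝ ((↑) : t → EuclideanSpace ℝ (Fin d)))
    {x : EuclideanSpace ℝ (Fin d)} {ρ : ℝ} (hρ : 0 ≤ ρ)
    (hball : Metric.closedBall x ρ ⊆ convexHull ℝ (t : Set (EuclideanSpace ℝ (Fin d))))
    {l : EuclideanSpace ℝ (Fin d) → ℝ} (hl : ∑ v ∈ t, l v = 0) {v} (hv : v ∈ t) :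
    |l v| * (2 * ρ) ≤ ‖∑ v ∈ t, l v • v‖ := by
  have hind' : ∀ w : EuclideanSpace ℝ (Fin d) → ℝ, ∑ v ∈ t, w v = 0 → ∑ v ∈ t, w v • v = 0 →
      ∀ v ∈ t, w v = 0 := by
    intro w h1 h2 v hv
    refine hind.eq_zero_of_sum_eq_zero (s := Finset.univ) (w := fun v : t => w v) ?_ ?_ ⟨v, hv⟩
      (Finset.mem_univ _)
    · rw [← h1]; exact Finset.sum_coe_sort t w
    · rw [← h2]; exact Finset.sum_coe_sort t (fun v => w v • v)
  set z := ∑ v ∈ t, l v • v with hz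
  rcases eq_or_ne z 0 with h0 | h0
  · rw [h0, hind' l hl (hz ▸ h0) v hv]; simp
  have hzpos : 0 < ‖z‖ := norm_pos_iff.2 h0
  have hmem : ∀ c : ℝ, |c| * ‖z‖ ≤ ρ → x + c • z ∈ Metric.closedBall x ρ := fun c hc => by
    simpa [norm_smul] using hc
  have hc : |ρ / ‖z‖| * ‖z‖ ≤ ρ := by
    rw [abs_of_nonneg (by positivity)]; field_simp; exact le_rfl
  have hc' : |-(ρ / ‖z‖)| * ‖z‖ ≤ ρ := by rwa [abs_neg]
  obtain ⟨w₁, hw₁, hs₁, h₁⟩ := Finset.mem_convexHull'.1 (hball (hmem _ hc))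
  obtain ⟨w₂, hw₂, hs₂, h₂⟩ := Finset.mem_convexHull'.1 (hball (hmem _ hc'))
  have hkey := hind' (fun v => w₁ v - w₂ v - (2 * ρ / ‖z‖) * l v)
    (by simp [Finset.sum_sub_distrib, hs₁, hs₂, ← Finset.mul_sum, hl])
    (by
      simp only [sub_smul, Finset.sum_sub_distrib, h₁, h₂, mul_smul, ← Finset.smul_sum, ← hz]
      module) v hv
  have hb₁ : w₁ v ≤ 1 := hs₁ ▸ Finset.single_le_sum (f := w₁) hw₁ hv
  have hb₂ : w₂ v ≤ 1 := hs₂ ▸ Finset.single_le_sum (f := w₂) hw₂ hv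
  have habs : |2 * ρ / ‖z‖ * l v| ≤ 1 := by
    rw [abs_le]
    constructor <;> linarith [hw₁ v hv, hw₂ v hv]
  rw [abs_mul, abs_of_nonneg (by positivity), div_mul_eq_mul_div, div_le_one hzpos] at habs
  linarith

theorem norm_mul_le_norm_edgeMap {d n : ℕ} {t : Finset (EuclideanSpace ℝ (Fin d))}
    (hind : AffineIndependent ℝ ((↑) : t → EuclideanSpace ℝ (Fin d)))
    {x : EuclideanSpace ℝ (Fin d)} {ρ : ℝ} (hρ : 0 ≤ ρ)
    (hball : Metric.closedBall x ρ ⊆ convexHull ℝ (t : Set (EuclideanSpace ℝ (Fin d))))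
    {v : Fin (n + 1) → EuclideanSpace ℝ (Fin d)} (hv : Function.Injective v)
    (hvt : range v ⊆ t) (w : EuclideanSpace ℝ (Fin n)) :
    2 * ρ * ‖w‖ ≤ n * ‖edgeMap v w‖ := by
  classical
  let c : Fin (n + 1) → ℝ := Fin.cons (-∑ i, w i) (fun i => w i)
  let l : EuclideanSpace ℝ (Fin d) → ℝ := Function.extend v c 0
  have hlv : ∀ i, l (v i) = c i := fun i => hv.extend_apply _ _ _
  have himg : Finset.univ.image v ⊆ t := fun x hx => by
    obtain ⟨i, -, rfl⟩ := Finset.mem_image.1 hx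
    exact hvt ⟨i, rfl⟩
  have hl0 : ∀ x ∈ t, x ∉ Finset.univ.image v → l x = 0 := fun x _ hx =>
    Function.extend_apply' _ _ _ fun ⟨i, hi⟩ => hx (Finset.mem_image.2 ⟨i, Finset.mem_univ _, hi⟩)
  have h1 : ∑ v ∈ t, l v = 0 := by
    rw [← Finset.sum_subset himg hl0, Finset.sum_image (fun _ _ _ _ h => hv h)]
    simp only [hlv]
    simp [c, Fin.sum_univ_succ]
  have h2 : ∑ v ∈ t, l v • v = edgeMap v w := by
    rw [← Finset.sum_subset himg (fun x hx h => by rw [hl0 x hx h, zero_smul]),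
      Finset.sum_image (fun _ _ _ _ h => hv h)]
    simp only [hlv, c, Fin.sum_univ_succ, Fin.cons_zero, Fin.cons_succ, edgeMap_apply, smul_sub,
      Finset.sum_sub_distrib, neg_smul, Finset.sum_smul]
    abel
  have h3 : ∀ i, 2 * ρ * |w i| ≤ ‖edgeMap v w‖ := fun i => by
    have := abs_weight_mul_le_norm hind hρ hball h1 (hvt ⟨i.succ, rfl⟩)
    rw [hlv, h2] at this
    simpa [c, mul_comm] using this
  have h4 : ‖w‖ ≤ ∑ i, |w i| := by
    have hw : w = ∑ i, w i • EuclideanSpace.single i (1 : ℝ) := by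
      ext j; simp [Pi.single_apply]
    conv_lhs => rw [hw]
    refine (norm_sum_le _ _).trans (Finset.sum_le_sum fun i _ => ?_)
    simp [norm_smul]
  calc 2 * ρ * ‖w‖ ≤ 2 * ρ * ∑ i, |w i| := by gcongr
    _ = ∑ i, 2 * ρ * |w i| := Finset.mul_sum _ _ _
    _ ≤ ∑ _i : Fin n, ‖edgeMap v w‖ := Finset.sum_le_sum fun i _ => h3 i
    _ = n * ‖edgeMap v w‖ := by simp

/-- The area of a face of a simplex that contains a ball of radius `ρ` is at least of order
`ρ ^ n`, where `n` is the dimension of the face. -/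
theorem pow_le_normDet_edgeMap {d n : ℕ} (hn : 1 ≤ n) {t : Finset (EuclideanSpace ℝ (Fin d))}
    (hind : AffineIndependent ℝ ((↑) : t → EuclideanSpace ℝ (Fin d)))
    {x : EuclideanSpace ℝ (Fin d)} {ρ : ℝ} (hρ : 0 < ρ)
    (hball : Metric.closedBall x ρ ⊆ convexHull ℝ (t : Set (EuclideanSpace ℝ (Fin d))))
    {v : Fin (n + 1) → EuclideanSpace ℝ (Fin d)} (hv : AffineIndependent ℝ v)
    (hvt : range v ⊆ t) : (2 * ρ / n) ^ n ≤ (edgeMap v).normDet := by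
  have hn' : (0 : ℝ) < n := by exact_mod_cast hn
  have hanti : AntilipschitzWith (n / (2 * ρ)).toNNReal (edgeMap v) := by
    refine AddMonoidHomClass.antilipschitz_of_bound _ fun w => ?_
    rw [Real.coe_toNNReal _ (by positivity), div_mul_eq_mul_div, le_div_iff₀ (by positivity),
      mul_comm]
    exact norm_mul_le_norm_edgeMap hind hρ.le hball hv.injective hvt w
  have h1 := hanti.le_hausdorffMeasure_image (d := n) (by positivity) (refSimplex n)
  have h2 := (edgeMap v).hausdorffMeasure_image (refSimplex n)
  rw [finrank_euclideanSpace_fin] at h2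
  set m := (μH[n] : Measure (EuclideanSpace ℝ (Fin n))) (refSimplex n) with hm
  have hm0 : m ≠ 0 := ((isOpen_interior.measure_pos _ (nonempty_interior_refSimplex n)).trans_le
    (measure_mono interior_subset)).ne'
  have hmt : m ≠ ⊤ := (isCompact_refSimplex n).measure_lt_top.ne
  rw [h2, ← mul_assoc] at h1
  have h3 : 1 ≤ ((n / (2 * ρ)).toNNReal : ENNReal) ^ (n : ℝ) * ENNReal.ofReal (edgeMap v).normDet :=
    (ENNReal.mul_le_mul_iff_left hm0 hmt).1 (by simpa using h1)
  rw [ENNReal.rpow_natCast, ← ENNReal.ofReal.eq_1, ← ENNReal.ofReal_pow (by positivity),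
    ← ENNReal.ofReal_mul (by positivity), ENNReal.one_le_ofReal] at h3
  have h4 : (2 * ρ / n) ^ n * (n / (2 * ρ)) ^ n = 1 := by
    rw [← mul_pow]
    field_simp
    simp
  have h5 : (0 : ℝ) < (n / (2 * ρ)) ^ n := by positivity
  refine le_of_mul_le_mul_right ?_ h5
  rw [h4, mul_comm]
  exact h3

/-! ### Cells of a mesh -/

theorem setIntegral_biUnion_of_aedisjoint {X ι : Type*} [MeasurableSpace X] {μ : Measure X}
    {F : Finset ι} {S : ι → Set X} {f : X → ℝ} (hS : ∀ i ∈ F, MeasurableSet (S i))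
    (hd : ∀ i ∈ F, ∀ j ∈ F, i ≠ j → μ (S i ∩ S j) = 0)
    (hf : ∀ i ∈ F, IntegrableOn f (S i) μ) :
    ∫ x in ⋃ i ∈ F, S i, f x ∂μ = ∑ i ∈ F, ∫ x in S i, f x ∂μ := by
  have h1 : (⋃ i ∈ F, S i) = ⋃ i : F, S i := by ext; simp
  have h2 := integral_iUnion_ae (μ := μ) (f := f) (s := fun i : F => S i)
    (fun i => (hS i i.2).nullMeasurableSet)
    (fun i j hij => hd i i.2 j j.2 fun h => hij (Subtype.ext h))
    (by rw [← h1]; exact integrableOn_finset_iUnion.2 hf)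
  rw [h1, h2, tsum_fintype]
  exact Finset.sum_coe_sort F fun i => ∫ x in S i, f x ∂μ

theorem sum_setIntegral_le_setIntegral {X ι : Type*} [MeasurableSpace X] {μ : Measure X}
    {F : Finset ι} {S : ι → Set X} {f : X → ℝ} {A : Set X} (hS : ∀ i ∈ F, MeasurableSet (S i))
    (hd : ∀ i ∈ F, ∀ j ∈ F, i ≠ j → μ (S i ∩ S j) = 0) (hA : ∀ i ∈ F, S i ⊆ A)
    (hf : IntegrableOn f A μ) (h0 : ∀ x, 0 ≤ f x) :
    ∑ i ∈ F, ∫ x in S i, f x ∂μ ≤ ∫ x in A, f x ∂μ := by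
  rw [← setIntegral_biUnion_of_aedisjoint hS hd fun i hi => hf.mono_set (hA i hi)]
  exact setIntegral_mono_set hf (.of_forall h0)
    (LE.le.eventuallyLE (iUnion₂_subset hA))

theorem setIntegral_le_sum_setIntegral {X ι : Type*} [MeasurableSpace X] {μ : Measure X}
    {F : Finset ι} {S : ι → Set X} {f : X → ℝ} {A : Set X} (hS : ∀ i ∈ F, MeasurableSet (S i))
    (hd : ∀ i ∈ F, ∀ j ∈ F, i ≠ j → μ (S i ∩ S j) = 0) (hA : A ⊆ ⋃ i ∈ F, S i)
    (hf : ∀ i ∈ F, IntegrableOn f (S i) μ) (h0 : ∀ x, 0 ≤ f x) :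
    ∫ x in A, f x ∂μ ≤ ∑ i ∈ F, ∫ x in S i, f x ∂μ := by
  rw [← setIntegral_biUnion_of_aedisjoint hS hd hf]
  exact setIntegral_mono_set (integrableOn_finset_iUnion.2 hf) (.of_forall h0)
    (LE.le.eventuallyLE hA)

section Mesh

variable {d : ℕ} {K : Geometry.SimplicialComplex ℝ (EuclideanSpace ℝ (Fin d))} {n : ℕ}
  {A : Set (EuclideanSpace ℝ (Fin d))}

theorem isCompact_convexHull_finset (s : Finset (EuclideanSpace ℝ (Fin d))) :
    IsCompact (convexHull ℝ (s : Set (EuclideanSpace ℝ (Fin d)))) :=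
  s.finite_toSet.isCompact_convexHull (𝕜 := ℝ)

theorem measurableSet_convexHull_finset (s : Finset (EuclideanSpace ℝ (Fin d))) :
    MeasurableSet (convexHull ℝ (s : Set (EuclideanSpace ℝ (Fin d)))) :=
  (isCompact_convexHull_finset s).measurableSet

theorem exists_enumeration_of_mem_cells {s : Finset (EuclideanSpace ℝ (Fin d))}
    (hs : s ∈ cells K n) : ∃ v : Fin (n + 1) → EuclideanSpace ℝ (Fin d), AffineIndependent ℝ v ∧
      range v = (s : Set (EuclideanSpace ℝ (Fin d))) :=
  exists_enumeration hs.2 (K.indep hs.1)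

/-- Distinct cells of the same dimension meet in a lower-dimensional face, hence in a null set. -/
theorem measure_inter_cells_eq_zero {s t : Finset (EuclideanSpace ℝ (Fin d))} (hs : s ∈ cells K n)
    (ht : t ∈ cells K n) (hst : s ≠ t) :
    μHE[n] (convexHull ℝ (s : Set (EuclideanSpace ℝ (Fin d))) ∩
      convexHull ℝ (t : Set (EuclideanSpace ℝ (Fin d)))) = 0 := by
  classical
  have h1 := K.inter_subset_convexHull hs.1 ht.1
  rw [← Finset.coe_inter] at h1
  refine measure_mono_null h1 ?_
  refine euclideanHausdorffMeasure_convexHull_eq_zero ?_ ?_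
  · have : s ∩ t ⊂ s := by
      refine Finset.ssubset_iff_subset_ne.2 ⟨Finset.inter_subset_left, fun h => hst ?_⟩
      exact Finset.eq_of_subset_of_card_le (Finset.inter_eq_left.1 h) (by rw [hs.2, ht.2])
    have := Finset.card_lt_card this
    have := hs.2
    omega
  · exact (K.indep hs.1).mono Finset.inter_subset_left

theorem finite_cells (h : K.faces.Finite) : (cells K n).Finite := h.subset fun _ hs => hs.1

theorem IsMesh.exists_cell (h : IsMesh K n A) {x} (hx : x ∈ A) :
    ∃ s ∈ cells K n, x ∈ convexHull ℝ (s : Set (EuclideanSpace ℝ (Fin d))) := by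
  rw [← h.space_eq, Geometry.SimplicialComplex.mem_space_iff] at hx
  obtain ⟨s, hs, hx⟩ := hx
  obtain ⟨t, ht, hst⟩ := h.pure s hs
  exact ⟨t, ht, convexHull_mono hst hx⟩

theorem IsMesh.convexHull_subset (h : IsMesh K n A) {s : Finset (EuclideanSpace ℝ (Fin d))}
    (hs : s ∈ K.faces) : convexHull ℝ (s : Set (EuclideanSpace ℝ (Fin d))) ⊆ A := by
  rw [← h.space_eq]
  exact Geometry.SimplicialComplex.convexHull_subset_space hs

theorem IsMesh.eq_biUnion_cells (h : IsMesh K n A) :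
    A = ⋃ s ∈ (finite_cells h.finite : (cells K n).Finite).toFinset,
      convexHull ℝ (s : Set (EuclideanSpace ℝ (Fin d))) := by
  ext x
  simp only [Finite.mem_toFinset, mem_iUnion, exists_prop]
  exact ⟨h.exists_cell, fun ⟨s, hs, hx⟩ => h.convexHull_subset hs.1 hx⟩

theorem IsMesh.isCompact (h : IsMesh K n A) : IsCompact A := by
  rw [h.eq_biUnion_cells]
  exact Finset.isCompact_biUnion _ fun s _ => isCompact_convexHull_finset s

theorem IsMesh.measure_lt_top (h : IsMesh K n A) : μHE[n] A < ⊤ := by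
  rw [h.eq_biUnion_cells]
  refine measure_biUnion_lt_top (Finset.finite_toSet _) fun s hs => ?_
  have hs' : s ∈ cells K n := by simpa using hs
  exact euclideanHausdorffMeasure_convexHull_lt_top hs'.2 (K.indep hs'.1)

theorem _root_.ContinuousOn.integrableOn_of_measure_lt_top {X : Type*} [TopologicalSpace X]
    [T2Space X] [MeasurableSpace X] [OpensMeasurableSpace X]
    {μ : Measure X} {S : Set X} {f : X → ℝ} (hS : IsCompact S) (hμ : μ S < ⊤)
    (hf : ContinuousOn f S) : IntegrableOn f S μ := by
  obtain ⟨C, hC⟩ := hS.exists_bound_of_continuousOn hf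
  exact IntegrableOn.of_bound hμ (hf.aestronglyMeasurable_of_isCompact hS hS.measurableSet) C
    ((ae_restrict_iff' hS.measurableSet).2 (.of_forall hC))

theorem diam_convexHull_le_meshWidth (h : K.faces.Finite) {s : Finset (EuclideanSpace ℝ (Fin d))}
    (hs : s ∈ K.faces) :
    Metric.diam (convexHull ℝ (s : Set (EuclideanSpace ℝ (Fin d)))) ≤ meshWidth K := by
  have := h.to_subtype
  exact le_ciSup (f := fun s : K.faces => Metric.diam
    (convexHull ℝ ((s : Finset (EuclideanSpace ℝ (Fin d))) : Set (EuclideanSpace ℝ (Fin d)))))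
    (Set.finite_range _).bddAbove ⟨s, hs⟩

theorem meshWidth_nonneg : 0 ≤ meshWidth K :=
  Real.iSup_nonneg fun _ => Metric.diam_nonneg

/-! ### Lagrange nodes -/

/-- The points of a cell with barycentric coordinates in `ℕ / k` are Lagrange nodes. -/
theorem param_lattice_mem_lagrangeNodes {k : ℕ} (hk : 1 ≤ k)
    {s : Finset (EuclideanSpace ℝ (Fin d))} (hs : s ∈ K.faces)
    {v : Fin (n + 1) → EuclideanSpace ℝ (Fin d)} (hv : AffineIndependent ℝ v)
    (hvs : range v = (s : Set (EuclideanSpace ℝ (Fin d)))) {a : Fin n → ℕ} (ha : ∑ i, a i ≤ k) :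
    param v (WithLp.toLp 2 fun i => (a i : ℝ) / k) ∈ lagrangeNodes K k := by
  classical
  have hk' : (k : ℝ) ≠ 0 := by positivity
  let c : Fin (n + 1) → ℕ := Fin.cons (k - ∑ i, a i) a
  have hs' : s = Finset.univ.image v := by
    apply Finset.coe_injective; rw [← hvs]; simp
  have hext : ∀ i, Function.extend v c 0 (v i) = c i := fun i => hv.injective.extend_apply _ _ _
  refine ⟨s, hs, Function.extend v c 0, ?_, ?_⟩
  · rw [hs', Finset.sum_image fun _ _ _ _ h => hv.injective h]
    simp only [hext, c, Fin.sum_univ_succ, Fin.cons_zero, Fin.cons_succ]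
    omega
  · rw [hs', Finset.sum_image fun _ _ _ _ h => hv.injective h, param_eq_sum]
    refine Finset.sum_congr rfl fun i _ => ?_
    rw [hext]
    congr 1
    refine Fin.cases ?_ (fun j => ?_) i
    · simp only [Fin.cons_zero, c, ← Finset.sum_div, Nat.cast_sub ha]
      push_cast
      field_simp
    · simp [c]

/-- A Lagrange node in a cell is a lattice point of that cell. -/
theorem exists_lattice_of_mem_lagrangeNodes {k : ℕ} (hk : 1 ≤ k)
    {s : Finset (EuclideanSpace ℝ (Fin d))} (hs : s ∈ K.faces)
    {v : Fin (n + 1) → EuclideanSpace ℝ (Fin d)} (hv : AffineIndependent ℝ v)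
    (hvs : range v = (s : Set (EuclideanSpace ℝ (Fin d)))) {z} (hz : z ∈ lagrangeNodes K k)
    (hzs : z ∈ convexHull ℝ (s : Set (EuclideanSpace ℝ (Fin d)))) :
    ∃ a : Fin n → ℕ, ∑ i, a i ≤ k ∧ z = param v (WithLp.toLp 2 fun i => (a i : ℝ) / k) := by
  classical
  have hk' : (k : ℝ) ≠ 0 := by positivity
  obtain ⟨t, ht, a, hak, rfl⟩ := hz
  have hzt : ∑ v ∈ t, ((a v : ℝ) / k) • v ∈
      convexHull ℝ (t : Set (EuclideanSpace ℝ (Fin d))) := by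
    refine Finset.mem_convexHull'.2 ⟨fun v => (a v : ℝ) / k, fun v _ => by positivity, ?_, rfl⟩
    rw [← Finset.sum_div, ← Nat.cast_sum, hak, div_self hk']
  have hmem := K.inter_subset_convexHull ht hs ⟨hzt, hzs⟩
  rw [← Finset.coe_inter] at hmem
  obtain ⟨w, hw, hw1, hwz⟩ := Finset.mem_convexHull'.1 hmem
  -- barycentric coordinates in `t` are unique, so the coordinates of `z` vanish outside `s`
  have huniq : ∀ v ∈ t, (a v : ℝ) / k - (if v ∈ s then w v else 0) = 0 := by
    intro v hv
    refine (K.indep ht).eq_zero_of_sum_eq_zero (s := Finset.univ)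
      (w := fun v : t => (a v : ℝ) / k - (if (v : EuclideanSpace ℝ (Fin d)) ∈ s then w v else 0))
      ?_ ?_ ⟨v, hv⟩ (Finset.mem_univ _)
    · rw [Finset.sum_coe_sort t (fun v => (a v : ℝ) / k - (if v ∈ s then w v else 0)),
        Finset.sum_sub_distrib, ← Finset.sum_div, ← Nat.cast_sum, hak, div_self hk',
        ← Finset.sum_filter, Finset.filter_mem_eq_inter, hw1, sub_self]
    · rw [Finset.sum_coe_sort t (fun v => ((a v : ℝ) / k - (if v ∈ s then w v else 0)) • v)]
      simp only [sub_smul, ite_smul, zero_smul]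
      rw [Finset.sum_sub_distrib, ← Finset.sum_filter, Finset.filter_mem_eq_inter, hwz, sub_self]
  have ha0 : ∀ v ∈ t, v ∉ s → a v = 0 := fun v hv hvs => by
    have := huniq v hv
    simpa [hvs, hk'] using this
  let a' : EuclideanSpace ℝ (Fin d) → ℕ := fun v => if v ∈ t then a v else 0
  have hs' : s = Finset.univ.image v := by
    apply Finset.coe_injective; rw [← hvs]; simp
  have hsum : ∑ i, a' (v i) = k := by
    rw [← hak, ← Finset.sum_image (f := a') fun _ _ _ _ h => hv.injective h, ← hs']
    simp only [a', ← Finset.sum_filter, Finset.filter_mem_eq_inter]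
    rw [Finset.inter_comm]
    exact Finset.sum_subset Finset.inter_subset_left fun v hv hvs =>
      ha0 v hv fun h => hvs (Finset.mem_inter.2 ⟨hv, h⟩)
  have hsmul : ∑ v ∈ t, ((a v : ℝ) / k) • v = ∑ i, ((a' (v i) : ℝ) / k) • v i := by
    rw [← Finset.sum_image (f := fun v => ((a' v : ℝ) / k) • v) fun _ _ _ _ h => hv.injective h,
      ← hs']
    have : ∀ v ∈ s, ((a' v : ℝ) / k) • v = if v ∈ t then ((a v : ℝ) / k) • v else 0 := by
      intro v _
      by_cases h : v ∈ t <;> simp [a', h]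
    rw [Finset.sum_congr rfl this, ← Finset.sum_filter, Finset.filter_mem_eq_inter,
      Finset.inter_comm]
    refine (Finset.sum_subset Finset.inter_subset_left fun v hv hvs => ?_).symm
    rw [ha0 v hv fun h => hvs (Finset.mem_inter.2 ⟨hv, h⟩)]
    simp
  rw [Fin.sum_univ_succ] at hsum
  refine ⟨fun i => a' (v i.succ), (Nat.le_add_left _ _).trans hsum.le, ?_⟩
  rw [hsmul, param_eq_sum]
  refine Finset.sum_congr rfl fun i _ => ?_
  congr 1
  refine Fin.cases ?_ (fun j => ?_) i
  · simp only [Fin.cons_zero, ← Finset.sum_div]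
    have : (k : ℝ) = a' (v 0) + ∑ i : Fin n, (a' (v i.succ) : ℝ) := by exact_mod_cast hsum.symm
    field_simp
    linarith
  · simp

end Mesh

/-! ### Finite element functions on a cell -/

section Local

variable {d : ℕ} {K : Geometry.SimplicialComplex ℝ (EuclideanSpace ℝ (Fin d))}

/-- The finite element function with coefficient vector `x`. -/
def feFun {d : ℕ} {ι : Type} [Fintype ι] (φ : ι → EuclideanSpace ℝ (Fin d) → ℝ) (x : ι → ℝ)
    (z : EuclideanSpace ℝ (Fin d)) : ℝ :=
  ∑ i, x i * φ i z

theorem IsPiecewisePolynomial.feFun {ι : Type} [Fintype ι] {k : ℕ}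
    {φ : ι → EuclideanSpace ℝ (Fin d) → ℝ} (h : ∀ i, IsPiecewisePolynomial K k (φ i))
    (x : ι → ℝ) : IsPiecewisePolynomial K k (feFun φ x) := by
  refine ⟨continuousOn_finsetSum _ fun i _ => continuousOn_const.mul (h i).1, fun s hs => ?_⟩
  choose P hP hPe using fun i => (h i).2 s hs
  refine ⟨∑ i, MvPolynomial.C (x i) * P i, ?_, fun z hz => ?_⟩
  · refine MvPolynomial.totalDegree_finsetSum_le fun i _ => ?_
    refine (MvPolynomial.totalDegree_mul _ _).trans ?_
    rw [MvPolynomial.totalDegree_C, zero_add]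
    exact hP i
  · simp only [BulkSurface.feFun, _root_.map_sum, map_mul, MvPolynomial.eval_C]
    exact Finset.sum_congr rfl fun i _ => by rw [hPe i z hz]

theorem IsPiecewisePolynomial.exists_polyFun {k : ℕ} {f : EuclideanSpace ℝ (Fin d) → ℝ}
    (h : IsPiecewisePolynomial K k f) {s} (hs : s ∈ K.faces) :
    ∃ P : MvPolynomial (Fin d) ℝ, P.totalDegree ≤ k ∧
      ∀ z ∈ convexHull ℝ (s : Set (EuclideanSpace ℝ (Fin d))), f z = polyFun P z :=
  h.2 s hs

/-- On a cell, a finite element function is bounded by its values at the Lagrange nodes of the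
cell. -/
theorem exists_abs_le_nodes (d n : ℕ) {k : ℕ} (hk : 1 ≤ k) :
    ∃ C, 0 ≤ C ∧ ∀ (K : Geometry.SimplicialComplex ℝ (EuclideanSpace ℝ (Fin d)))
      (f : EuclideanSpace ℝ (Fin d) → ℝ), IsPiecewisePolynomial K k f → ∀ s ∈ cells K n,
      ∀ M : ℝ, 0 ≤ M → (∀ z ∈ lagrangeNodes K k,
        z ∈ convexHull ℝ (s : Set (EuclideanSpace ℝ (Fin d))) → |f z| ≤ M) →
      ∀ x ∈ convexHull ℝ (s : Set (EuclideanSpace ℝ (Fin d))), |f x| ≤ C * M := by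
  obtain ⟨C, hC, h⟩ := exists_abs_polyFun_le_nodes n hk
  refine ⟨C, hC, fun K f hf s hs M hM hnode x hx => ?_⟩
  obtain ⟨v, hv, hvs⟩ := exists_enumeration_of_mem_cells hs
  obtain ⟨P, hP, hPf⟩ := hf.exists_polyFun hs.1
  have hx' := hx
  rw [← hvs, ← image_param_refSimplex] at hx'
  obtain ⟨y, hy, rfl⟩ := hx'
  rw [hPf _ hx, ← polyFun_pullPoly]
  refine h _ ((totalDegree_pullPoly_le v P).trans hP) M hM (fun a ha => ?_) y hy
  have hmem : param v (WithLp.toLp 2 fun i => (a i : ℝ) / k) ∈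
      convexHull ℝ (s : Set (EuclideanSpace ℝ (Fin d))) := by
    rw [← hvs, ← image_param_refSimplex]
    exact mem_image_of_mem _ (lattice_mem_refSimplex hk ha)
  rw [polyFun_pullPoly, ← hPf _ hmem]
  exact hnode _ (param_lattice_mem_lagrangeNodes hk hs.1 hv hvs ha) hmem

/-- On a cell, point values of a finite element function are bounded by its `L²` norm. -/
theorem exists_sq_mul_normDet_le (d n : ℕ) {k : ℕ} (hk : 1 ≤ k) :
    ∃ C, 0 ≤ C ∧ ∀ (P : MvPolynomial (Fin d) ℝ), P.totalDegree ≤ k →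
      ∀ v : Fin (n + 1) → EuclideanSpace ℝ (Fin d), AffineIndependent ℝ v →
      ∀ x ∈ convexHull ℝ (range v),
        polyFun P x ^ 2 * (edgeMap v).normDet ≤
          C * ∫ z in convexHull ℝ (range v), polyFun P z ^ 2 ∂μHE[n] := by
  obtain ⟨C, hC, h⟩ := exists_sq_polyFun_le_integral n hk LinearMap.id
  refine ⟨C, hC, fun P hP v hv x hx => ?_⟩
  rw [← image_param_refSimplex] at hx
  obtain ⟨y, hy, rfl⟩ := hx
  rw [setIntegral_convexHull hv]
  simp only [← polyFun_pullPoly]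
  have := h _ ((totalDegree_pullPoly_le v P).trans hP) y hy
  rw [LinearMap.id_apply] at this
  calc _ ≤ (C * ∫ y in refSimplex n, polyFun (pullPoly v P) y ^ 2) * (edgeMap v).normDet :=
        mul_le_mul_of_nonneg_right this (LinearMap.normDet_nonneg _)
    _ = _ := by ring

/-- Local inverse estimate on a simplex containing a ball of radius `ρ`. -/
theorem exists_local_inverse (d : ℕ) (hd : 1 ≤ d) {k : ℕ} (hk : 1 ≤ k) :
    ∃ C, 0 ≤ C ∧ ∀ (P : MvPolynomial (Fin d) ℝ), P.totalDegree ≤ k →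
      ∀ s : Finset (EuclideanSpace ℝ (Fin d)), s.card = d + 1 →
      AffineIndependent ℝ ((↑) : s → EuclideanSpace ℝ (Fin d)) → ∀ x ρ, 0 < ρ →
      Metric.closedBall x ρ ⊆ convexHull ℝ (s : Set (EuclideanSpace ℝ (Fin d))) →
        ρ ^ 2 * ∫ z in convexHull ℝ (s : Set (EuclideanSpace ℝ (Fin d))), ‖polyGrad P z‖ ^ 2 ≤
          C * ∫ z in convexHull ℝ (s : Set (EuclideanSpace ℝ (Fin d))), polyFun P z ^ 2 := by
  obtain ⟨C, hC, h⟩ := exists_sq_norm_polyGrad_le_integral d hk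
  refine ⟨(d / 2) ^ 2 * C * (volume (refSimplex d)).toReal, by positivity,
    fun P hP s hs hind x ρ hρ hball => ?_⟩
  obtain ⟨v, hv, hvs⟩ := exists_enumeration hs hind
  have hsurj : Function.Surjective (edgeMap v) :=
    LinearMap.injective_iff_surjective.1 (injective_edgeMap hv)
  set I := ∫ y in refSimplex d, polyFun (pullPoly v P) y ^ 2 with hI
  have hpt : ∀ y ∈ refSimplex d, ρ ^ 2 * ‖polyGrad P (param v y)‖ ^ 2 ≤ (d / 2) ^ 2 * (C * I) := by
    intro y hy
    obtain ⟨w, hw⟩ := hsurj (polyGrad P (param v y))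
    have h1 := inner_polyGrad_pullPoly v P y w
    have h2 := norm_mul_le_norm_edgeMap hind hρ.le hball hv.injective hvs.subset w
    have h3 := real_inner_le_norm (polyGrad (pullPoly v P) y) w
    rw [h1, hw, real_inner_self_eq_norm_sq] at h3
    rw [hw] at h2
    set g := ‖polyGrad P (param v y)‖
    have hg : 0 ≤ g := norm_nonneg _
    have h4 : ρ * g ≤ d / 2 * ‖polyGrad (pullPoly v P) y‖ := by
      rcases hg.eq_or_lt with h0 | h0
      · rw [← h0]; simp; positivity
      · refine le_of_mul_le_mul_right ?_ h0
        calc ρ * g * g = ρ * g ^ 2 := by ring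
          _ ≤ ρ * (‖polyGrad (pullPoly v P) y‖ * ‖w‖) := by gcongr
          _ = ‖polyGrad (pullPoly v P) y‖ * (2 * ρ * ‖w‖) / 2 := by ring
          _ ≤ ‖polyGrad (pullPoly v P) y‖ * (d * g) / 2 := by gcongr
          _ = _ := by ring
    have h5 := h _ ((totalDegree_pullPoly_le v P).trans hP) y hy
    calc ρ ^ 2 * g ^ 2 = (ρ * g) ^ 2 := by ring
      _ ≤ (d / 2 * ‖polyGrad (pullPoly v P) y‖) ^ 2 := by gcongr
      _ = (d / 2) ^ 2 * ‖polyGrad (pullPoly v P) y‖ ^ 2 := by ring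
      _ ≤ _ := by gcongr
  have hvol : ∀ f : EuclideanSpace ℝ (Fin d) → ℝ,
      ∫ z in convexHull ℝ (s : Set (EuclideanSpace ℝ (Fin d))), f z =
        (edgeMap v).normDet * ∫ y in refSimplex d, f (param v y) := fun f => by
    rw [← setIntegral_convexHull hv, hvs, EuclideanSpace.euclideanHausdorffMeasure_eq_volume]
  rw [hvol, hvol]
  simp only [← polyFun_pullPoly, ← hI]
  have h6 : ρ ^ 2 * ∫ y in refSimplex d, ‖polyGrad P (param v y)‖ ^ 2 ≤
      (d / 2) ^ 2 * (C * I) * (volume (refSimplex d)).toReal := by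
    rw [← integral_const_mul]
    have hfin := (isCompact_refSimplex d).measure_lt_top (μ := volume)
    calc ∫ y in refSimplex d, ρ ^ 2 * ‖polyGrad P (param v y)‖ ^ 2
        ≤ ∫ _y in refSimplex d, (d / 2) ^ 2 * (C * I) := by
          refine setIntegral_mono_on ?_ (integrableOn_const hfin.ne)
            (isCompact_refSimplex d).measurableSet hpt
          refine ContinuousOn.integrableOn_compact (isCompact_refSimplex d) ?_
          exact (continuous_const.mul
            (((continuous_polyGrad P).comp (continuous_param v)).norm.pow 2)).continuousOn
      _ = _ := by
          rw [setIntegral_const, smul_eq_mul, mul_comm]; rfl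
  calc ρ ^ 2 * ((edgeMap v).normDet * ∫ y in refSimplex d, ‖polyGrad P (param v y)‖ ^ 2)
      = (edgeMap v).normDet * (ρ ^ 2 * ∫ y in refSimplex d, ‖polyGrad P (param v y)‖ ^ 2) := by ring
    _ ≤ (edgeMap v).normDet * ((d / 2) ^ 2 * (C * I) * (volume (refSimplex d)).toReal) :=
        mul_le_mul_of_nonneg_left h6 (LinearMap.normDet_nonneg _)
    _ = _ := by ring

end Local

/-! ### Matrices of integrals -/

theorem dotProduct_mulVec_integral {X ι κ : Type} [Fintype ι] [Fintype κ] [MeasurableSpace X]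
    {μ : Measure X} {F : ι → κ → X → ℝ} (hF : ∀ i j, Integrable (F i j) μ) (x : ι → ℝ)
    (y : κ → ℝ) :
    x ⬝ᵥ ((Matrix.of fun i j => ∫ z, F i j z ∂μ) *ᵥ y) =
      ∫ z, ∑ i, ∑ j, x i * y j * F i j z ∂μ := by
  rw [integral_finsetSum _ fun i _ => integrable_finsetSum _ fun j _ => (hF i j).const_mul _]
  simp only [dotProduct, mulVec, Matrix.of_apply]
  refine Finset.sum_congr rfl fun i _ => ?_
  rw [integral_finsetSum _ fun j _ => (hF i j).const_mul _, Finset.mul_sum]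
  refine Finset.sum_congr rfl fun j _ => ?_
  rw [integral_const_mul]
  ring

theorem sum_sum_mul_feFun {d : ℕ} {ι κ : Type} [Fintype ι] [Fintype κ]
    (φ : ι → EuclideanSpace ℝ (Fin d) → ℝ) (ψ : κ → EuclideanSpace ℝ (Fin d) → ℝ) (x : ι → ℝ)
    (y : κ → ℝ) (z) :
    ∑ i, ∑ j, x i * y j * (φ i z * ψ j z) = feFun φ x z * feFun ψ y z := by
  simp only [feFun, Finset.sum_mul_sum]
  exact Finset.sum_congr rfl fun i _ => Finset.sum_congr rfl fun j _ => by ring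

theorem dotProduct_bulkMass {d : ℕ} {ι : Type} [Fintype ι] {Ω : Set (EuclideanSpace ℝ (Fin d))}
    {φ : ι → EuclideanSpace ℝ (Fin d) → ℝ}
    (hφ : ∀ i j, IntegrableOn (fun z => φ i z * φ j z) Ω) (x y : ι → ℝ) :
    x ⬝ᵥ (bulkMass Ω φ *ᵥ y) = ∫ z in Ω, feFun φ x z * feFun φ y z := by
  rw [bulkMass, dotProduct_mulVec_integral hφ]
  simp only [sum_sum_mul_feFun]

theorem dotProduct_surfaceMass {d : ℕ} {ι κ : Type} [Fintype ι] [Fintype κ]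
    {Γ : Set (EuclideanSpace ℝ (Fin d))} {φ : ι → EuclideanSpace ℝ (Fin d) → ℝ}
    {ψ : κ → EuclideanSpace ℝ (Fin d) → ℝ}
    (h : ∀ i j, IntegrableOn (fun z => φ i z * ψ j z) Γ μHE[d - 1]) (x : ι → ℝ) (y : κ → ℝ) :
    x ⬝ᵥ (surfaceMass Γ φ ψ *ᵥ y) = ∫ z in Γ, feFun φ x z * feFun ψ y z ∂μHE[d - 1] := by
  rw [surfaceMass, dotProduct_mulVec_integral h]
  simp only [sum_sum_mul_feFun]

/-! ### The bulk mass matrix -/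

section Bulk

variable {d : ℕ} {K : Geometry.SimplicialComplex ℝ (EuclideanSpace ℝ (Fin d))}
  {Ω : Set (EuclideanSpace ℝ (Fin d))}

theorem IsTriangulation.volume_frontier (hT : IsTriangulation K Ω) (hd : 1 ≤ d) :
    volume (frontier Ω) = 0 := by
  rw [← EuclideanSpace.euclideanHausdorffMeasure_eq_volume]
  have hfin : (cells K (d - 1)).Finite := finite_cells hT.isMesh.finite
  refine measure_mono_null (t := ⋃ s ∈ cells K (d - 1),
    convexHull ℝ (s : Set (EuclideanSpace ℝ (Fin d)))) (fun x hx => ?_) ?_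
  · obtain ⟨s, hs, hxs, -⟩ := hT.boundary x hx
    exact mem_biUnion hs hxs
  · refine (measure_biUnion_null_iff hfin.countable).2 fun s hs => ?_
    exact euclideanHausdorffMeasure_convexHull_eq_zero (by have := hs.2; omega) (K.indep hs.1)

/-- The part of the cell `s` that lies in the open set `Ω` and in the interior of `s`. -/
def cellPart (Ω : Set (EuclideanSpace ℝ (Fin d))) (s : Finset (EuclideanSpace ℝ (Fin d))) :
    Set (EuclideanSpace ℝ (Fin d)) :=
  Ω ∩ interior (convexHull ℝ (s : Set (EuclideanSpace ℝ (Fin d))))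

theorem cellPart_subset (s : Finset (EuclideanSpace ℝ (Fin d))) :
    cellPart Ω s ⊆ convexHull ℝ (s : Set (EuclideanSpace ℝ (Fin d))) :=
  inter_subset_right.trans interior_subset

theorem measurableSet_cellPart (hΩ : IsOpen Ω) (s : Finset (EuclideanSpace ℝ (Fin d))) :
    MeasurableSet (cellPart Ω s) := (hΩ.inter isOpen_interior).measurableSet

/-- The mesh cells as a finite set. -/
noncomputable def cellFinset (h : K.faces.Finite) (n : ℕ) :
    Finset (Finset (EuclideanSpace ℝ (Fin d))) :=
  (finite_cells h : (cells K n).Finite).toFinset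

theorem mem_cellFinset {h : K.faces.Finite} {n : ℕ} {s : Finset (EuclideanSpace ℝ (Fin d))} :
    s ∈ cellFinset h n ↔ s ∈ cells K n := Finite.mem_toFinset _

theorem IsTriangulation.ae_eq_biUnion (hT : IsTriangulation K Ω) :
    (⋃ s ∈ cellFinset hT.isMesh.finite d, cellPart Ω s) =ᵐ[volume] Ω := by
  have h1 : (⋃ s ∈ cellFinset hT.isMesh.finite d, cellPart Ω s) ⊆ Ω :=
    iUnion₂_subset fun s _ => inter_subset_left
  refine h1.eventuallyLE.antisymm ?_
  rw [ae_le_set]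
  refine measure_mono_null (t := ⋃ s ∈ cells K d,
    frontier (convexHull ℝ (s : Set (EuclideanSpace ℝ (Fin d))))) (fun x hx => ?_) ?_
  · obtain ⟨s, hs, hxs⟩ := hT.isMesh.exists_cell (subset_closure hx.1)
    refine mem_biUnion hs ⟨subset_closure hxs, fun hi => hx.2 ?_⟩
    exact mem_biUnion (mem_cellFinset.2 hs) ⟨hx.1, hi⟩
  · refine (measure_biUnion_null_iff (finite_cells hT.isMesh.finite).countable).2 fun s hs => ?_
    exact (convex_convexHull ℝ _).addHaar_frontier volume

theorem volume_inter_cells_eq_zero {s t : Finset (EuclideanSpace ℝ (Fin d))} (hs : s ∈ cells K d)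
    (ht : t ∈ cells K d) (hst : s ≠ t) :
    volume (convexHull ℝ (s : Set (EuclideanSpace ℝ (Fin d))) ∩
      convexHull ℝ (t : Set (EuclideanSpace ℝ (Fin d)))) = 0 := by
  rw [← EuclideanSpace.euclideanHausdorffMeasure_eq_volume]
  exact measure_inter_cells_eq_zero hs ht hst

theorem IsTriangulation.integrableOn (hT : IsTriangulation K Ω)
    {f : EuclideanSpace ℝ (Fin d) → ℝ} (hf : ∀ s ∈ cells K d, IntegrableOn f (cellPart Ω s)) :
    IntegrableOn f Ω := by
  refine IntegrableOn.congr_set_ae ?_ hT.ae_eq_biUnion.symm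
  exact integrableOn_finset_iUnion.2 fun s hs => hf s (mem_cellFinset.1 hs)

theorem IsTriangulation.setIntegral_eq_sum (hT : IsTriangulation K Ω) (hΩ : IsOpen Ω)
    {f : EuclideanSpace ℝ (Fin d) → ℝ} (hf : ∀ s ∈ cells K d, IntegrableOn f (cellPart Ω s)) :
    ∫ z in Ω, f z = ∑ s ∈ cellFinset hT.isMesh.finite d, ∫ z in cellPart Ω s, f z := by
  rw [← setIntegral_congr_set hT.ae_eq_biUnion]
  refine setIntegral_biUnion_of_aedisjoint (fun s _ => measurableSet_cellPart hΩ s)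
    (fun s hs t ht hst => ?_) (fun s hs => hf s (mem_cellFinset.1 hs))
  exact measure_mono_null (inter_subset_inter (cellPart_subset s) (cellPart_subset t))
    (volume_inter_cells_eq_zero (mem_cellFinset.1 hs) (mem_cellFinset.1 ht) hst)

theorem IsTriangulation.continuousOn_closure {k : ℕ} (hT : IsTriangulation K Ω)
    {f : EuclideanSpace ℝ (Fin d) → ℝ} (hf : IsPiecewisePolynomial K k f) :
    ContinuousOn f (closure Ω) := by
  rw [← hT.isMesh.space_eq]; exact hf.1

theorem IsTriangulation.integrableOn_closure (hT : IsTriangulation K Ω)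
    {f : EuclideanSpace ℝ (Fin d) → ℝ} (hf : ContinuousOn f (closure Ω)) :
    IntegrableOn f (closure Ω) :=
  hf.integrableOn_compact hT.isMesh.isCompact

theorem IsTriangulation.dotProduct_bulkMass {k : ℕ} {ι : Type} [Fintype ι]
    {φ : ι → EuclideanSpace ℝ (Fin d) → ℝ} (hT : IsTriangulation K Ω)
    (hφ : ∀ i, IsPiecewisePolynomial K k (φ i)) (x y : ι → ℝ) :
    x ⬝ᵥ (bulkMass Ω φ *ᵥ y) = ∫ z in Ω, feFun φ x z * feFun φ y z :=
  BulkSurface.dotProduct_bulkMass (fun i j => (hT.integrableOn_closure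
    ((hT.continuousOn_closure (hφ i)).mul (hT.continuousOn_closure (hφ j)))).mono_set
      subset_closure) x y

theorem IsTriangulation.sqNorm_bulkMass {k : ℕ} {ι : Type} [Fintype ι]
    {φ : ι → EuclideanSpace ℝ (Fin d) → ℝ} (hT : IsTriangulation K Ω)
    (hφ : ∀ i, IsPiecewisePolynomial K k (φ i)) (x : ι → ℝ) :
    sqNorm (bulkMass Ω φ) x = ∫ z in Ω, feFun φ x z ^ 2 := by
  rw [sqNorm, hT.dotProduct_bulkMass hφ]
  simp only [sq]

theorem IsTriangulation.setIntegral_closure (hT : IsTriangulation K Ω) (hd : 1 ≤ d)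
    (f : EuclideanSpace ℝ (Fin d) → ℝ) : ∫ z in closure Ω, f z = ∫ z in Ω, f z := by
  refine setIntegral_congr_set ?_
  rw [closure_eq_self_union_frontier]
  exact union_ae_eq_left_of_ae_eq_empty (ae_eq_empty.2 (hT.volume_frontier hd))

theorem feFun_node {ι : Type} [Fintype ι] [DecidableEq ι] {φ : ι → EuclideanSpace ℝ (Fin d) → ℝ}
    {node : ι → EuclideanSpace ℝ (Fin d)} (h : ∀ i j, φ i (node j) = if i = j then 1 else 0)
    (x : ι → ℝ) (j : ι) : feFun φ x (node j) = x j := by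
  simp [feFun, h]

theorem lagrangeNodes_subset_space {k : ℕ} (hk : 1 ≤ k) : lagrangeNodes K k ⊆ K.space := by
  rintro _ ⟨s, hs, a, ha, rfl⟩
  refine Geometry.SimplicialComplex.convexHull_subset_space hs (Finset.mem_convexHull'.2
    ⟨fun v => (a v : ℝ) / k, fun v _ => by positivity, ?_, rfl⟩)
  rw [← Finset.sum_div, ← Nat.cast_sum, ha, div_self (by positivity)]

theorem isHermitian_bulkMass {ι : Type} (φ : ι → EuclideanSpace ℝ (Fin d) → ℝ) :
    (bulkMass Ω φ).IsHermitian := by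
  ext i j
  simp [bulkMass, mul_comm]

/-- A finite element function with zero `L²` norm vanishes on the closure of `Ω`, hence at all nodes. -/
theorem posDef_bulkMass {k N₁ Nl : ℕ} (hk : 1 ≤ k)
    {node : Fin N₁ ⊕ Fin Nl → EuclideanSpace ℝ (Fin d)}
    {φ : Fin N₁ ⊕ Fin Nl → EuclideanSpace ℝ (Fin d) → ℝ} (hΩ : IsOpen Ω)
    (hT : IsTriangulation K Ω) (hφ : IsNodalBasis K k (frontier Ω) node φ) :
    (bulkMass Ω φ).PosDef := by
  refine posDef_iff_dotProduct_mulVec.2 ⟨isHermitian_bulkMass φ, fun x hx => ?_⟩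
  have h0 : star x ⬝ᵥ (bulkMass Ω φ *ᵥ x) = ∫ z in Ω, feFun φ x z ^ 2 :=
    hT.sqNorm_bulkMass hφ.mem_space x
  rw [h0]
  have hcont := hT.continuousOn_closure (IsPiecewisePolynomial.feFun hφ.mem_space x)
  refine lt_of_le_of_ne (integral_nonneg fun z => sq_nonneg _) fun h => hx ?_
  have hint : IntegrableOn (fun z => feFun φ x z ^ 2) Ω :=
    (hT.integrableOn_closure (hcont.pow 2)).mono_set subset_closure
  have h1 := (integral_eq_zero_iff_of_nonneg (fun z => sq_nonneg _) hint).1 h.symm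
  have h2 : EqOn (fun z => feFun φ x z ^ 2) 0 Ω :=
    Measure.eqOn_open_of_ae_eq h1 hΩ ((hcont.mono subset_closure).pow 2) continuousOn_const
  have h3 : EqOn (fun z => feFun φ x z ^ 2) 0 (closure Ω) :=
    h2.of_subset_closure (hcont.pow 2) continuousOn_const subset_closure subset_rfl
  ext j
  have hmem : node j ∈ closure Ω := by
    rw [← hT.isMesh.space_eq]
    exact lagrangeNodes_subset_space hk (hφ.range_eq ▸ mem_range_self j)
  have := h3 hmem
  simpa [feFun_node hφ.nodal] using this

/-! ### Stiffness matrix and inverse estimate -/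

theorem gradient_eq_polyGrad {f : EuclideanSpace ℝ (Fin d) → ℝ}
    {s : Finset (EuclideanSpace ℝ (Fin d))} {P : MvPolynomial (Fin d) ℝ}
    (h : ∀ z ∈ convexHull ℝ (s : Set (EuclideanSpace ℝ (Fin d))), f z = polyFun P z) {z}
    (hz : z ∈ cellPart Ω s) : gradient f z = polyGrad P z := by
  refine HasGradientAt.gradient ((hasGradientAt_polyFun P z).congr_of_eventuallyEq ?_)
  filter_upwards [isOpen_interior.mem_nhds hz.2] with w hw using h w (interior_subset hw)

theorem integrableOn_weight_mul {X : Type*} [MeasurableSpace X] {μ : Measure X} {A : Set X}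
    {α g : X → ℝ} {α₁ : ℝ} (hα : AEMeasurable α (μ.restrict A))
    (hα₁ : ∀ᵐ x ∂μ.restrict A, |α x| ≤ α₁) (hg : IntegrableOn g A μ) :
    IntegrableOn (fun x => α x * g x) A μ :=
  hg.bdd_mul hα.aestronglyMeasurable (hα₁.mono fun x hx => by simpa using hx)

variable {α : EuclideanSpace ℝ (Fin d) → ℝ} {α₀ α₁ : ℝ}

theorem integrableOn_stiffness {k : ℕ} {ι : Type} {φ : ι → EuclideanSpace ℝ (Fin d) → ℝ}
    (hΩ : IsOpen Ω) (hT : IsTriangulation K Ω) (hφ : ∀ i, IsPiecewisePolynomial K k (φ i))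
    (hα : AEMeasurable α (volume.restrict Ω)) (h₀ : 0 < α₀)
    (hα₁ : ∀ᵐ x ∂(volume.restrict Ω), α₀ ≤ α x ∧ α x ≤ α₁) (i j : ι) :
    IntegrableOn (fun z => α z * inner ℝ (gradient (φ i) z) (gradient (φ j) z)) Ω := by
  refine hT.integrableOn fun s hs => ?_
  have hle : volume.restrict (cellPart Ω s) ≤ volume.restrict Ω :=
    Measure.restrict_mono inter_subset_left le_rfl
  refine integrableOn_weight_mul (hα.mono_measure hle) (α₁ := α₁) ?_ ?_
  · filter_upwards [ae_mono hle hα₁] with x hx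
    rw [abs_of_nonneg (h₀.le.trans hx.1)]
    exact hx.2
  · obtain ⟨P, -, hP⟩ := (hφ i).exists_polyFun hs.1
    obtain ⟨Q, -, hQ⟩ := (hφ j).exists_polyFun hs.1
    have h1 : IntegrableOn (fun z => inner ℝ (polyGrad P z) (polyGrad Q z)) (cellPart Ω s) :=
      (((continuous_polyGrad P).inner (continuous_polyGrad Q)).continuousOn.integrableOn_compact
        (isCompact_convexHull_finset s)).mono_set (cellPart_subset s)
    refine h1.congr_fun (fun z hz => ?_) (measurableSet_cellPart hΩ s)
    simp only [gradient_eq_polyGrad hP hz, gradient_eq_polyGrad hQ hz]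

theorem sqNorm_bulkStiffness {k : ℕ} {ι : Type} [Fintype ι] {φ : ι → EuclideanSpace ℝ (Fin d) → ℝ}
    (hΩ : IsOpen Ω) (hT : IsTriangulation K Ω) (hφ : ∀ i, IsPiecewisePolynomial K k (φ i))
    (hα : AEMeasurable α (volume.restrict Ω)) (h₀ : 0 < α₀)
    (hα₁ : ∀ᵐ x ∂(volume.restrict Ω), α₀ ≤ α x ∧ α x ≤ α₁) (x : ι → ℝ) :
    sqNorm (bulkStiffness Ω α φ) x =
      ∫ z in Ω, α z * ‖∑ i, x i • gradient (φ i) z‖ ^ 2 := by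
  rw [sqNorm, bulkStiffness,
    dotProduct_mulVec_integral (integrableOn_stiffness hΩ hT hφ hα h₀ hα₁)]
  refine integral_congr_ae (.of_forall fun z => ?_)
  simp only [← real_inner_self_eq_norm_sq, sum_inner, inner_sum, inner_smul_left, inner_smul_right,
    conj_trivial, Finset.mul_sum]
  exact Finset.sum_congr rfl fun i _ => Finset.sum_congr rfl fun j _ => by
    rw [real_inner_comm]; ring

theorem posSemidef_bulkStiffness {k : ℕ} {ι : Type} [Fintype ι]
    {φ : ι → EuclideanSpace ℝ (Fin d) → ℝ}
    (hΩ : IsOpen Ω) (hT : IsTriangulation K Ω) (hφ : ∀ i, IsPiecewisePolynomial K k (φ i))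
    (hα : AEMeasurable α (volume.restrict Ω)) (h₀ : 0 < α₀)
    (hα₁ : ∀ᵐ x ∂(volume.restrict Ω), α₀ ≤ α x ∧ α x ≤ α₁) :
    (bulkStiffness Ω α φ).PosSemidef := by
  refine posSemidef_iff_dotProduct_mulVec.2 ⟨?_, fun x => ?_⟩
  · ext i j
    simp only [bulkStiffness, conjTranspose_apply, Matrix.of_apply, star_trivial]
    simp only [real_inner_comm]
  · have h := sqNorm_bulkStiffness hΩ hT hφ hα h₀ hα₁ x
    have h0 : star x ⬝ᵥ (bulkStiffness Ω α φ *ᵥ x) = sqNorm (bulkStiffness Ω α φ) x := rfl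
    rw [h0, h]
    refine integral_nonneg_of_ae ?_
    filter_upwards [hα₁] with z hz
    exact mul_nonneg (h₀.le.trans hz.1) (sq_nonneg _)

/-- The global inverse estimate `‖∇v‖² ≤ C h⁻² ‖v‖²` on quasi-uniform meshes. -/
theorem exists_inverse_estimate (d : ℕ) (hd : 1 ≤ d) {k : ℕ} (hk : 1 ≤ k) {σ : ℝ} (hσ : 0 < σ)
    (α₁ : ℝ) :
    ∃ b, 0 ≤ b ∧ ∀ (Ω : Set (EuclideanSpace ℝ (Fin d))) (α : EuclideanSpace ℝ (Fin d) → ℝ) (α₀ : ℝ)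
      (K : Geometry.SimplicialComplex ℝ (EuclideanSpace ℝ (Fin d))) (ι : Type) (_ : Fintype ι)
      (φ : ι → EuclideanSpace ℝ (Fin d) → ℝ), IsOpen Ω → IsTriangulation K Ω →
      (∀ i, IsPiecewisePolynomial K k (φ i)) → AEMeasurable α (volume.restrict Ω) → 0 < α₀ →
      (∀ᵐ x ∂(volume.restrict Ω), α₀ ≤ α x ∧ α x ≤ α₁) → IsQuasiUniform K σ → 0 < meshWidth K →
      ∀ x, meshWidth K ^ 2 * sqNorm (bulkStiffness Ω α φ) x ≤ b * sqNorm (bulkMass Ω φ) x := by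
  obtain ⟨C, hC, hloc⟩ := exists_local_inverse d hd hk
  refine ⟨|α₁| * σ ^ 2 * C, by positivity,
    fun Ω α α₀ K ι _ φ hΩ hT hφ hα h₀ hα₁ hq hh x => ?_⟩
  have hP : ∀ s ∈ cells K d, ∃ P : MvPolynomial (Fin d) ℝ, P.totalDegree ≤ k ∧
      (∀ z ∈ convexHull ℝ (s : Set (EuclideanSpace ℝ (Fin d))), feFun φ x z = polyFun P z) ∧
      ∀ z ∈ cellPart Ω s, ∑ i, x i • gradient (φ i) z = polyGrad P z := by
    intro s hs
    choose P hP hPe using fun i => (hφ i).exists_polyFun hs.1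
    have hsum : ∀ z, polyFun (∑ i, MvPolynomial.C (x i) * P i) z = ∑ i, x i * polyFun (P i) z :=
      fun z => by simp [polyFun, _root_.map_sum]
    refine ⟨∑ i, MvPolynomial.C (x i) * P i, ?_, fun z hz => ?_, fun z hz => ?_⟩
    · refine MvPolynomial.totalDegree_finsetSum_le fun i _ => ?_
      refine (MvPolynomial.totalDegree_mul _ _).trans ?_
      rw [MvPolynomial.totalDegree_C, zero_add]
      exact hP i
    · rw [hsum]
      exact Finset.sum_congr rfl fun i _ => by rw [hPe i z hz]
    · ext j
      simp only [gradient_eq_polyGrad (hPe _) hz]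
      simp [polyGrad, polyFun, _root_.map_sum]
  rw [sqNorm_bulkStiffness hΩ hT hφ hα h₀ hα₁, hT.sqNorm_bulkMass hφ]
  have hcont : ContinuousOn (fun z => feFun φ x z ^ 2) (closure Ω) :=
    (hT.continuousOn_closure (IsPiecewisePolynomial.feFun hφ x)).pow 2
  have hlocal : ∀ s ∈ cells K d,
      IntegrableOn (fun z => α z * ‖∑ i, x i • gradient (φ i) z‖ ^ 2) (cellPart Ω s) ∧
      meshWidth K ^ 2 * ∫ z in cellPart Ω s, α z * ‖∑ i, x i • gradient (φ i) z‖ ^ 2 ≤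
        |α₁| * σ ^ 2 * C * ∫ z in convexHull ℝ (s : Set (EuclideanSpace ℝ (Fin d))),
          feFun φ x z ^ 2 := by
    intro s hs
    obtain ⟨P, hPd, hPe, hPg⟩ := hP s hs
    obtain ⟨x₀, hx₀⟩ := hq s hs
    have hle : volume.restrict (cellPart Ω s) ≤ volume.restrict Ω :=
      Measure.restrict_mono inter_subset_left le_rfl
    have hg : IntegrableOn (fun z => ‖polyGrad P z‖ ^ 2)
        (convexHull ℝ (s : Set (EuclideanSpace ℝ (Fin d)))) :=
      ((continuous_polyGrad P).norm.pow 2).continuousOn.integrableOn_compact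
        (isCompact_convexHull_finset s)
    have hg' := hg.mono_set (cellPart_subset (Ω := Ω) s)
    have hgg : EqOn (fun z => α z * ‖∑ i, x i • gradient (φ i) z‖ ^ 2)
        (fun z => α z * ‖polyGrad P z‖ ^ 2) (cellPart Ω s) := fun z hz => by
      simp only [hPg z hz]
    have hint : IntegrableOn (fun z => α z * ‖polyGrad P z‖ ^ 2) (cellPart Ω s) := by
      refine integrableOn_weight_mul (hα.mono_measure hle) (α₁ := α₁) ?_ hg'
      filter_upwards [ae_mono hle hα₁] with x hx
      rw [abs_of_nonneg (h₀.le.trans hx.1)]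
      exact hx.2
    refine ⟨hint.congr_fun hgg.symm (measurableSet_cellPart hΩ s), ?_⟩
    rw [setIntegral_congr_fun (measurableSet_cellPart hΩ s) hgg]
    have h1 : ∫ z in cellPart Ω s, α z * ‖polyGrad P z‖ ^ 2 ≤
        |α₁| * ∫ z in convexHull ℝ (s : Set (EuclideanSpace ℝ (Fin d))), ‖polyGrad P z‖ ^ 2 := by
      calc ∫ z in cellPart Ω s, α z * ‖polyGrad P z‖ ^ 2
          ≤ ∫ z in cellPart Ω s, |α₁| * ‖polyGrad P z‖ ^ 2 := by
            refine setIntegral_mono_ae_restrict hint (hg'.const_mul _) ?_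
            filter_upwards [ae_mono hle hα₁] with z hz
            exact mul_le_mul_of_nonneg_right (hz.2.trans (le_abs_self _)) (sq_nonneg _)
        _ = |α₁| * ∫ z in cellPart Ω s, ‖polyGrad P z‖ ^ 2 := integral_const_mul _ _
        _ ≤ _ := by
            refine mul_le_mul_of_nonneg_left ?_ (abs_nonneg _)
            exact setIntegral_mono_set hg (.of_forall fun z => sq_nonneg _)
              (cellPart_subset s).eventuallyLE
    have h2 := hloc P hPd s hs.2 (K.indep hs.1) x₀ _ (div_pos hh hσ) hx₀
    have h3 : ∫ z in convexHull ℝ (s : Set (EuclideanSpace ℝ (Fin d))), feFun φ x z ^ 2 =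
        ∫ z in convexHull ℝ (s : Set (EuclideanSpace ℝ (Fin d))), polyFun P z ^ 2 :=
      setIntegral_congr_fun (measurableSet_convexHull_finset s) fun z hz => by
        simp only [hPe z hz]
    rw [h3]
    rw [div_pow, div_mul_eq_mul_div, div_le_iff₀ (by positivity)] at h2
    calc _ ≤ meshWidth K ^ 2 * (|α₁| *
          ∫ z in convexHull ℝ (s : Set (EuclideanSpace ℝ (Fin d))), ‖polyGrad P z‖ ^ 2) := by
          gcongr
      _ = |α₁| * (meshWidth K ^ 2 *
          ∫ z in convexHull ℝ (s : Set (EuclideanSpace ℝ (Fin d))), ‖polyGrad P z‖ ^ 2) := by ring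
      _ ≤ |α₁| * (C * (∫ z in convexHull ℝ (s : Set (EuclideanSpace ℝ (Fin d))),
          polyFun P z ^ 2) * σ ^ 2) := by gcongr
      _ = _ := by ring
  rw [hT.setIntegral_eq_sum hΩ fun s hs => (hlocal s hs).1, Finset.mul_sum]
  refine (Finset.sum_le_sum fun s hs => (hlocal s (mem_cellFinset.1 hs)).2).trans ?_
  rw [← Finset.mul_sum, ← hT.setIntegral_closure hd]
  refine mul_le_mul_of_nonneg_left ?_ (by positivity)
  refine sum_setIntegral_le_setIntegral (fun s _ => measurableSet_convexHull_finset s)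
    (fun s hs t ht hst => volume_inter_cells_eq_zero (mem_cellFinset.1 hs) (mem_cellFinset.1 ht)
      hst) (fun s hs => hT.isMesh.convexHull_subset (mem_cellFinset.1 hs).1)
    (hT.integrableOn_closure hcont) (fun z => sq_nonneg _)

end Bulk

/-! ### Boundary values and surface mass matrices -/

section Surface

variable {d : ℕ} {K KΓ : Geometry.SimplicialComplex ℝ (EuclideanSpace ℝ (Fin d))}
  {Ω : Set (EuclideanSpace ℝ (Fin d))}

/-- Basis functions of interior nodes vanish on the boundary: on a boundary facet, such a function
is a polynomial of degree at most `k` that vanishes at all Lagrange nodes of the facet. -/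
theorem IsNodalBasis.eq_zero_of_mem_frontier {k N₁ Nl : ℕ} (hk : 1 ≤ k)
    {node : Fin N₁ ⊕ Fin Nl → EuclideanSpace ℝ (Fin d)}
    {φ : Fin N₁ ⊕ Fin Nl → EuclideanSpace ℝ (Fin d) → ℝ}
    (hT : IsTriangulation K Ω) (hφ : IsNodalBasis K k (frontier Ω) node φ) (i : Fin N₁) {z}
    (hz : z ∈ frontier Ω) : φ (Sum.inl i) z = 0 := by
  obtain ⟨C, -, h⟩ := exists_abs_le_nodes d (d - 1) hk
  obtain ⟨s, hs, hzs, hsub⟩ := hT.boundary z hz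
  have := h K (φ (Sum.inl i)) (hφ.mem_space _) s hs 0 le_rfl (fun w hw hws => ?_) z hzs
  · simpa using this
  · rw [← hφ.range_eq] at hw
    obtain ⟨j, rfl⟩ := hw
    have hij : Sum.inl i ≠ j := by
      rintro rfl
      exact hφ.interior_node i (hsub hws)
    simp [hφ.nodal, hij]

theorem continuousOn_frontier {k : ℕ} (hT : IsTriangulation K Ω)
    {f : EuclideanSpace ℝ (Fin d) → ℝ} (hf : IsPiecewisePolynomial K k f) :
    ContinuousOn f (frontier Ω) :=
  (hT.continuousOn_closure hf).mono frontier_subset_closure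

theorem integrableOn_frontier (hM : IsMesh KΓ (d - 1) (frontier Ω))
    {f : EuclideanSpace ℝ (Fin d) → ℝ} (hf : ContinuousOn f (frontier Ω)) :
    IntegrableOn f (frontier Ω) μHE[d - 1] :=
  hf.integrableOn_of_measure_lt_top hM.isCompact hM.measure_lt_top

/-- The quadratic form of a surface mass matrix is the squared `L²(Γ)` norm. -/
theorem dotProduct_surfaceMass_of_continuousOn {ι κ : Type} [Fintype ι] [Fintype κ]
    (hM : IsMesh KΓ (d - 1) (frontier Ω)) {f : ι → EuclideanSpace ℝ (Fin d) → ℝ}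
    {g : κ → EuclideanSpace ℝ (Fin d) → ℝ} (hf : ∀ i, ContinuousOn (f i) (frontier Ω))
    (hg : ∀ i, ContinuousOn (g i) (frontier Ω)) (x : ι → ℝ) (y : κ → ℝ) :
    x ⬝ᵥ (surfaceMass (frontier Ω) f g *ᵥ y) =
      ∫ z in frontier Ω, feFun f x z * feFun g y z ∂μHE[d - 1] :=
  dotProduct_surfaceMass (fun i j => integrableOn_frontier hM ((hf i).mul (hg j))) x y

theorem continuousOn_feFun {ι : Type} [Fintype ι] {A : Set (EuclideanSpace ℝ (Fin d))}
    {f : ι → EuclideanSpace ℝ (Fin d) → ℝ} (hf : ∀ i, ContinuousOn (f i) A) (x : ι → ℝ) :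
    ContinuousOn (feFun f x) A :=
  continuousOn_finsetSum _ fun i _ => continuousOn_const.mul (hf i)

theorem sq_integral_mul_le {X : Type*} [MeasurableSpace X] {μ : Measure X} {f g : X → ℝ}
    (hf : Integrable (fun z => f z ^ 2) μ) (hg : Integrable (fun z => g z ^ 2) μ)
    (hfg : Integrable (fun z => f z * g z) μ) :
    (∫ z, f z * g z ∂μ) ^ 2 ≤ (∫ z, f z ^ 2 ∂μ) * ∫ z, g z ^ 2 ∂μ := by
  have h : ∀ t : ℝ, 0 ≤ (∫ z, g z ^ 2 ∂μ) * (t * t) + (2 * ∫ z, f z * g z ∂μ) * t +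
      ∫ z, f z ^ 2 ∂μ := by
    intro t
    have h1 : ∫ z, (f z + t * g z) ^ 2 ∂μ = (∫ z, g z ^ 2 ∂μ) * (t * t) +
        (2 * ∫ z, f z * g z ∂μ) * t + ∫ z, f z ^ 2 ∂μ := by
      have h2 : ∀ z, (f z + t * g z) ^ 2 = (t * t) * g z ^ 2 + (2 * t) * (f z * g z) + f z ^ 2 :=
        fun z => by ring
      simp only [h2]
      have h3 : Integrable (fun z => t * t * g z ^ 2 + 2 * t * (f z * g z)) μ :=
        (hg.const_mul _).add (hfg.const_mul _)
      rw [integral_add h3 hf, integral_add (hg.const_mul _) (hfg.const_mul _), integral_const_mul,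
        integral_const_mul]
      ring
    rw [← h1]
    exact integral_nonneg fun z => sq_nonneg _
  have := discrim_le_zero h
  rw [discrim] at this
  linarith

/-- The Cauchy–Schwarz inequality in `L²(Γ)` for a surface mass matrix. -/
theorem sq_dotProduct_surfaceMass_le {ι κ : Type} [Fintype ι] [Fintype κ]
    (hM : IsMesh KΓ (d - 1) (frontier Ω)) {f : ι → EuclideanSpace ℝ (Fin d) → ℝ}
    {g : κ → EuclideanSpace ℝ (Fin d) → ℝ} (hf : ∀ i, ContinuousOn (f i) (frontier Ω))
    (hg : ∀ i, ContinuousOn (g i) (frontier Ω)) (x : ι → ℝ) (y : κ → ℝ) :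
    (x ⬝ᵥ (surfaceMass (frontier Ω) f g *ᵥ y)) ^ 2 ≤
      sqNorm (surfaceMass (frontier Ω) f f) x * sqNorm (surfaceMass (frontier Ω) g g) y := by
  simp only [sqNorm, dotProduct_surfaceMass_of_continuousOn hM hf hg,
    dotProduct_surfaceMass_of_continuousOn hM hf hf,
    dotProduct_surfaceMass_of_continuousOn hM hg hg, ← sq]
  have hf' := continuousOn_feFun hf x
  have hg' := continuousOn_feFun hg y
  exact sq_integral_mul_le (integrableOn_frontier hM (hf'.pow 2))
    (integrableOn_frontier hM (hg'.pow 2)) (integrableOn_frontier hM (hf'.mul hg'))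

theorem posSemidef_surfaceMass {ι : Type} [Fintype ι]
    (hM : IsMesh KΓ (d - 1) (frontier Ω)) {f : ι → EuclideanSpace ℝ (Fin d) → ℝ}
    (hf : ∀ i, ContinuousOn (f i) (frontier Ω)) :
    (surfaceMass (frontier Ω) f f).PosSemidef := by
  refine posSemidef_iff_dotProduct_mulVec.2 ⟨?_, fun x => ?_⟩
  · ext i j
    simp [surfaceMass, mul_comm]
  · rw [star_trivial, dotProduct_surfaceMass_of_continuousOn hM hf hf]
    exact integral_nonneg fun z => mul_self_nonneg _

/-- The trace matrix of the bulk space is `(0, M_λ)`. -/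
theorem surfaceMass_mulVec_bulk {k N₁ Nl : ℕ} (hk : 1 ≤ k)
    {node : Fin N₁ ⊕ Fin Nl → EuclideanSpace ℝ (Fin d)}
    {φ : Fin N₁ ⊕ Fin Nl → EuclideanSpace ℝ (Fin d) → ℝ}
    (hT : IsTriangulation K Ω) (hφ : IsNodalBasis K k (frontier Ω) node φ) (i : Fin Nl)
    (j : Fin N₁) : surfaceMass (frontier Ω) (fun j => φ (Sum.inr j)) φ i (Sum.inl j) = 0 := by
  simp only [surfaceMass, Matrix.of_apply]
  rw [setIntegral_congr_fun isClosed_frontier.measurableSet (g := fun _ => 0) fun z hz => ?_]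
  · simp
  · simp [hφ.eq_zero_of_mem_frontier hk hT j hz]

/-! ### Nodal values on the boundary and `L²` norms -/

theorem convexHull_subset_closedBall (hK : K.faces.Finite) {s : Finset (EuclideanSpace ℝ (Fin d))}
    (hs : s ∈ K.faces) {z} (hz : z ∈ convexHull ℝ (s : Set (EuclideanSpace ℝ (Fin d)))) :
    convexHull ℝ (s : Set (EuclideanSpace ℝ (Fin d))) ⊆ Metric.closedBall z (meshWidth K) := by
  intro w hw
  exact (Metric.dist_le_diam_of_mem (isCompact_convexHull_finset s).isBounded hw hz).trans
    (diam_convexHull_le_meshWidth hK hs)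

theorem volume_real_closedBall (z : EuclideanSpace ℝ (Fin d)) {r : ℝ} (hr : 0 ≤ r) :
    volume.real (Metric.closedBall z r) =
      r ^ d * volume.real (Metric.ball (0 : EuclideanSpace ℝ (Fin d)) 1) := by
  rw [Measure.real, Measure.addHaar_closedBall volume z hr, ENNReal.toReal_mul,
    ENNReal.toReal_ofReal (by positivity), finrank_euclideanSpace_fin]
  rfl

/-- The bulk `L²` norm of a finite element function whose interior nodal values vanish is bounded
by the nodal values on the boundary. -/
theorem exists_bulkMass_le_sum_sq (d : ℕ) {k : ℕ} (hk : 1 ≤ k) :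
    ∃ C, 0 ≤ C ∧ ∀ (Ω : Set (EuclideanSpace ℝ (Fin d)))
      (K : Geometry.SimplicialComplex ℝ (EuclideanSpace ℝ (Fin d))) (N₁ Nl : ℕ)
      (node : Fin N₁ ⊕ Fin Nl → EuclideanSpace ℝ (Fin d))
      (φ : Fin N₁ ⊕ Fin Nl → EuclideanSpace ℝ (Fin d) → ℝ), IsOpen Ω → IsTriangulation K Ω →
      IsNodalBasis K k (frontier Ω) node φ → ∀ x : Fin Nl → ℝ,
      sqNorm (bulkMass Ω φ) (Sum.elim 0 x) ≤ C * meshWidth K ^ d * ∑ j, x j ^ 2 := by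
  classical
  obtain ⟨C, hC, h⟩ := exists_abs_le_nodes d d hk
  refine ⟨C ^ 2 * volume.real (Metric.ball (0 : EuclideanSpace ℝ (Fin d)) 1), by positivity,
    fun Ω K N₁ Nl node φ hΩ hT hφ x => ?_⟩
  set f := feFun φ (Sum.elim 0 x) with hf
  have hpp : IsPiecewisePolynomial K k f := IsPiecewisePolynomial.feFun hφ.mem_space _
  set F := cellFinset hT.isMesh.finite d with hF
  let S : Finset (EuclideanSpace ℝ (Fin d)) → Set (EuclideanSpace ℝ (Fin d)) :=
    fun s => convexHull ℝ (s : Set (EuclideanSpace ℝ (Fin d)))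
  let q : Finset (EuclideanSpace ℝ (Fin d)) → ℝ :=
    fun s => ∑ j with node (Sum.inr j) ∈ S s, x j ^ 2
  have hfin : ∀ s, volume (S s) ≠ ⊤ := fun s => (isCompact_convexHull_finset s).measure_lt_top.ne
  have hcell : ∀ s ∈ F, ∫ z in S s, f z ^ 2 ≤ C ^ 2 * q s * volume.real (S s) := by
    intro s hs
    have hs' : s ∈ cells K d := mem_cellFinset.1 hs
    have hq : 0 ≤ q s := Finset.sum_nonneg fun j _ => sq_nonneg _
    have hbd : ∀ z ∈ S s, |f z| ≤ C * √(q s) := by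
      refine h K f hpp s hs' _ (Real.sqrt_nonneg _) fun z hz hzs => ?_
      rw [← hφ.range_eq] at hz
      obtain ⟨j, rfl⟩ := hz
      rw [hf, feFun_node hφ.nodal]
      rcases j with j | j
      · simp
      · refine Real.abs_le_sqrt ?_
        exact Finset.single_le_sum (f := fun j => x j ^ 2) (fun _ _ => sq_nonneg _)
          (Finset.mem_filter.2 ⟨Finset.mem_univ j, hzs⟩)
    calc ∫ z in S s, f z ^ 2 ≤ ∫ _z in S s, C ^ 2 * q s := by
          refine setIntegral_mono_on ?_ (integrableOn_const (hfin s))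
            (measurableSet_convexHull_finset s) fun z hz => ?_
          · refine ContinuousOn.integrableOn_compact (isCompact_convexHull_finset s) ?_
            exact (hpp.1.mono (Geometry.SimplicialComplex.convexHull_subset_space hs'.1)).pow 2
          · rw [← sq_abs, ← Real.sq_sqrt hq, ← mul_pow]
            gcongr
            exact hbd z hz
      _ = _ := by rw [setIntegral_const, smul_eq_mul, mul_comm]
  have hcover : Ω ⊆ ⋃ s ∈ F, S s := fun z hz => by
    obtain ⟨s, hs, hzs⟩ := hT.isMesh.exists_cell (subset_closure hz)
    exact mem_biUnion (mem_cellFinset.2 hs) hzs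
  have hdisj : ∀ s ∈ F, ∀ t ∈ F, s ≠ t → volume (S s ∩ S t) = 0 := fun s hs t ht hst =>
    volume_inter_cells_eq_zero (mem_cellFinset.1 hs) (mem_cellFinset.1 ht) hst
  rw [hT.sqNorm_bulkMass hφ.mem_space]
  have h1 : ∫ z in Ω, f z ^ 2 ≤ ∑ s ∈ F, ∫ z in S s, f z ^ 2 := by
    refine setIntegral_le_sum_setIntegral (fun s _ => measurableSet_convexHull_finset s) hdisj
      hcover (fun s hs => ?_) fun z => sq_nonneg _
    refine ContinuousOn.integrableOn_compact (isCompact_convexHull_finset s) ?_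
    exact (hpp.1.mono (Geometry.SimplicialComplex.convexHull_subset_space
      (mem_cellFinset.1 hs).1)).pow 2
  -- the cells that contain a given node lie in a ball of radius `h` around it
  have h2 : ∀ j, ∑ s ∈ F with node (Sum.inr j) ∈ S s, volume.real (S s) ≤
      meshWidth K ^ d * volume.real (Metric.ball (0 : EuclideanSpace ℝ (Fin d)) 1) := by
    intro j
    rw [← volume_real_closedBall (node (Sum.inr j)) meshWidth_nonneg,
      ← measureReal_biUnion_finset₀ (fun s hs t ht hst => hdisj s (Finset.mem_filter.1 hs).1 t
        (Finset.mem_filter.1 ht).1 hst)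
        (fun s _ => (measurableSet_convexHull_finset s).nullMeasurableSet) (fun s _ => hfin s)]
    · refine measureReal_mono (iUnion₂_subset fun s hs => ?_)
        (isCompact_closedBall _ _).measure_lt_top.ne
      have hs' := Finset.mem_filter.1 hs
      exact convexHull_subset_closedBall hT.isMesh.finite (mem_cellFinset.1 hs'.1).1 hs'.2
  calc ∫ z in Ω, f z ^ 2 ≤ ∑ s ∈ F, C ^ 2 * q s * volume.real (S s) :=
        h1.trans (Finset.sum_le_sum hcell)
    _ = C ^ 2 * ∑ j, x j ^ 2 * ∑ s ∈ F with node (Sum.inr j) ∈ S s, volume.real (S s) := by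
        simp only [q, Finset.sum_filter, Finset.mul_sum, Finset.sum_mul]
        rw [Finset.sum_comm]
        refine Finset.sum_congr rfl fun j _ => Finset.sum_congr rfl fun s _ => ?_
        split_ifs <;> ring
    _ ≤ C ^ 2 * ∑ j, x j ^ 2 * (meshWidth K ^ d *
          volume.real (Metric.ball (0 : EuclideanSpace ℝ (Fin d)) 1)) := by
        gcongr with j _
        exact h2 j
    _ = _ := by rw [← Finset.sum_mul]; ring

/-- The nodal values on the boundary are bounded by the `L²(Γ)` norm. -/
theorem exists_sum_sq_le_surfaceMass (d : ℕ) (hd : 2 ≤ d) {k : ℕ} (hk : 1 ≤ k) {σ : ℝ}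
    (hσ : 0 < σ) :
    ∃ C, 0 ≤ C ∧ ∀ (Ω : Set (EuclideanSpace ℝ (Fin d)))
      (K KΓ : Geometry.SimplicialComplex ℝ (EuclideanSpace ℝ (Fin d))) (N₁ Nl : ℕ)
      (node : Fin N₁ ⊕ Fin Nl → EuclideanSpace ℝ (Fin d))
      (φ : Fin N₁ ⊕ Fin Nl → EuclideanSpace ℝ (Fin d) → ℝ), IsTriangulation K Ω →
      IsQuasiUniform K σ → 0 < meshWidth K → IsMesh KΓ (d - 1) (frontier Ω) →
      IsNodalBasis K k (frontier Ω) node φ → ∀ x : Fin Nl → ℝ,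
      meshWidth K ^ (d - 1) * ∑ j, x j ^ 2 ≤
        C * sqNorm (surfaceMass (frontier Ω) (fun j => φ (Sum.inr j))
          (fun j => φ (Sum.inr j))) x := by
  classical
  obtain ⟨C, hC, h⟩ := exists_sq_mul_normDet_le d (d - 1) hk
  set n := d - 1 with hn
  have hn1 : 1 ≤ n := by omega
  have hn1' : (0 : ℝ) < n := by exact_mod_cast hn1
  set c : ℝ := (2 / (σ * n)) ^ n with hc
  have hcpos : 0 < c := by positivity
  refine ⟨Fintype.card (Fin n → Fin (k + 1)) * (C / c), by positivity,
    fun Ω K KΓ N₁ Nl node φ hT hq hh hM hφ x => ?_⟩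
  set f := feFun (fun j => φ (Sum.inr j)) x with hf
  have hpp : IsPiecewisePolynomial K k f :=
    IsPiecewisePolynomial.feFun (fun j => hφ.mem_space (Sum.inr j)) _
  have hcont := fun j => continuousOn_frontier hT (hφ.mem_space (Sum.inr j))
  have hnode : ∀ j, f (node (Sum.inr j)) = x j := fun j => by
    simp [hf, feFun, hφ.nodal]
  choose F hF hzF hFΓ using fun j => hT.boundary _ (hφ.boundary_node j)
  let S : Finset (EuclideanSpace ℝ (Fin d)) → Set (EuclideanSpace ℝ (Fin d)) :=
    fun s => convexHull ℝ (s : Set (EuclideanSpace ℝ (Fin d)))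
  have hpt : ∀ j, meshWidth K ^ n * x j ^ 2 ≤ C / c * ∫ z in S (F j), f z ^ 2 ∂μHE[n] := by
    intro j
    obtain ⟨v, hv, hvs⟩ := exists_enumeration_of_mem_cells (hF j)
    obtain ⟨P, hP, hPe⟩ := hpp.exists_polyFun (hF j).1
    obtain ⟨t, ht, hst⟩ := hT.isMesh.pure _ (hF j).1
    obtain ⟨x₀, hx₀⟩ := hq t ht
    have hdet := pow_le_normDet_edgeMap hn1 (K.indep ht.1) (div_pos hh hσ) hx₀ hv
      (hvs.subset.trans (Finset.coe_subset.2 hst))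
    have h1 := h P hP v hv (node (Sum.inr j)) (by rw [hvs]; exact hzF j)
    rw [hvs, ← hPe _ (hzF j), hnode] at h1
    have h2 : ∫ z in S (F j), f z ^ 2 ∂μHE[n] = ∫ z in S (F j), polyFun P z ^ 2 ∂μHE[n] :=
      setIntegral_congr_fun (measurableSet_convexHull_finset _) fun z hz => by
        simp only [hPe z hz]
    have h3 : c * meshWidth K ^ n ≤ (edgeMap v).normDet := by
      refine le_trans (le_of_eq ?_) hdet
      rw [hc, ← mul_pow]
      congr 1
      field_simp
    rw [h2, div_mul_eq_mul_div, le_div_iff₀ hcpos]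
    refine le_trans ?_ h1
    calc meshWidth K ^ n * x j ^ 2 * c = x j ^ 2 * (c * meshWidth K ^ n) := by ring
      _ ≤ _ := by gcongr
  -- a facet contains a bounded number of nodes
  have hcard : ∀ s ∈ Finset.univ.image F, ((Finset.univ.filter fun j => F j = s).card : ℝ) ≤
      Fintype.card (Fin n → Fin (k + 1)) := by
    intro s hs
    obtain ⟨j₀, -, rfl⟩ := Finset.mem_image.1 hs
    obtain ⟨v, hv, hvs⟩ := exists_enumeration_of_mem_cells (hF j₀)
    have hex : ∀ j, F j = F j₀ → ∃ a : Fin n → ℕ, ∑ i, a i ≤ k ∧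
        node (Sum.inr j) = param v (WithLp.toLp 2 fun i => (a i : ℝ) / k) := fun j hj =>
      exists_lattice_of_mem_lagrangeNodes hk (hF j₀).1 hv hvs
        (hφ.range_eq ▸ mem_range_self _) (hj ▸ hzF j)
    choose a ha hza using hex
    rw [Nat.cast_le, ← Fintype.card_coe]
    refine Fintype.card_le_of_injective (fun j i => ⟨a j (Finset.mem_filter.1 j.2).2 i,
      Nat.lt_succ_of_le ((Finset.single_le_sum (fun _ _ => Nat.zero_le _)
        (Finset.mem_univ i)).trans (ha j (Finset.mem_filter.1 j.2).2))⟩) fun j j' hjj => ?_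
    have haa : a j (Finset.mem_filter.1 j.2).2 = a j' (Finset.mem_filter.1 j'.2).2 := by
      ext i
      simpa using congrFun hjj i
    have := (hza j (Finset.mem_filter.1 j.2).2).trans
      ((by rw [haa] : param v _ = param v _).trans (hza j' (Finset.mem_filter.1 j'.2).2).symm)
    exact Subtype.ext (Sum.inr_injective (hφ.injective this))
  have hsq : sqNorm (surfaceMass (frontier Ω) (fun j => φ (Sum.inr j))
      (fun j => φ (Sum.inr j))) x = ∫ z in frontier Ω, f z ^ 2 ∂μHE[n] := by
    rw [sqNorm, dotProduct_surfaceMass_of_continuousOn hM hcont hcont]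
    simp only [sq, hf, hn]
  have hint0 : ∀ s, 0 ≤ ∫ z in S s, f z ^ 2 ∂μHE[n] := fun s =>
    integral_nonneg fun z => sq_nonneg _
  rw [hsq, Finset.mul_sum]
  calc ∑ j, meshWidth K ^ n * x j ^ 2
      ≤ ∑ j, C / c * ∫ z in S (F j), f z ^ 2 ∂μHE[n] := Finset.sum_le_sum fun j _ => hpt j
    _ = ∑ s ∈ Finset.univ.image F, ∑ j with F j = s, C / c * ∫ z in S (F j), f z ^ 2 ∂μHE[n] :=
        (Finset.sum_fiberwise_of_maps_to (fun j hj => Finset.mem_image_of_mem F hj) _).symm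
    _ = ∑ s ∈ Finset.univ.image F, ((Finset.univ.filter fun j => F j = s).card : ℝ) *
          (C / c * ∫ z in S s, f z ^ 2 ∂μHE[n]) := by
        refine Finset.sum_congr rfl fun s _ => ?_
        rw [Finset.sum_congr rfl fun j hj => by rw [(Finset.mem_filter.1 hj).2],
          Finset.sum_const, nsmul_eq_mul]
    _ ≤ ∑ s ∈ Finset.univ.image F, (Fintype.card (Fin n → Fin (k + 1)) : ℝ) *
          (C / c * ∫ z in S s, f z ^ 2 ∂μHE[n]) := by
        refine Finset.sum_le_sum fun s hs => mul_le_mul_of_nonneg_right (hcard s hs) ?_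
        exact mul_nonneg (by positivity) (hint0 s)
    _ = Fintype.card (Fin n → Fin (k + 1)) * (C / c) *
          ∑ s ∈ Finset.univ.image F, ∫ z in S s, f z ^ 2 ∂μHE[n] := by
        rw [Finset.mul_sum]
        exact Finset.sum_congr rfl fun s _ => by ring
    _ ≤ _ := by
        refine mul_le_mul_of_nonneg_left ?_ (by positivity)
        refine sum_setIntegral_le_setIntegral (fun s _ => measurableSet_convexHull_finset s)
          (fun s hs t ht hst => ?_) (fun s hs => ?_) ?_ fun z => sq_nonneg _
        · obtain ⟨i, -, rfl⟩ := Finset.mem_image.1 hs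
          obtain ⟨j, -, rfl⟩ := Finset.mem_image.1 ht
          exact measure_inter_cells_eq_zero (hF i) (hF j) hst
        · obtain ⟨i, -, rfl⟩ := Finset.mem_image.1 hs
          exact hFΓ i
        · exact integrableOn_frontier hM ((continuousOn_feFun hcont x).pow 2)

end Surface

/-! ### The surface stiffness matrix -/

section SurfaceStiffness

variable {d : ℕ} {KΓ : Geometry.SimplicialComplex ℝ (EuclideanSpace ℝ (Fin d))}
  {Γ : Set (EuclideanSpace ℝ (Fin d))}

/-- For a function that agrees with a polynomial on the simplex `s`, the tangential gradient at a
relative interior point is the projection of the gradient of the polynomial. -/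
theorem tangentialGradient_eq_of_mem_interior {n : ℕ}
    {v : Fin (n + 1) → EuclideanSpace ℝ (Fin d)} (hv : AffineIndependent ℝ v)
    {g : EuclideanSpace ℝ (Fin d) → ℝ} {P : MvPolynomial (Fin d) ℝ}
    (hP : ∀ z ∈ convexHull ℝ (range v), g z = polyFun P z) {y : EuclideanSpace ℝ (Fin n)}
    (hy : y ∈ interior (refSimplex n)) :
    tangentialGradient (vectorSpan ℝ (range v)) g (param v y) =
      (vectorSpan ℝ (range v)).starProjection (polyGrad P (param v y)) := by
  set W := vectorSpan ℝ (range v) with hW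
  have hWr : W ≤ LinearMap.range (edgeMap v) := by
    rw [hW, vectorSpan_range_eq_span_range_vsub_right ℝ v 0, Submodule.span_le]
    rintro _ ⟨i, rfl⟩
    refine Fin.cases ?_ (fun j => ?_) i
    · simp
    · refine ⟨EuclideanSpace.single j 1, ?_⟩
      simp [edgeMap_apply]
  let e : EuclideanSpace ℝ (Fin n) ≃ₗ[ℝ] LinearMap.range (edgeMap v) :=
    LinearEquiv.ofInjective (edgeMap v) (injective_edgeMap hv)
  let f : W →ₗ[ℝ] EuclideanSpace ℝ (Fin n) := e.symm.toLinearMap ∘ₗ Submodule.inclusion hWr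
  have hf : ∀ w : W, edgeMap v (f w) = w := fun w => by
    have := e.apply_symm_apply (Submodule.inclusion hWr w)
    exact congrArg Subtype.val this
  have hev : (fun w : W => g (param v y + (w : EuclideanSpace ℝ (Fin d)))) =ᶠ[nhds 0]
      fun w : W => polyFun P (param v y + (w : EuclideanSpace ℝ (Fin d))) := by
    have hcont : Filter.Tendsto (fun w : W => y + f w) (nhds 0) (nhds y) := by
      have : Continuous fun w : W => y + f w :=
        continuous_const.add f.continuous_of_finiteDimensional
      simpa using this.tendsto 0
    filter_upwards [hcont (isOpen_interior.mem_nhds hy)] with w hw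
    refine hP _ ?_
    rw [← image_param_refSimplex]
    refine ⟨y + f w, interior_subset hw, ?_⟩
    simp only [param, map_add, hf, add_assoc]
  have hgrad : HasGradientAt (fun w : W => polyFun P (param v y + (w : EuclideanSpace ℝ (Fin d))))
      (W.orthogonalProjectionOnto (polyGrad P (param v y))) 0 := by
    rw [hasGradientAt_iff_hasFDerivAt]
    have h1 := hasGradientAt_iff_hasFDerivAt.1 (hasGradientAt_polyFun P (param v y))
    have h2 : HasFDerivAt (fun w : W => param v y + (w : EuclideanSpace ℝ (Fin d))) W.subtypeL 0 :=
      W.subtypeL.hasFDerivAt.const_add _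
    have h3 : HasFDerivAt (polyFun P) ((InnerProductSpace.toDual ℝ (EuclideanSpace ℝ (Fin d)))
        (polyGrad P (param v y))) (param v y + ((0 : W) : EuclideanSpace ℝ (Fin d))) := by
      simpa using h1
    refine (HasFDerivAt.comp (g := polyFun P)
      (f := fun w : W => param v y + (w : EuclideanSpace ℝ (Fin d))) 0 h3 h2).congr_fderiv ?_
    ext w
    simp
  rw [tangentialGradient, (hgrad.congr_of_eventuallyEq hev).gradient]
  rfl

theorem integrableOn_surfaceStiffness {m : ℕ} {ι : Type}
    {ψ : ι → EuclideanSpace ℝ (Fin d) → ℝ} {κ : EuclideanSpace ℝ (Fin d) → ℝ} {κ₀ κ₁ : ℝ}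
    {s : Finset (EuclideanSpace ℝ (Fin d))} {n : ℕ} (hs : s ∈ cells KΓ n)
    (hκ : AEMeasurable κ (μHE[n].restrict (convexHull ℝ (s : Set (EuclideanSpace ℝ (Fin d))))))
    (h₀ : 0 < κ₀)
    (hκ₁ : ∀ᵐ x ∂(μHE[n].restrict (convexHull ℝ (s : Set (EuclideanSpace ℝ (Fin d))))),
      κ₀ ≤ κ x ∧ κ x ≤ κ₁)
    (hψ : ∀ i, IsPiecewisePolynomial KΓ m (ψ i)) (i j : ι) :
    IntegrableOn (fun x => κ x * inner ℝ
        (tangentialGradient (vectorSpan ℝ (s : Set (EuclideanSpace ℝ (Fin d)))) (ψ i) x)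
        (tangentialGradient (vectorSpan ℝ (s : Set (EuclideanSpace ℝ (Fin d)))) (ψ j) x))
      (convexHull ℝ (s : Set (EuclideanSpace ℝ (Fin d)))) μHE[n] := by
  obtain ⟨v, hv, hvs⟩ := exists_enumeration_of_mem_cells hs
  have hcpt := isCompact_convexHull_finset s
  have hμ := euclideanHausdorffMeasure_convexHull_lt_top hs.2 (KΓ.indep hs.1)
  obtain ⟨P, -, hP⟩ := (hψ i).exists_polyFun hs.1
  obtain ⟨Q, -, hQ⟩ := (hψ j).exists_polyFun hs.1
  rw [← hvs] at hκ hκ₁ hcpt hμ hP hQ ⊢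
  set W := vectorSpan ℝ (range v)
  have hG : MeasurableSet (param v '' interior (refSimplex n)) :=
    (measurableEmbedding_param hv).measurableSet_image.2 isOpen_interior.measurableSet
  have hae : param v '' interior (refSimplex n) =ᵐ[μHE[n]] convexHull ℝ (range v) := by
    rw [← image_param_refSimplex]
    refine (image_mono interior_subset).eventuallyLE.antisymm ?_
    rw [ae_le_set, ← image_sdiff (injective_param hv), euclideanHausdorffMeasure_image_param]
    have h0 : volume (refSimplex n \ interior (refSimplex n)) = 0 :=
      measure_mono_null (sdiff_subset_sdiff_left subset_closure)
        ((convex_refSimplex n).addHaar_frontier volume)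
    rw [h0, mul_zero]
  have h1 : IntegrableOn (fun x => κ x * inner ℝ (W.starProjection (polyGrad P x))
      (W.starProjection (polyGrad Q x))) (convexHull ℝ (range v)) μHE[n] := by
    refine integrableOn_weight_mul hκ (α₁ := κ₁) ?_ ?_
    · filter_upwards [hκ₁] with x hx
      rw [abs_of_nonneg (h₀.le.trans hx.1)]
      exact hx.2
    · refine ContinuousOn.integrableOn_of_measure_lt_top hcpt hμ (Continuous.continuousOn ?_)
      exact (W.starProjection.continuous.comp (continuous_polyGrad P)).inner
        (W.starProjection.continuous.comp (continuous_polyGrad Q))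
  refine IntegrableOn.congr_set_ae ?_ hae.symm
  refine (h1.congr_set_ae hae).congr_fun (fun z hz => ?_) hG
  obtain ⟨y, hy, rfl⟩ := hz
  simp only [W, tangentialGradient_eq_of_mem_interior hv hP hy,
    tangentialGradient_eq_of_mem_interior hv hQ hy]

theorem posSemidef_surfaceStiffness {m : ℕ} {ι : Type} [Fintype ι]
    {ψ : ι → EuclideanSpace ℝ (Fin d) → ℝ} {κ : EuclideanSpace ℝ (Fin d) → ℝ} {κ₀ κ₁ : ℝ}
    (hM : IsMesh KΓ (d - 1) Γ) (hκ : AEMeasurable κ (μHE[d - 1].restrict Γ)) (h₀ : 0 < κ₀)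
    (hκ₁ : ∀ᵐ x ∂(μHE[d - 1].restrict Γ), κ₀ ≤ κ x ∧ κ x ≤ κ₁)
    (hψ : ∀ i, IsPiecewisePolynomial KΓ m (ψ i)) :
    (surfaceStiffness KΓ κ ψ).PosSemidef := by
  let G : Finset (EuclideanSpace ℝ (Fin d)) → ι → EuclideanSpace ℝ (Fin d) →
      EuclideanSpace ℝ (Fin d) := fun s i x =>
    tangentialGradient (vectorSpan ℝ (s : Set (EuclideanSpace ℝ (Fin d)))) (ψ i) x
  have h1 : surfaceStiffness KΓ κ ψ = ∑ s ∈ cellFinset hM.finite (d - 1), Matrix.of fun i j =>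
      ∫ x in convexHull ℝ (s : Set (EuclideanSpace ℝ (Fin d))),
        κ x * inner ℝ (G s i x) (G s j x) ∂μHE[d - 1] := by
    ext i j
    rw [Matrix.sum_apply]
    simp only [surfaceStiffness, Matrix.of_apply]
    exact finsum_mem_eq_finite_toFinset_sum _ (finite_cells hM.finite)
  rw [h1]
  refine posSemidef_sum _ fun s hs => ?_
  have hs' : s ∈ cells KΓ (d - 1) := mem_cellFinset.1 hs
  have hle := Measure.restrict_mono (hM.convexHull_subset hs'.1)
    (le_refl (μHE[d - 1] : Measure (EuclideanSpace ℝ (Fin d))))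
  refine posSemidef_iff_dotProduct_mulVec.2 ⟨?_, fun x => ?_⟩
  · ext i j
    simp only [conjTranspose_apply, Matrix.of_apply, star_trivial]
    simp only [real_inner_comm]
  · rw [star_trivial, dotProduct_mulVec_integral (integrableOn_surfaceStiffness hs'
      (hκ.mono_measure hle) h₀ (ae_mono hle hκ₁) hψ)]
    refine integral_nonneg_of_ae ?_
    filter_upwards [ae_mono hle hκ₁] with z hz
    have h2 : ∑ i, ∑ j, x i * x j * (κ z * inner ℝ (G s i z) (G s j z)) =
        κ z * ‖∑ i, x i • G s i z‖ ^ 2 := by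
      simp only [← real_inner_self_eq_norm_sq, sum_inner, inner_sum, inner_smul_left,
        inner_smul_right, conj_trivial, Finset.mul_sum]
      exact Finset.sum_congr rfl fun i _ => Finset.sum_congr rfl fun j _ => by
        rw [real_inner_comm]; ring
    exact h2 ▸ mul_nonneg (h₀.le.trans hz.1) (sq_nonneg _)

end SurfaceStiffness

/-! ### The properties of the finite element matrices used in the error analysis -/

/-- The properties of the finite element matrices on which the error analysis rests: besides
definiteness, the trace matrix of the bulk space sees only the boundary nodes, `B_p` is bounded with
respect to the two `L²(Γ)` norms, the extension by zero of boundary values is small in `L²(Ω)`,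
and the inverse estimate holds. The constants `a`, `b` do not depend on the mesh width `h`. -/
structure IsAdmissible {ι₁ ι₂ ιp : Type} [Fintype ι₁] [Fintype ι₂] [Fintype ιp]
    (A : FEMatrices ι₁ ι₂ ιp) (a b h : ℝ) : Prop where
  posDef_Mu : A.Mu.PosDef
  posSemidef_Ku : A.Ku.PosSemidef
  posSemidef_Mp : A.Mp.PosSemidef
  posSemidef_Kp : A.Kp.PosSemidef
  posDef_Ml : A.Ml.PosDef
  Bu_eq : A.Bu = Matrix.fromCols 0 A.Ml
  sq_Bp_le : ∀ x y, (x ⬝ᵥ (A.Bp *ᵥ y)) ^ 2 ≤ sqNorm A.Ml x * sqNorm A.Mp y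
  extension_le : ∀ x, sqNorm A.Mu (Sum.elim 0 x) ≤ a * h * sqNorm A.Ml x
  inverse_le : ∀ x, h ^ 2 * sqNorm A.Ku x ≤ b * sqNorm A.Mu x

/-- The finite element matrices on quasi-uniform meshes satisfy the bounds with constants that
depend only on the dimension, the degree, the uniformity parameter and the upper bound of `α`. -/
theorem exists_isAdmissible (d : ℕ) (hd : 2 ≤ d) {k : ℕ} (hk : 1 ≤ k) {σ : ℝ} (hσ : 0 < σ)
    (α₁ : ℝ) :
    ∃ a b : ℝ, 0 ≤ a ∧ 0 ≤ b ∧ ∀ (Ω : Set (EuclideanSpace ℝ (Fin d)))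
        (α κ : EuclideanSpace ℝ (Fin d) → ℝ) (α₀ κ₀ κ₁ : ℝ)
        (K KΓ : Geometry.SimplicialComplex ℝ (EuclideanSpace ℝ (Fin d))) (m N₁ Nl Np : ℕ)
        (node : Fin N₁ ⊕ Fin Nl → EuclideanSpace ℝ (Fin d))
        (φ : Fin N₁ ⊕ Fin Nl → EuclideanSpace ℝ (Fin d) → ℝ)
        (ψ : Fin Np → EuclideanSpace ℝ (Fin d) → ℝ),
        IsOpen Ω → AEMeasurable α (volume.restrict Ω) → 0 < α₀ →
        (∀ᵐ x ∂(volume.restrict Ω), α₀ ≤ α x ∧ α x ≤ α₁) →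
        AEMeasurable κ (μHE[d - 1].restrict (frontier Ω)) → 0 < κ₀ →
        (∀ᵐ x ∂(μHE[d - 1].restrict (frontier Ω)), κ₀ ≤ κ x ∧ κ x ≤ κ₁) →
        IsTriangulation K Ω → IsQuasiUniform K σ → 0 < meshWidth K →
        IsMesh KΓ (d - 1) (frontier Ω) → IsNodalBasis K k (frontier Ω) node φ →
        IsSurfaceBasis KΓ m (frontier Ω) ψ →
        IsAdmissible (feMatrices Ω KΓ α κ φ ψ) a b (meshWidth K) := by
  obtain ⟨b, hb, hinv⟩ := exists_inverse_estimate d (by omega) hk hσ α₁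
  obtain ⟨C₁, hC₁, hbulk⟩ := exists_bulkMass_le_sum_sq d hk
  obtain ⟨C₂, hC₂, hsurf⟩ := exists_sum_sq_le_surfaceMass d hd hk hσ
  refine ⟨C₁ * C₂, b, by positivity, hb, fun Ω α κ α₀ κ₀ κ₁ K KΓ m N₁ Nl Np node φ ψ hΩ hα h₀ hα₁
    hκ hκ₀ hκ₁ hT hq hh hM hφ hψ => ?_⟩
  have hcφ := fun j => continuousOn_frontier hT (hφ.mem_space (Sum.inr j))
  have hcψ : ∀ j, ContinuousOn (ψ j) (frontier Ω) := fun j => by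
    rw [← hM.space_eq]; exact (hψ.mem_space j).1
  have hMl := posSemidef_surfaceMass hM hcφ
  refine
    { posDef_Mu := posDef_bulkMass hk hΩ hT hφ
      posSemidef_Ku := posSemidef_bulkStiffness hΩ hT hφ.mem_space hα h₀ hα₁
      posSemidef_Mp := posSemidef_surfaceMass hM hcψ
      posSemidef_Kp := posSemidef_surfaceStiffness hM hκ hκ₀ hκ₁ hψ.mem_space
      posDef_Ml := ?_
      Bu_eq := ?_
      sq_Bp_le := sq_dotProduct_surfaceMass_le hM hcφ hcψ
      extension_le := fun x => ?_
      inverse_le := hinv Ω α α₀ K _ inferInstance φ hΩ hT hφ.mem_space hα h₀ hα₁ hq hh }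
  · refine posDef_iff_dotProduct_mulVec.2 ⟨hMl.isHermitian, fun x hx => ?_⟩
    have h1 := hsurf Ω K KΓ N₁ Nl node φ hT hq hh hM hφ x
    obtain ⟨j, hj⟩ := Function.ne_iff.1 hx
    have h2 : 0 < ∑ j, x j ^ 2 :=
      Finset.sum_pos' (fun j _ => sq_nonneg _) ⟨j, Finset.mem_univ j, sq_pos_of_ne_zero hj⟩
    have h3 : 0 < C₂ * sqNorm (surfaceMass (frontier Ω) (fun j => φ (Sum.inr j))
      (fun j => φ (Sum.inr j))) x := lt_of_lt_of_le (mul_pos (pow_pos hh _) h2) h1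
    exact pos_of_mul_pos_right h3 hC₂
  · ext i j
    rcases j with j | j
    · exact surfaceMass_mulVec_bulk hk hT hφ i j
    · rfl
  · have h1 := hsurf Ω K KΓ N₁ Nl node φ hT hq hh hM hφ x
    refine (hbulk Ω K N₁ Nl node φ hΩ hT hφ x).trans ?_
    have h2 : meshWidth K ^ d = meshWidth K * meshWidth K ^ (d - 1) := by
      rw [← pow_succ']; congr 1; omega
    rw [h2]
    calc C₁ * (meshWidth K * meshWidth K ^ (d - 1)) * ∑ j, x j ^ 2
        = C₁ * meshWidth K * (meshWidth K ^ (d - 1) * ∑ j, x j ^ 2) := by ring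
      _ ≤ C₁ * meshWidth K * (C₂ * sqNorm (surfaceMass (frontier Ω) (fun j => φ (Sum.inr j))
          (fun j => φ (Sum.inr j))) x) := by gcongr
      _ = _ := by simp only [feMatrices]; ring

/-! ### The energy estimate for one time step -/

section Energy

variable {H : Type*} [NormedAddCommGroup H] [InnerProductSpace ℝ H]

/-- The identity behind the `G`-stability of the two-step backward differentiation formula. -/
theorem bdf_inner_identity (x y z : H) :
    2 * inner ℝ x ((3 : ℝ) • x - (4 : ℝ) • y + z) =
      (‖x‖ ^ 2 + ‖(2 : ℝ) • x - y‖ ^ 2) - (‖y‖ ^ 2 + ‖(2 : ℝ) • y - z‖ ^ 2) +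
        ‖x - (2 : ℝ) • y + z‖ ^ 2 := by
  simp only [← real_inner_self_eq_norm_sq, inner_add_left, inner_add_right, inner_sub_left,
    inner_sub_right, inner_smul_left, inner_smul_right, conj_trivial, real_inner_comm x y,
    real_inner_comm x z, real_inner_comm y z]
  ring

/-- The correction `r` obeys `r' = r / 3 - δ`, where `δ` is the increment of `x`. Then the mixed
term `⟪r', x⟫` is a discrete time derivative up to terms that are quadratic in `r` and `δ`. -/
theorem telescoping_identity {r r' x x' δ : H} (hr : r' = (1 / 3 : ℝ) • r - δ) (hx : x' = x + δ) :
    -4 * inner ℝ r' x = (3 * ‖x'‖ ^ 2 + 2 * inner ℝ x' r') - (3 * ‖x‖ ^ 2 + 2 * inner ℝ x r) -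
      ‖δ‖ ^ 2 - 2 / 3 * inner ℝ δ r := by
  subst hr hx
  simp only [← real_inner_self_eq_norm_sq, inner_add_left, inner_add_right, inner_sub_left,
    inner_sub_right, inner_smul_left, inner_smul_right, conj_trivial, real_inner_comm x δ,
    real_inner_comm r δ, real_inner_comm r x]
  ring

theorem inner_le_half_sq_add (x y : H) {a b : ℝ} (hx : ‖x‖ ^ 2 ≤ a) (hy : ‖y‖ ^ 2 ≤ b) :
    |inner ℝ x y| ≤ (a + b) / 2 := by
  have h1 := abs_real_inner_le_norm x y
  nlinarith [sq_nonneg (‖x‖ - ‖y‖)]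

variable {Hp : Type*} [NormedAddCommGroup Hp] [InnerProductSpace ℝ Hp]

/-- The discrete energy. Besides the `G`-norms of the two variables it contains a quadratic form in
the boundary increment `x` and the correction `r`, which absorbs the splitting error of the
velocity `w`; `ρ` stands for the `L²(Γ)` norm of the correction. -/
noncomputable def energy (Y₀ Y₁ x r : H) (p₀ p₁ p₂ : Hp) (ρ : ℝ) : ℝ :=
  ‖Y₀‖ ^ 2 + ‖(2 : ℝ) • Y₀ - Y₁‖ ^ 2 + (‖p₀‖ ^ 2 + ‖(2 : ℝ) • p₀ - p₁‖ ^ 2) +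
    (3 * ‖x‖ ^ 2 + 2 * inner ℝ x r) + ρ ^ 2 / 3 + ‖p₀ - (2 : ℝ) • p₁ + p₂‖ ^ 2 / 8

theorem le_energy {Y₀ Y₁ x r : H} {p₀ p₁ p₂ : Hp} {ρ θ : ℝ} (hr : ‖r‖ ^ 2 ≤ θ * ρ ^ 2)
    (hθ : θ ≤ 1 / 48) :
    ‖Y₀‖ ^ 2 + ‖p₀‖ ^ 2 + ρ ^ 2 / 6 + ‖p₀ - (2 : ℝ) • p₁ + p₂‖ ^ 2 / 8 ≤
      energy Y₀ Y₁ x r p₀ p₁ p₂ ρ := by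
  have h1 : 0 ≤ 3 * ‖x‖ ^ 2 + 2 * inner ℝ x r + ‖r‖ ^ 2 / 3 := by
    have h2 := abs_le.1 (abs_real_inner_le_norm x r)
    nlinarith [sq_nonneg (3 * ‖x‖ - ‖r‖)]
  have h3 : θ * ρ ^ 2 ≤ 1 / 48 * ρ ^ 2 := by gcongr
  have h4 := sq_nonneg ‖(2 : ℝ) • Y₀ - Y₁‖
  have h5 := sq_nonneg ‖(2 : ℝ) • p₀ - p₁‖
  have h6 := sq_nonneg ρ
  unfold energy
  linarith

theorem two_mul_inner_le (x y : H) {c : ℝ} (hc : 0 < c) :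
    2 * inner ℝ x y ≤ c * ‖x‖ ^ 2 + ‖y‖ ^ 2 / c := by
  have h1 := real_inner_le_norm x y
  have h2 : 2 * (‖x‖ * ‖y‖) ≤ c * ‖x‖ ^ 2 + ‖y‖ ^ 2 / c := by
    rw [← sub_nonneg]
    have : c * ‖x‖ ^ 2 + ‖y‖ ^ 2 / c - 2 * (‖x‖ * ‖y‖) = (c * ‖x‖ - ‖y‖) ^ 2 / c := by
      field_simp
      ring
    rw [this]
    positivity
  linarith

variable {Hk Hq : Type*} [NormedAddCommGroup Hk] [InnerProductSpace ℝ Hk]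
  [NormedAddCommGroup Hq]

/-- One step of the energy estimate. The dissipation `‖∂²p‖²` of the backward differentiation
formula and the decay of the correction absorb the boundary terms (small factor `θ ∼ h`) and the
terms that arise from the extension into the bulk (small factor `μ ∼ τ / h`). The numerical bounds
on `θ` and `μ` are chosen so small that all these terms fit below `‖∂²p‖² / 8` and `ρ² / 3`. -/
theorem energy_step {Y₀ Y₁ Y₂ R₀ R₁ x δ₀ δ₁ G : H} {e s η : Hk} {p₀ p₁ p₂ p₃ Gp : Hp} {q : Hq}
    {τ θ μ ρ₀ ρ₁ γ ς : ℝ} (hτ : 0 ≤ τ) (hθ₀ : 0 ≤ θ) (hθ : θ ≤ 1 / 48)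
    (hμ : μ ≤ 1 / 1000)
    (hR : R₀ = (1 / 3 : ℝ) • R₁ - δ₀)
    (htr : inner ℝ R₀ ((3 : ℝ) • Y₀ - (4 : ℝ) • Y₁ + Y₂) =
      2 * inner ℝ R₀ x + 3 * inner ℝ R₀ δ₁)
    (hvar : inner ℝ (Y₀ - R₀) ((3 : ℝ) • Y₀ - (4 : ℝ) • Y₁ + Y₂) +
        2 * τ * inner ℝ (e + s + η) e +
        inner ℝ p₀ ((3 : ℝ) • p₀ - (4 : ℝ) • p₁ + p₂) + 2 * τ * ‖q‖ ^ 2 =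
      2 * τ * inner ℝ (Y₀ - R₀) G + 2 * τ * inner ℝ p₀ Gp)
    (hδ₀ : ‖δ₀‖ ^ 2 ≤ θ * ‖p₀ - (2 : ℝ) • p₁ + p₂‖ ^ 2)
    (hδ₁ : ‖δ₁‖ ^ 2 ≤ θ * ‖p₁ - (2 : ℝ) • p₂ + p₃‖ ^ 2)
    (hR₀ : ‖R₀‖ ^ 2 ≤ θ * ρ₀ ^ 2) (hR₁ : ‖R₁‖ ^ 2 ≤ θ * ρ₁ ^ 2)
    (hρ : ρ₀ ^ 2 ≤ ρ₁ ^ 2 / 3 + 3 / 2 * ‖p₀ - (2 : ℝ) • p₁ + p₂‖ ^ 2)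
    (hη : τ * ‖η‖ ^ 2 ≤ μ * (6 * ρ₀ ^ 2 + 4 * ‖p₀ - (2 : ℝ) • p₁ + p₂‖ ^ 2))
    (hs : ‖s‖ ≤ ς) (hG : ‖G‖ ≤ γ) (hGp : ‖Gp‖ ≤ γ) :
    energy Y₀ Y₁ (x + δ₀) R₀ p₀ p₁ p₂ ρ₀ + 2 * τ * (‖e‖ ^ 2 + ‖q‖ ^ 2) ≤
      energy Y₁ Y₂ x R₁ p₁ p₂ p₃ ρ₁ + τ * energy Y₀ Y₁ (x + δ₀) R₀ p₀ p₁ p₂ ρ₀ +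
        τ * (24 * γ ^ 2 + 4 * ς ^ 2) := by
  have hlow := le_energy (Y₀ := Y₀) (Y₁ := Y₁) (x := x + δ₀) (p₀ := p₀) (p₁ := p₁) (p₂ := p₂) hR₀ hθ
  set L₀ := energy Y₀ Y₁ (x + δ₀) R₀ p₀ p₁ p₂ ρ₀ with hL₀
  have hb₁ := bdf_inner_identity Y₀ Y₁ Y₂
  have hb₂ := bdf_inner_identity p₀ p₁ p₂
  have hb₃ := telescoping_identity (x := x) hR rfl
  have hL₀' := hL₀
  unfold energy at hL₀'
  set D₀ := ‖p₀ - (2 : ℝ) • p₁ + p₂‖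
  set D₁ := ‖p₁ - (2 : ℝ) • p₂ + p₃‖
  -- the boundary terms
  have h1 := (abs_le.1 (inner_le_half_sq_add δ₀ R₁ hδ₀ hR₁)).2
  have h2 := (abs_le.1 (inner_le_half_sq_add R₀ δ₁ hR₀ hδ₁)).2
  have hθρ : θ * ρ₀ ^ 2 ≤ θ * (ρ₁ ^ 2 / 3 + 3 / 2 * D₀ ^ 2) := by gcongr
  -- the consistency errors
  have h3 : 4 * inner ℝ (Y₀ - R₀) G ≤ ‖Y₀‖ ^ 2 / 2 + ‖R₀‖ ^ 2 / 2 + 16 * γ ^ 2 := by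
    have h4 := two_mul_inner_le Y₀ G (c := 1 / 4) (by norm_num)
    have h5 := two_mul_inner_le (-R₀) G (c := 1 / 4) (by norm_num)
    have h6 : ‖G‖ ^ 2 ≤ γ ^ 2 := by gcongr
    rw [norm_neg, inner_neg_left] at h5
    rw [inner_sub_left]
    linarith
  have h4 : 4 * inner ℝ p₀ Gp ≤ ‖p₀‖ ^ 2 / 2 + 8 * γ ^ 2 := by
    have h5 := two_mul_inner_le p₀ Gp (c := 1 / 4) (by norm_num)
    have h6 : ‖Gp‖ ^ 2 ≤ γ ^ 2 := by gcongr
    linarith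
  -- the terms in the bulk energy norm
  have h5 : -(4 * inner ℝ (s + η) e) ≤ 2 * ‖e‖ ^ 2 + 4 * ς ^ 2 + 4 * ‖η‖ ^ 2 := by
    have h6 := two_mul_inner_le (-s) e (c := 2) (by norm_num)
    have h7 := two_mul_inner_le (-η) e (c := 2) (by norm_num)
    have h8 : ‖s‖ ^ 2 ≤ ς ^ 2 := by gcongr
    rw [norm_neg, inner_neg_left] at h6 h7
    rw [inner_add_left]
    linarith
  have h6 : inner ℝ (e + s + η) e = ‖e‖ ^ 2 + inner ℝ (s + η) e := by
    rw [add_assoc, inner_add_left, real_inner_self_eq_norm_sq]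
  rw [h6] at hvar
  have h7 : inner ℝ (Y₀ - R₀) ((3 : ℝ) • Y₀ - (4 : ℝ) • Y₁ + Y₂) =
      inner ℝ Y₀ ((3 : ℝ) • Y₀ - (4 : ℝ) • Y₁ + Y₂) - (2 * inner ℝ R₀ x + 3 * inner ℝ R₀ δ₁) := by
    rw [inner_sub_left, htr]
  rw [h7] at hvar
  have hμρ : μ * (6 * ρ₀ ^ 2 + 4 * D₀ ^ 2) ≤ 1 / 1000 * (6 * ρ₀ ^ 2 + 4 * D₀ ^ 2) := by gcongr
  have hθD₀ : θ * D₀ ^ 2 ≤ 1 / 48 * D₀ ^ 2 := by gcongr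
  have hθD₁ : θ * D₁ ^ 2 ≤ 1 / 48 * D₁ ^ 2 := by gcongr
  have hθρ₁ : θ * ρ₁ ^ 2 ≤ 1 / 48 * ρ₁ ^ 2 := by gcongr
  have hθρ₀ : θ * ρ₀ ^ 2 ≤ 1 / 48 * ρ₀ ^ 2 := by gcongr
  have h8 : 4 * inner ℝ (Y₀ - R₀) G + 4 * inner ℝ p₀ Gp ≤ L₀ + 24 * γ ^ 2 := by
    have := sq_nonneg ρ₀
    have := sq_nonneg D₀
    have := sq_nonneg ‖Y₀‖
    have := sq_nonneg ‖p₀‖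
    linarith
  have h9 := mul_le_mul_of_nonneg_left h8 hτ
  have h10 := mul_le_mul_of_nonneg_left h5 hτ
  have h11 : energy Y₁ Y₂ x R₁ p₁ p₂ p₃ ρ₁ = ‖Y₁‖ ^ 2 + ‖(2 : ℝ) • Y₁ - Y₂‖ ^ 2 +
    (‖p₁‖ ^ 2 + ‖(2 : ℝ) • p₁ - p₂‖ ^ 2) + (3 * ‖x‖ ^ 2 + 2 * inner ℝ x R₁) + ρ₁ ^ 2 / 3 +
      D₁ ^ 2 / 8 := rfl
  rw [h11]
  have h12 := sq_nonneg D₀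
  have h13 := sq_nonneg D₁
  have h14 := sq_nonneg ρ₁
  have h15 := sq_nonneg ‖Y₀ - (2 : ℝ) • Y₁ + Y₂‖
  have h16 : 0 ≤ τ * ‖q‖ ^ 2 := by positivity
  linarith

end Energy

/-- An implicit discrete Gronwall inequality. -/
theorem gronwall_implicit {τ B : ℝ} (hτ : 0 ≤ τ) (hτ' : τ ≤ 1 / 2) (hB : 0 ≤ B) {L κ : ℕ → ℝ}
    {N : ℕ} (hL : ∀ n ≤ N, 0 ≤ L n) (hκ : ∀ n, 0 ≤ κ n)
    (h : ∀ n < N, L (n + 1) + τ * κ (n + 1) ≤ L n + τ * L (n + 1) + τ * B) :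
    ∀ n ≤ N, L n + τ * ∑ i ∈ Finset.Icc 1 n, κ i ≤ Real.exp (2 * (n * τ)) * (L 0 + n * τ * B) := by
  intro n
  induction n with
  | zero => intro _; simp
  | succ n ih =>
    intro hn
    have h1 := ih (by omega)
    have h2 := h n (by omega)
    have h3 : 0 ≤ ∑ i ∈ Finset.Icc 1 n, κ i := Finset.sum_nonneg fun i _ => hκ i
    rw [Finset.sum_Icc_succ_top (by omega)]
    set S := ∑ i ∈ Finset.Icc 1 n, κ i
    set X := L (n + 1) + τ * (S + κ (n + 1)) with hX
    set M := Real.exp (2 * (n * τ)) * (L 0 + n * τ * B)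
    have hLX : L (n + 1) ≤ X := by
      have := hκ (n + 1)
      have : 0 ≤ τ * (S + κ (n + 1)) := by positivity
      linarith
    have h4 : (1 - τ) * X ≤ M + τ * B := by
      have : τ * L (n + 1) ≤ τ * X := by gcongr
      linarith
    have h0 : 0 ≤ L 0 := hL 0 (by omega)
    have hM : 0 ≤ M := by positivity
    have hX0 : 0 ≤ X := (hL (n + 1) hn).trans hLX
    have h5 : X ≤ (1 + 2 * τ) * (M + τ * B) := by
      have : 0 ≤ M + τ * B := by positivity
      nlinarith [mul_nonneg hτ hX0]
    have h6 : 1 + 2 * τ ≤ Real.exp (2 * τ) := by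
      have := Real.add_one_le_exp (2 * τ)
      linarith
    have h7 : M + τ * B ≤ Real.exp (2 * (n * τ)) * (L 0 + (n + 1 : ℕ) * τ * B) := by
      have h8 : 1 ≤ Real.exp (2 * (n * τ)) := Real.one_le_exp (by positivity)
      have h9 : τ * B ≤ Real.exp (2 * (n * τ)) * (τ * B) := le_mul_of_one_le_left (by positivity) h8
      push_cast
      simp only [M]
      linarith
    calc X ≤ (1 + 2 * τ) * (M + τ * B) := h5
      _ ≤ Real.exp (2 * τ) * (Real.exp (2 * (n * τ)) * (L 0 + (n + 1 : ℕ) * τ * B)) := by gcongr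
      _ = Real.exp (2 * ((n + 1 : ℕ) * τ)) * (L 0 + (n + 1 : ℕ) * τ * B) := by
        rw [← mul_assoc, ← Real.exp_add]
        congr 2
        push_cast
        ring

/-! ### Consistency of difference quotients -/

section Consistency

variable {F : Type*} [NormedAddCommGroup F] [NormedSpace ℝ F] {l T τ B : ℝ} {f f₀ f₁ f₂ f₃ : ℝ → F}

theorem norm_sub_shift_le (hτ : 0 ≤ τ)
    (hf : ∀ t ∈ Icc l T, HasDerivWithinAt f (f₁ t) (Icc l T) t)
    (hB : ∀ t ∈ Icc l T, ‖f₁ t‖ ≤ B) {t : ℝ} (ht : t ∈ Icc (l + τ) T) :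
    ‖f t - f (t - τ)‖ ≤ τ * B := by
  have h := Convex.norm_image_sub_le_of_norm_hasDerivWithin_le hf hB (convex_Icc l T)
    (x := t - τ) (y := t) ⟨by linarith [ht.1], by linarith [ht.2]⟩ ⟨by linarith [ht.1], ht.2⟩
  rwa [sub_sub_cancel, Real.norm_of_nonneg hτ, mul_comm] at h

theorem hasDerivWithinAt_sub_shift (hτ : 0 ≤ τ)
    (hf : ∀ t ∈ Icc l T, HasDerivWithinAt f (f₁ t) (Icc l T) t) :
    ∀ t ∈ Icc (l + τ) T, HasDerivWithinAt (fun s => f s - f (s - τ)) (f₁ t - f₁ (t - τ))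
      (Icc (l + τ) T) t := by
  intro t ht
  have h1 := (hf t ⟨by linarith [ht.1], ht.2⟩).mono
    (Icc_subset_Icc (by linarith) le_rfl : Icc (l + τ) T ⊆ Icc l T)
  have h2 : HasDerivWithinAt (fun s => f (s - τ)) (f₁ (t - τ)) (Icc (l + τ) T) t := by
    have h3 := (hf (t - τ) ⟨by linarith [ht.1], by linarith [ht.2]⟩).scomp t
      ((hasDerivWithinAt_id t (Icc (l + τ) T)).sub_const τ)
      (fun s hs => (⟨by linarith [hs.1], by linarith [hs.2]⟩ : s - τ ∈ Icc l T))
    simpa [Function.comp_def] using h3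
  exact h1.sub h2

/-- Second backward differences are of second order. -/
theorem norm_second_difference_le (hτ : 0 ≤ τ)
    (h₀ : ∀ t ∈ Icc l T, HasDerivWithinAt f₀ (f₁ t) (Icc l T) t)
    (h₁ : ∀ t ∈ Icc l T, HasDerivWithinAt f₁ (f₂ t) (Icc l T) t)
    (hB : ∀ t ∈ Icc l T, ‖f₂ t‖ ≤ B) {t : ℝ} (ht : t ∈ Icc (l + 2 * τ) T) :
    ‖f₀ t - (2 : ℝ) • f₀ (t - τ) + f₀ (t - 2 * τ)‖ ≤ τ ^ 2 * B := by
  have h := norm_sub_shift_le hτ (hasDerivWithinAt_sub_shift hτ h₀)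
    (fun t ht => norm_sub_shift_le hτ h₁ hB ht) (t := t) ⟨by linarith [ht.1], ht.2⟩
  have e : f₀ t - (2 : ℝ) • f₀ (t - τ) + f₀ (t - 2 * τ) =
      f₀ t - f₀ (t - τ) - (f₀ (t - τ) - f₀ (t - τ - τ)) := by
    rw [show t - τ - τ = t - 2 * τ by ring]; module
  rw [e]
  exact h.trans_eq (by ring)

/-- Third backward differences are of third order. -/
theorem norm_third_difference_le (hτ : 0 ≤ τ)
    (h₀ : ∀ t ∈ Icc l T, HasDerivWithinAt f₀ (f₁ t) (Icc l T) t)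
    (h₁ : ∀ t ∈ Icc l T, HasDerivWithinAt f₁ (f₂ t) (Icc l T) t)
    (h₂ : ∀ t ∈ Icc l T, HasDerivWithinAt f₂ (f₃ t) (Icc l T) t)
    (hB : ∀ t ∈ Icc l T, ‖f₃ t‖ ≤ B) {t : ℝ} (ht : t ∈ Icc (l + 3 * τ) T) :
    ‖f₀ t - (3 : ℝ) • f₀ (t - τ) + (3 : ℝ) • f₀ (t - 2 * τ) - f₀ (t - 3 * τ)‖ ≤ τ ^ 3 * B := by
  have h := norm_second_difference_le hτ (hasDerivWithinAt_sub_shift hτ h₀)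
    (hasDerivWithinAt_sub_shift hτ h₁) (fun t ht => norm_sub_shift_le hτ h₂ hB ht) (t := t)
    ⟨by linarith [ht.1], ht.2⟩
  have e : f₀ t - (3 : ℝ) • f₀ (t - τ) + (3 : ℝ) • f₀ (t - 2 * τ) - f₀ (t - 3 * τ) =
      f₀ t - f₀ (t - τ) - (2 : ℝ) • (f₀ (t - τ) - f₀ (t - τ - τ)) +
        (f₀ (t - 2 * τ) - f₀ (t - 2 * τ - τ)) := by
    rw [show t - τ - τ = t - 2 * τ by ring, show t - 2 * τ - τ = t - 3 * τ by ring]; module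
  rw [e]
  exact h.trans_eq (by ring)

/-- Taylor expansion to second order, backwards in time. -/
theorem norm_taylor_remainder_le {S : ℝ} (hS : 0 ≤ S)
    (h₀ : ∀ t ∈ Icc l T, HasDerivWithinAt f₀ (f₁ t) (Icc l T) t)
    (h₁ : ∀ t ∈ Icc l T, HasDerivWithinAt f₁ (f₂ t) (Icc l T) t)
    (h₂ : ∀ t ∈ Icc l T, HasDerivWithinAt f₂ (f₃ t) (Icc l T) t)
    (hB : ∀ t ∈ Icc l T, ‖f₃ t‖ ≤ B) {t : ℝ} (ht : t ∈ Icc (l + S) T) :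
    ‖f₀ (t - S) - f₀ t + S • f₁ t - (S ^ 2 / 2) • f₂ t‖ ≤ S ^ 3 * B := by
  have hB₀ : 0 ≤ B := (norm_nonneg _).trans (hB t ⟨by linarith [ht.1], ht.2⟩)
  have hmem : ∀ σ ∈ Icc 0 S, t - σ ∈ Icc l T := fun σ hσ =>
    ⟨by linarith [ht.1, hσ.2], by linarith [ht.2, hσ.1]⟩
  have hback : ∀ {g g' : ℝ → F}, (∀ t ∈ Icc l T, HasDerivWithinAt g (g' t) (Icc l T) t) →
      ∀ σ ∈ Icc 0 S, HasDerivWithinAt (fun σ => g (t - σ)) (-g' (t - σ)) (Icc 0 S) σ := by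
    intro g g' hg σ hσ
    have h3 := (hg (t - σ) (hmem σ hσ)).scomp σ
      ((hasDerivWithinAt_id σ (Icc 0 S)).const_sub t) (fun s hs => hmem s hs)
    simpa [Function.comp_def] using h3
  have hid : ∀ (c : F), ∀ σ ∈ Icc 0 S, HasDerivWithinAt (fun σ : ℝ => σ • c) c (Icc 0 S) σ := by
    intro c σ _
    simpa using (hasDerivWithinAt_id σ (Icc 0 S)).smul_const c
  have b₂ : ∀ σ ∈ Icc 0 S, ‖-f₂ (t - σ) + f₂ t‖ ≤ S * B := by
    intro σ hσ
    have h := norm_sub_shift_le hσ.1 h₂ hB (t := t) ⟨by linarith [ht.1, hσ.2], ht.2⟩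
    rw [neg_add_eq_sub]
    refine h.trans ?_
    gcongr
    exact hσ.2
  have b₁ : ∀ σ ∈ Icc 0 S, ‖f₁ (t - σ) - f₁ t + σ • f₂ t‖ ≤ S ^ 2 * B := by
    intro σ hσ
    have h := Convex.norm_image_sub_le_of_norm_hasDerivWithin_le
      (f := fun σ => f₁ (t - σ) - f₁ t + σ • f₂ t)
      (fun σ hσ => ((hback h₁ σ hσ).sub_const (f₁ t)).add (hid (f₂ t) σ hσ)) b₂ (convex_Icc 0 S)
      (left_mem_Icc.2 hS) hσ
    simp only [sub_zero, sub_self, zero_smul, add_zero, Real.norm_of_nonneg hσ.1] at h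
    calc _ ≤ S * B * σ := h
      _ ≤ S * B * S := by gcongr; exact hσ.2
      _ = S ^ 2 * B := by ring
  have b₁' : ∀ σ ∈ Icc 0 S, ‖-f₁ (t - σ) + f₁ t - σ • f₂ t‖ ≤ S ^ 2 * B := by
    intro σ hσ
    rw [← norm_neg]
    refine le_trans (le_of_eq (congrArg _ ?_)) (b₁ σ hσ)
    module
  have hsq : ∀ σ ∈ Icc 0 S, HasDerivWithinAt (fun σ : ℝ => (σ ^ 2 / 2) • f₂ t) (σ • f₂ t)
      (Icc 0 S) σ := by
    intro σ _
    have h := (((hasDerivAt_pow 2 σ).div_const 2).smul_const (f₂ t)).hasDerivWithinAt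
      (s := Icc 0 S)
    simpa using h
  have h := Convex.norm_image_sub_le_of_norm_hasDerivWithin_le
    (f := fun σ => f₀ (t - σ) - f₀ t + σ • f₁ t - (σ ^ 2 / 2) • f₂ t)
    (fun σ hσ => (((hback h₀ σ hσ).sub_const (f₀ t)).add (hid (f₁ t) σ hσ)).sub (hsq σ hσ)) b₁'
    (convex_Icc 0 S) (left_mem_Icc.2 hS) (right_mem_Icc.2 hS)
  simp only [sub_zero, sub_self, zero_smul, add_zero, Real.norm_of_nonneg hS, ne_eq,
    OfNat.ofNat_ne_zero, not_false_eq_true, zero_pow, zero_div] at h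
  exact h.trans_eq (by ring)

/-- Consistency of the two-step backward differentiation formula. -/
theorem norm_bdf_sub_deriv_le (hτ : 0 ≤ τ)
    (h₀ : ∀ t ∈ Icc l T, HasDerivWithinAt f₀ (f₁ t) (Icc l T) t)
    (h₁ : ∀ t ∈ Icc l T, HasDerivWithinAt f₁ (f₂ t) (Icc l T) t)
    (h₂ : ∀ t ∈ Icc l T, HasDerivWithinAt f₂ (f₃ t) (Icc l T) t)
    (hB : ∀ t ∈ Icc l T, ‖f₃ t‖ ≤ B) {t : ℝ} (ht : t ∈ Icc (l + 2 * τ) T) :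
    ‖(3 : ℝ) • f₀ t - (4 : ℝ) • f₀ (t - τ) + f₀ (t - 2 * τ) - (2 * τ) • f₁ t‖ ≤
      12 * τ ^ 3 * B := by
  have e1 := norm_taylor_remainder_le hτ h₀ h₁ h₂ hB (t := t) ⟨by linarith [ht.1], ht.2⟩
  have e2 := norm_taylor_remainder_le (S := 2 * τ) (by positivity) h₀ h₁ h₂ hB ht
  have e : (3 : ℝ) • f₀ t - (4 : ℝ) • f₀ (t - τ) + f₀ (t - 2 * τ) - (2 * τ) • f₁ t =
      (f₀ (t - 2 * τ) - f₀ t + (2 * τ) • f₁ t - ((2 * τ) ^ 2 / 2) • f₂ t) -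
        (4 : ℝ) • (f₀ (t - τ) - f₀ t + τ • f₁ t - (τ ^ 2 / 2) • f₂ t) := by
    module
  rw [e]
  refine (norm_sub_le _ _).trans ?_
  rw [norm_smul, Real.norm_of_nonneg (by norm_num : (0 : ℝ) ≤ 4)]
  linarith

end Consistency

/-! ### Stability -/

section Stability

/-- The forward-indexed second difference `x (n + 2) - 2 x (n + 1) + x n`. -/
def secondDiff {M : Type*} [AddCommGroup M] [Module ℝ M] (x : ℕ → M) (n : ℕ) : M :=
  x (n + 2) - (2 : ℝ) • x (n + 1) + x n

theorem map_secondDiff {M M' : Type*} [AddCommGroup M] [Module ℝ M] [AddCommGroup M']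
    [Module ℝ M'] (f : M →ₗ[ℝ] M') (x : ℕ → M) (n : ℕ) :
    f (secondDiff x n) = f (x (n + 2)) - (2 : ℝ) • f (x (n + 1)) + f (x n) := by
  simp [secondDiff]

variable {V V₂ W H Hk Hp Hq Hl : Type*} [AddCommGroup V] [Module ℝ V] [AddCommGroup V₂]
  [Module ℝ V₂] [AddCommGroup W] [Module ℝ W] [NormedAddCommGroup H] [InnerProductSpace ℝ H]
  [NormedAddCommGroup Hk] [InnerProductSpace ℝ Hk] [NormedAddCommGroup Hp] [InnerProductSpace ℝ Hp]
  [NormedAddCommGroup Hq] [InnerProductSpace ℝ Hq] [NormedAddCommGroup Hl] [InnerProductSpace ℝ Hl]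

/-- The structure of the discrete coupling that the energy estimate uses. The bulk norms are those
of `mu` (mass) and `ku` (energy), the surface norm is that of `mp`, the norm of the multiplier
space that of `ml`. `Z` extends boundary values by zero and `E` orthogonally to the bulk functions
with zero trace; `Q` is the projection of surface functions onto the trace space. -/
structure IsCoupling (mu : V →ₗ[ℝ] H) (ku : V →ₗ[ℝ] Hk) (mp : W →ₗ[ℝ] Hp) (ml : V₂ →ₗ[ℝ] Hl)
    (tr : V →ₗ[ℝ] V₂) (Z E : V₂ →ₗ[ℝ] V) (Q : W →ₗ[ℝ] V₂) (τ θ μ : ℝ) : Prop where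
  trace_ext : ∀ x, tr (E x) = x
  inner_ext : ∀ x v, inner ℝ (mu (E x)) (mu v) = inner ℝ (mu (E x)) (mu (E (tr v)))
  mass_zero_le : ∀ x, ‖mu (Z x)‖ ^ 2 ≤ θ * ‖ml x‖ ^ 2
  mass_ext_le : ∀ x, ‖mu (E x)‖ ^ 2 ≤ θ * ‖ml x‖ ^ 2
  energy_zero_le : ∀ x, τ * ‖ku (Z x)‖ ^ 2 ≤ μ * ‖ml x‖ ^ 2
  energy_ext_le : ∀ x, τ * ‖ku (E x)‖ ^ 2 ≤ μ * ‖ml x‖ ^ 2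
  proj_le : ∀ y, ‖ml (Q y)‖ ≤ ‖mp y‖

/-- The error equations of the splitting scheme on `N` time steps. The sequences `e` and `p` start
at time level `-2`, the corrected variable `y`, the boundary correction `r` and the consistency
term `s` at time level `-1`. -/
structure IsErrorRecursion (mu : V →ₗ[ℝ] H) (ku : V →ₗ[ℝ] Hk) (mp : W →ₗ[ℝ] Hp) (kp : W →ₗ[ℝ] Hq)
    (tr : V →ₗ[ℝ] V₂) (Z : V₂ →ₗ[ℝ] V) (Q : W →ₗ[ℝ] V₂) (τ : ℝ) (N : ℕ) (e s y : ℕ → V)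
    (r : ℕ → V₂) (p : ℕ → W) (G : ℕ → H) (Gp : ℕ → Hp) : Prop where
  corr_zero : r 0 = 0
  corr_succ : ∀ n, r (n + 1) = (1 / 3 : ℝ) • r n - Q (secondDiff p n)
  trace_eq : ∀ n, tr (y n) = Q (p (n + 1)) + r n
  error_add : ∀ n < N, e (n + 3) + s (n + 2) = y (n + 2) - Z (r (n + 2) + Q (secondDiff p (n + 1)))
  variational : ∀ n < N, ∀ v, tr v = Q (p (n + 3)) →
    inner ℝ (mu v) (mu ((3 : ℝ) • y (n + 2) - (4 : ℝ) • y (n + 1) + y n)) +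
      2 * τ * inner ℝ (ku v) (ku (e (n + 3))) +
      inner ℝ (mp (p (n + 3))) (mp ((3 : ℝ) • p (n + 3) - (4 : ℝ) • p (n + 2) + p (n + 1))) +
      2 * τ * ‖kp (p (n + 3))‖ ^ 2 =
    2 * τ * inner ℝ (mu v) (G n) + 2 * τ * inner ℝ (mp (p (n + 3))) (Gp n)

/-- The discrete energy of the error at time level `n`. -/
noncomputable def errorEnergy (mu : V →ₗ[ℝ] H) (mp : W →ₗ[ℝ] Hp) (ml : V₂ →ₗ[ℝ] Hl)
    (E : V₂ →ₗ[ℝ] V) (Q : W →ₗ[ℝ] V₂) (y : ℕ → V) (r : ℕ → V₂) (p : ℕ → W) (n : ℕ) : ℝ :=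
  energy (mu (y (n + 1))) (mu (y n)) (mu (E (Q (p (n + 2) - p (n + 1))))) (mu (E (r (n + 1))))
    (mp (p (n + 2))) (mp (p (n + 1))) (mp (p n)) ‖ml (r (n + 1))‖

variable {mu : V →ₗ[ℝ] H} {ku : V →ₗ[ℝ] Hk} {mp : W →ₗ[ℝ] Hp} {kp : W →ₗ[ℝ] Hq}
  {ml : V₂ →ₗ[ℝ] Hl} {tr : V →ₗ[ℝ] V₂} {Z E : V₂ →ₗ[ℝ] V} {Q : W →ₗ[ℝ] V₂} {τ θ μ : ℝ} {N : ℕ}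
  {e s y : ℕ → V} {r : ℕ → V₂} {p : ℕ → W} {G : ℕ → H} {Gp : ℕ → Hp} {γ ς : ℝ}

theorem IsCoupling.norm_proj_secondDiff_le (hc : IsCoupling mu ku mp ml tr Z E Q τ θ μ)
    (p : ℕ → W) (n : ℕ) : ‖ml (Q (secondDiff p n))‖ ≤
      ‖mp (p (n + 2)) - (2 : ℝ) • mp (p (n + 1)) + mp (p n)‖ := by
  rw [← map_secondDiff]
  exact hc.proj_le _

/-- The one-step energy estimate for the corrected errors, tested with `y - E r`. -/
theorem errorEnergy_step (hc : IsCoupling mu ku mp ml tr Z E Q τ θ μ)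
    (hr : IsErrorRecursion mu ku mp kp tr Z Q τ N e s y r p G Gp) (hτ : 0 ≤ τ) (hθ₀ : 0 ≤ θ)
    (hθ : θ ≤ 1 / 48) (hμ₀ : 0 ≤ μ) (hμ : μ ≤ 1 / 1000) {n : ℕ} (hn : n < N)
    (hs : ‖ku (s (n + 2))‖ ≤ ς) (hG : ‖G n‖ ≤ γ) (hGp : ‖Gp n‖ ≤ γ) :
    errorEnergy mu mp ml E Q y r p (n + 1) +
        2 * τ * (‖ku (e (n + 3))‖ ^ 2 + ‖kp (p (n + 3))‖ ^ 2) ≤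
      errorEnergy mu mp ml E Q y r p n + τ * errorEnergy mu mp ml E Q y r p (n + 1) +
        τ * (24 * γ ^ 2 + 4 * ς ^ 2) := by
  have hd := hc.norm_proj_secondDiff_le p
  have hx : mu (E (Q (p (n + 3) - p (n + 2)))) =
      mu (E (Q (p (n + 2) - p (n + 1)))) + mu (E (Q (secondDiff p (n + 1)))) := by
    simp only [← map_add]
    congr 3
    simp only [secondDiff, add_assoc, Nat.reduceAdd]
    module
  have key := energy_step (Y₀ := mu (y (n + 2))) (Y₁ := mu (y (n + 1))) (Y₂ := mu (y n))
    (R₀ := mu (E (r (n + 2)))) (R₁ := mu (E (r (n + 1))))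
    (x := mu (E (Q (p (n + 2) - p (n + 1))))) (δ₀ := mu (E (Q (secondDiff p (n + 1)))))
    (δ₁ := mu (E (Q (secondDiff p n)))) (G := G n) (e := ku (e (n + 3))) (s := ku (s (n + 2)))
    (η := ku (Z (r (n + 2) + Q (secondDiff p (n + 1))) - E (r (n + 2)))) (p₀ := mp (p (n + 3)))
    (p₁ := mp (p (n + 2))) (p₂ := mp (p (n + 1))) (p₃ := mp (p n)) (Gp := Gp n)
    (q := kp (p (n + 3))) (ρ₀ := ‖ml (r (n + 2))‖) (ρ₁ := ‖ml (r (n + 1))‖) hτ hθ₀ hθ hμ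
    ?_ ?_ ?_ ?_ ?_ (hc.mass_ext_le _) (hc.mass_ext_le _) ?_ ?_ hs hG hGp
  · rw [← hx] at key
    exact key
  · rw [hr.corr_succ (n + 1)]
    simp only [map_sub, map_smul]
  · simp only [← map_smul, ← map_sub, ← map_add]
    rw [hc.inner_ext]
    have h1 : tr ((3 : ℝ) • y (n + 2) - (4 : ℝ) • y (n + 1) + y n) =
        (2 : ℝ) • Q (p (n + 2) - p (n + 1)) + (3 : ℝ) • Q (secondDiff p n) := by
      simp only [map_add, map_sub, map_smul, hr.trace_eq, hr.corr_succ, secondDiff, add_assoc,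
        Nat.reduceAdd]
      module
    rw [h1, map_add, map_add, inner_add_right, map_smul, map_smul, map_smul, map_smul,
      inner_smul_right, inner_smul_right]
  · have h1 := hr.variational n hn (y (n + 2) - E (r (n + 2)))
      (by rw [map_sub, hr.trace_eq, hc.trace_ext]; simp [add_assoc])
    have h2 : ku (e (n + 3)) + ku (s (n + 2)) +
        ku (Z (r (n + 2) + Q (secondDiff p (n + 1))) - E (r (n + 2))) =
        ku (y (n + 2) - E (r (n + 2))) := by
      rw [← map_add, hr.error_add n hn, ← map_add]
      congr 1
      abel
    rw [h2]
    simp only [map_add, map_sub, map_smul] at h1 ⊢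
    exact h1
  · refine (hc.mass_ext_le _).trans ?_
    gcongr
    exact hd (n + 1)
  · refine (hc.mass_ext_le _).trans ?_
    gcongr
    exact hd n
  · have h1 : ‖ml (r (n + 2))‖ ≤ 1 / 3 * ‖ml (r (n + 1))‖ + ‖ml (Q (secondDiff p (n + 1)))‖ := by
      rw [hr.corr_succ (n + 1), map_sub, map_smul]
      refine (norm_sub_le _ _).trans_eq ?_
      rw [norm_smul, Real.norm_of_nonneg (by norm_num)]
    have h2 := h1.trans (add_le_add_right (hd (n + 1)) _)
    have h3 := pow_le_pow_left₀ (norm_nonneg _) h2 2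
    refine h3.trans ?_
    simp only [add_assoc, Nat.reduceAdd]
    nlinarith [sq_nonneg (2 / 3 * ‖ml (r (n + 1))‖ -
      ‖mp (p (n + 3)) - ((2 : ℝ) • mp (p (n + 2)) - mp (p (n + 1)))‖),
      sq_nonneg (2 / 3 * ‖ml (r (n + 1))‖ -
      ‖mp (p (n + 3)) - (2 : ℝ) • mp (p (n + 2)) + mp (p (n + 1))‖)]
  · have h1 : ‖ml (r (n + 2) + Q (secondDiff p (n + 1)))‖ ≤ ‖ml (r (n + 2))‖ +
        ‖mp (p (n + 3)) - (2 : ℝ) • mp (p (n + 2)) + mp (p (n + 1))‖ := by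
      rw [map_add]
      exact (norm_add_le _ _).trans (add_le_add_right (hd (n + 1)) _)
    set D := ‖mp (p (n + 3)) - (2 : ℝ) • mp (p (n + 2)) + mp (p (n + 1))‖
    have h2 := pow_le_pow_left₀ (norm_nonneg _) h1 2
    have h3 : ‖ku (Z (r (n + 2) + Q (secondDiff p (n + 1))) - E (r (n + 2)))‖ ^ 2 ≤
        2 * (‖ku (Z (r (n + 2) + Q (secondDiff p (n + 1))))‖ ^ 2 + ‖ku (E (r (n + 2)))‖ ^ 2) := by
      rw [map_sub]
      have h4 := pow_le_pow_left₀ (norm_nonneg _) (norm_sub_le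
        (ku (Z (r (n + 2) + Q (secondDiff p (n + 1))))) (ku (E (r (n + 2))))) 2
      exact h4.trans (add_sq_le ..)
    have h5 := mul_le_mul_of_nonneg_left h3 hτ
    have h6 := hc.energy_zero_le (r (n + 2) + Q (secondDiff p (n + 1)))
    have h7 := hc.energy_ext_le (r (n + 2))
    have h8 : ‖ml (r (n + 2) + Q (secondDiff p (n + 1)))‖ ^ 2 ≤
        2 * (‖ml (r (n + 2))‖ ^ 2 + D ^ 2) := h2.trans (add_sq_le ..)
    have h9 := mul_le_mul_of_nonneg_left h8 hμ₀
    linarith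

theorem norm_two_smul_sub_le {x z : H} {M : ℝ} (hx : ‖x‖ ≤ M) (hz : ‖z‖ ≤ M) :
    ‖(2 : ℝ) • x - z‖ ≤ 3 * M := by
  refine (norm_sub_le _ _).trans ?_
  rw [norm_smul, Real.norm_of_nonneg (by norm_num)]
  linarith

theorem norm_secondDiff_le {x z w : H} {M : ℝ} (hx : ‖x‖ ≤ M) (hz : ‖z‖ ≤ M) (hw : ‖w‖ ≤ M) :
    ‖x - (2 : ℝ) • z + w‖ ≤ 4 * M := by
  refine (norm_add_le _ _).trans ((add_le_add_left (norm_sub_le _ _) _).trans ?_)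
  rw [norm_smul, Real.norm_of_nonneg (by norm_num)]
  linarith

theorem energy_le_of_norm_le {Y₀ Y₁ x r : H} {p₀ p₁ p₂ : Hp} {ρ M : ℝ} (hY₀ : ‖Y₀‖ ≤ M)
    (hY₁ : ‖Y₁‖ ≤ M) (hx : ‖x‖ ≤ M) (hr : ‖r‖ ≤ M) (h₀ : ‖p₀‖ ≤ M) (h₁ : ‖p₁‖ ≤ M)
    (h₂ : ‖p₂‖ ≤ M) (hρ₀ : 0 ≤ ρ) (hρ : ρ ≤ M) : energy Y₀ Y₁ x r p₀ p₁ p₂ ρ ≤ 28 * M ^ 2 := by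
  have hM : 0 ≤ M := hρ₀.trans hρ
  have e2 := norm_two_smul_sub_le hY₀ hY₁
  have e2' := norm_two_smul_sub_le h₀ h₁
  have e3 := norm_secondDiff_le h₀ h₁ h₂
  have e4 : inner ℝ x r ≤ M * M :=
    (real_inner_le_norm x r).trans (mul_le_mul hx hr (norm_nonneg _) hM)
  have f1 := pow_le_pow_left₀ (norm_nonneg _) hY₀ 2
  have f2 := pow_le_pow_left₀ (norm_nonneg _) e2 2
  have f3 := pow_le_pow_left₀ (norm_nonneg _) h₀ 2
  have f4 := pow_le_pow_left₀ (norm_nonneg _) e2' 2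
  have f5 := pow_le_pow_left₀ (norm_nonneg _) hx 2
  have f6 := pow_le_pow_left₀ hρ₀ hρ 2
  have f7 := pow_le_pow_left₀ (norm_nonneg _) e3 2
  unfold energy
  nlinarith [sq_nonneg M]

/-- The initial energy: the trace of the initial bulk error equals the projected surface error, so
that the corrected errors differ from the errors only by second differences. -/
theorem errorEnergy_zero_le (hc : IsCoupling mu ku mp ml tr Z E Q τ θ μ)
    (hr : IsErrorRecursion mu ku mp kp tr Z Q τ N e s y r p G Gp) (hθ : θ ≤ 1 / 48) {ε : ℝ}
    (hy : ∀ n, y n = e (n + 1) + s n - Z (tr (e (n + 1) + s n)) + Z (tr (y n)))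
    (ht₁ : tr (e 1) = Q (p 1)) (ht₂ : tr (e 2) = Q (p 2))
    (he₁ : ‖mu (e 1)‖ ≤ ε) (he₂ : ‖mu (e 2)‖ ≤ ε)
    (hp₀ : ‖mp (p 0)‖ ≤ ε) (hp₁ : ‖mp (p 1)‖ ≤ ε) (hp₂ : ‖mp (p 2)‖ ≤ ε)
    (hs : ∀ n < 2, ‖mu (s n)‖ ≤ ς) (hts : ∀ n < 2, ‖ml (tr (s n))‖ ≤ ς) :
    errorEnergy mu mp ml E Q y r p 0 ≤ 28 * (5 * ε + 2 * ς) ^ 2 := by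
  have hε : 0 ≤ ε := (norm_nonneg _).trans he₁
  have hς : 0 ≤ ς := (norm_nonneg _).trans (hs 0 (by omega))
  have hθ' : ∀ {x : H} {z : V₂}, ‖x‖ ^ 2 ≤ θ * ‖ml z‖ ^ 2 → ‖x‖ ≤ ‖ml z‖ := by
    intro x z h
    refine le_of_sq_le_sq (h.trans ?_) (norm_nonneg _)
    nlinarith [sq_nonneg ‖ml z‖]
  have hZ := fun x => hθ' (hc.mass_zero_le x)
  have hE := fun x => hθ' (hc.mass_ext_le x)
  have hr₁ : ‖ml (r 1)‖ ≤ 4 * ε := by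
    rw [hr.corr_succ 0, hr.corr_zero, smul_zero, zero_sub, map_neg, norm_neg]
    exact (hc.norm_proj_secondDiff_le p 0).trans (norm_secondDiff_le hp₂ hp₁ hp₀)
  have hy₀ : mu (y 0) = mu (e 1) + mu (s 0) - mu (Z (tr (s 0))) := by
    rw [hy 0, hr.trace_eq 0, hr.corr_zero]
    simp only [map_add, map_sub, zero_add, add_zero, ht₁]
    abel
  have hy₁ : mu (y 1) = mu (e 2) + mu (s 1) - mu (Z (tr (s 1))) + mu (Z (r 1)) := by
    rw [hy 1, hr.trace_eq 1]
    simp only [map_add, map_sub, Nat.reduceAdd, ht₂]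
    abel
  refine energy_le_of_norm_le ?_ ?_ ?_ ?_ ?_ ?_ ?_ (norm_nonneg _) ?_
  · rw [zero_add, hy₁]
    have h1 := (norm_add_le (mu (e 2) + mu (s 1) - mu (Z (tr (s 1)))) (mu (Z (r 1))))
    have h2 := norm_sub_le (mu (e 2) + mu (s 1)) (mu (Z (tr (s 1))))
    have h3 := norm_add_le (mu (e 2)) (mu (s 1))
    linarith [hZ (r 1), hZ (tr (s 1)), hs 1 (by omega), hts 1 (by omega)]
  · rw [hy₀]
    have h2 := norm_sub_le (mu (e 1) + mu (s 0)) (mu (Z (tr (s 0))))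
    have h3 := norm_add_le (mu (e 1)) (mu (s 0))
    linarith [hZ (tr (s 0)), hs 0 (by omega), hts 0 (by omega)]
  · have h1 := (hE _).trans (hc.proj_le (p (0 + 2) - p (0 + 1)))
    rw [map_sub mp] at h1
    have h2 := norm_sub_le (mp (p 2)) (mp (p 1))
    simp only [zero_add] at h1 ⊢
    linarith
  · have := hE (r 1)
    simp only [zero_add]
    linarith
  · simp only [zero_add]; linarith
  · simp only [zero_add]; linarith
  · linarith
  · simp only [zero_add]; linarith

/-- Stability of the splitting scheme: the errors are bounded by the errors `ε` of the initial
values and the consistency errors `γ`, `ς`. -/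
theorem error_bound (hc : IsCoupling mu ku mp ml tr Z E Q τ θ μ)
    (hr : IsErrorRecursion mu ku mp kp tr Z Q τ N e s y r p G Gp) (hτ : 0 ≤ τ) (hτ' : τ ≤ 1 / 2)
    (hθ₀ : 0 ≤ θ) (hθ : θ ≤ 1 / 48) (hμ₀ : 0 ≤ μ) (hμ : μ ≤ 1 / 1000) {ε : ℝ}
    (hy : ∀ n, y n = e (n + 1) + s n - Z (tr (e (n + 1) + s n)) + Z (tr (y n)))
    (ht₁ : tr (e 1) = Q (p 1)) (ht₂ : tr (e 2) = Q (p 2))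
    (he₁ : ‖mu (e 1)‖ ≤ ε) (he₂ : ‖mu (e 2)‖ ≤ ε)
    (hp₀ : ‖mp (p 0)‖ ≤ ε) (hp₁ : ‖mp (p 1)‖ ≤ ε) (hp₂ : ‖mp (p 2)‖ ≤ ε)
    (hs : ∀ n < N + 2, ‖mu (s n)‖ ≤ ς) (hts : ∀ n < N + 2, ‖ml (tr (s n))‖ ≤ ς)
    (hks : ∀ n < N, ‖ku (s (n + 2))‖ ≤ ς) (hG : ∀ n < N, ‖G n‖ ≤ γ) (hGp : ∀ n < N, ‖Gp n‖ ≤ γ) :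
    ‖mu (e (N + 2))‖ ^ 2 + ‖mp (p (N + 2))‖ ^ 2 +
        τ * ∑ i ∈ Finset.Icc 1 N, (‖ku (e (i + 2))‖ ^ 2 + ‖kp (p (i + 2))‖ ^ 2) ≤
      3 * (Real.exp (2 * (N * τ)) *
        (28 * (5 * ε + 2 * ς) ^ 2 + N * τ * (24 * γ ^ 2 + 4 * ς ^ 2))) + 3 * ς ^ 2 := by
  have hε : 0 ≤ ε := (norm_nonneg _).trans he₁
  have hς : 0 ≤ ς := (norm_nonneg _).trans (hs 0 (by omega))
  have hL₀ := errorEnergy_zero_le hc hr hθ hy ht₁ ht₂ he₁ he₂ hp₀ hp₁ hp₂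
    (fun n hn => hs n (by omega)) (fun n hn => hts n (by omega))
  have hlow : ∀ n, ‖mu (y (n + 1))‖ ^ 2 + ‖mp (p (n + 2))‖ ^ 2 + ‖ml (r (n + 1))‖ ^ 2 / 6 +
      ‖mp (p (n + 2)) - (2 : ℝ) • mp (p (n + 1)) + mp (p n)‖ ^ 2 / 8 ≤
      errorEnergy mu mp ml E Q y r p n := fun n => le_energy (hc.mass_ext_le _) hθ
  have hG' := gronwall_implicit (L := errorEnergy mu mp ml E Q y r p)
    (κ := fun i => 2 * (‖ku (e (i + 2))‖ ^ 2 + ‖kp (p (i + 2))‖ ^ 2)) (N := N)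
    (B := 24 * γ ^ 2 + 4 * ς ^ 2) hτ hτ' (by positivity)
    (fun n _ => le_trans (by positivity) (hlow n)) (fun n => by positivity)
    (fun n hn => by
      have := errorEnergy_step hc hr hτ hθ₀ hθ hμ₀ hμ hn (hks n hn) (hG n hn) (hGp n hn)
      simp only [add_assoc, Nat.reduceAdd] at this ⊢
      linarith) N le_rfl
  rw [← Finset.mul_sum] at hG'
  set S := ∑ i ∈ Finset.Icc 1 N, (‖ku (e (i + 2))‖ ^ 2 + ‖kp (p (i + 2))‖ ^ 2) with hS
  have hS₀ : 0 ≤ S := Finset.sum_nonneg fun i _ => by positivity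
  have hτS : 0 ≤ τ * S := by positivity
  have hX : Real.exp (2 * (N * τ)) *
      (errorEnergy mu mp ml E Q y r p 0 + N * τ * (24 * γ ^ 2 + 4 * ς ^ 2)) ≤
      Real.exp (2 * (N * τ)) *
        (28 * (5 * ε + 2 * ς) ^ 2 + N * τ * (24 * γ ^ 2 + 4 * ς ^ 2)) := by gcongr
  have hfin : ‖mu (e (N + 2))‖ ^ 2 + ‖mp (p (N + 2))‖ ^ 2 ≤
      3 * errorEnergy mu mp ml E Q y r p N + 3 * ς ^ 2 ∨ N = 0 := by
    rcases N with _ | n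
    · exact Or.inr rfl
    left
    have h1 := hr.error_add n (by omega)
    have h2 : mu (e (n + 1 + 2)) = mu (y (n + 2)) - mu (s (n + 2)) -
        mu (Z (r (n + 2) + Q (secondDiff p (n + 1)))) := by
      rw [← map_sub, ← map_sub]
      congr 1
      simp only [add_assoc, Nat.reduceAdd]
      rw [eq_sub_of_add_eq h1]
      abel
    have h3 : ‖mu (Z (r (n + 2) + Q (secondDiff p (n + 1))))‖ ^ 2 ≤
        1 / 24 * (‖ml (r (n + 2))‖ ^ 2 +
          ‖mp (p (n + 3)) - (2 : ℝ) • mp (p (n + 2)) + mp (p (n + 1))‖ ^ 2) := by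
      have h4 : ‖ml (r (n + 2) + Q (secondDiff p (n + 1)))‖ ^ 2 ≤ 2 * (‖ml (r (n + 2))‖ ^ 2 +
          ‖mp (p (n + 3)) - (2 : ℝ) • mp (p (n + 2)) + mp (p (n + 1))‖ ^ 2) := by
        rw [map_add]
        exact (pow_le_pow_left₀ (norm_nonneg _) ((norm_add_le _ _).trans
          (add_le_add_right (hc.norm_proj_secondDiff_le p (n + 1)) _)) 2).trans (add_sq_le ..)
      have h5 := mul_le_mul_of_nonneg_right hθ
        (sq_nonneg ‖ml (r (n + 2) + Q (secondDiff p (n + 1)))‖)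
      linarith [hc.mass_zero_le (r (n + 2) + Q (secondDiff p (n + 1)))]
    have h4 := hlow (n + 1)
    simp only [add_assoc, Nat.reduceAdd] at h2 h4 ⊢
    have h5 : ‖mu (e (n + 3))‖ ^ 2 ≤ 3 * (‖mu (y (n + 2))‖ ^ 2 + ς ^ 2 +
        ‖mu (Z (r (n + 2) + Q (secondDiff p (n + 1))))‖ ^ 2) := by
      rw [h2]
      have h6 := (norm_sub_le (mu (y (n + 2)) - mu (s (n + 2)))
        (mu (Z (r (n + 2) + Q (secondDiff p (n + 1)))))).trans (add_le_add_left
          ((norm_sub_le _ _).trans (add_le_add_right (hs (n + 2) (by omega)) _)) _)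
      refine (pow_le_pow_left₀ (norm_nonneg _) h6 2).trans ?_
      nlinarith [sq_nonneg (‖mu (y (n + 2))‖ - ς),
        sq_nonneg (‖mu (y (n + 2))‖ - ‖mu (Z (r (n + 2) + Q (secondDiff p (n + 1))))‖),
        sq_nonneg (ς - ‖mu (Z (r (n + 2) + Q (secondDiff p (n + 1))))‖)]
    have h7 := sq_nonneg ‖mp (p (n + 3))‖
    have h8 := sq_nonneg ‖ml (r (n + 2))‖
    have h9 := sq_nonneg ‖mp (p (n + 3)) - (2 : ℝ) • mp (p (n + 2)) + mp (p (n + 1))‖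
    linarith
  rcases hfin with h | rfl
  · have hE₀ : 0 ≤ errorEnergy mu mp ml E Q y r p N := le_trans (by positivity) (hlow N)
    linarith
  · have h1 := pow_le_pow_left₀ (norm_nonneg _) he₂ 2
    have h2 := pow_le_pow_left₀ (norm_nonneg _) hp₂ 2
    have h3 : S = 0 := by simp [hS]
    rw [h3]
    simp only [Nat.cast_zero, zero_mul, mul_zero, Real.exp_zero, add_zero, zero_add, one_mul]
    nlinarith [mul_nonneg hε hς, sq_nonneg ς]

end Stability

/-! ### The error equations -/

section ErrorEquations

variable {V V₂ W H Hk Hp Hq Hl : Type*} [AddCommGroup V] [Module ℝ V] [AddCommGroup V₂]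
  [Module ℝ V₂] [AddCommGroup W] [Module ℝ W] [NormedAddCommGroup H] [InnerProductSpace ℝ H]
  [NormedAddCommGroup Hk] [InnerProductSpace ℝ Hk] [NormedAddCommGroup Hp] [InnerProductSpace ℝ Hp]
  [NormedAddCommGroup Hq] [InnerProductSpace ℝ Hq] [NormedAddCommGroup Hl] [InnerProductSpace ℝ Hl]

/-- The correction `r` of the boundary values: the solution of `3 r' = r - 3 Q ∂²p` that starts at
zero. The boundary velocity of the scheme is the two-step difference quotient of `Q p + r`. -/
noncomputable def corr (Q : W →ₗ[ℝ] V₂) (p : ℕ → W) : ℕ → V₂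
  | 0 => 0
  | n + 1 => (1 / 3 : ℝ) • corr Q p n - Q (secondDiff p n)

/-- The sequence `∂²x`, indexed from time level `-1`; at level `-1`, where it is not available, it
is replaced by its value at level `0`. -/
def shiftedSecondDiff (x : ℕ → V) (n : ℕ) : V :=
  secondDiff x (n - 1)

/-- The corrected bulk error: `∂²u` is added in the interior, and the boundary values are replaced
by those whose difference quotient is the error of the boundary velocity. -/
noncomputable def correctedError (tr : V →ₗ[ℝ] V₂) (Z : V₂ →ₗ[ℝ] V) (Q : W →ₗ[ℝ] V₂)
    (e u : ℕ → V) (p : ℕ → W) (n : ℕ) : V :=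
  e (n + 1) + shiftedSecondDiff u n - Z (tr (e (n + 1) + shiftedSecondDiff u n)) +
    Z (Q (p (n + 1)) + corr Q p n)

/-- The consistency error of the bulk equation, multiplied by `2τ`. -/
noncomputable def bulkDefect (tr : V →ₗ[ℝ] V₂) (Z : V₂ →ₗ[ℝ] V) (Q : W →ₗ[ℝ] V₂) (τ : ℝ)
    (u : ℕ → V) (p : ℕ → W) (du : ℕ → V) (n : ℕ) : V :=
  (2 * τ) • du n - ((3 : ℝ) • u (n + 3) - (4 : ℝ) • u (n + 2) + u (n + 1)) +
    (3 : ℝ) • Z (Q (secondDiff p (n + 1) - secondDiff p n)) +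
    ((3 : ℝ) • (shiftedSecondDiff u (n + 2) - shiftedSecondDiff u (n + 1)) -
      (shiftedSecondDiff u (n + 1) - shiftedSecondDiff u n)) -
    Z (tr ((3 : ℝ) • (shiftedSecondDiff u (n + 2) - shiftedSecondDiff u (n + 1)) -
      (shiftedSecondDiff u (n + 1) - shiftedSecondDiff u n)))

variable {mu : V →ₗ[ℝ] H} {ku : V →ₗ[ℝ] Hk} {mp : W →ₗ[ℝ] Hp} {kp : W →ₗ[ℝ] Hq}
  {ml : V₂ →ₗ[ℝ] Hl} {tr : V →ₗ[ℝ] V₂} {Z E : V₂ →ₗ[ℝ] V} {Q : W →ₗ[ℝ] V₂} {τ θ μ : ℝ} {N : ℕ}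
  {un u du : ℕ → V} {pn p dp : ℕ → W} {β : ℝ}

theorem shiftedSecondDiff_succ (x : ℕ → V) (n : ℕ) :
    shiftedSecondDiff x (n + 1) = secondDiff x n := rfl

/-- The discrete time derivative of the scheme, in which the boundary velocity is extrapolated from
the surface variable, is that of the corrected error up to the consistency error. -/
theorem defect_identity (n : ℕ)
    (ht₀ : tr (u (n + 1)) = Q (p (n + 1))) (ht₁ : tr (u (n + 2)) = Q (p (n + 2)))
    (ht₂ : tr (u (n + 3)) = Q (p (n + 3))) :
    ((3 : ℝ) • un (n + 3) - (4 : ℝ) • un (n + 2) + un (n + 1)) -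
        Z (tr ((3 : ℝ) • un (n + 3) - (4 : ℝ) • un (n + 2) + un (n + 1))) +
        Z (Q ((5 : ℝ) • pn (n + 2) - (8 : ℝ) • pn (n + 1) + (3 : ℝ) • pn n)) - (2 * τ) • du n =
      ((3 : ℝ) • correctedError tr Z Q (un - u) u (pn - p) (n + 2) -
        (4 : ℝ) • correctedError tr Z Q (un - u) u (pn - p) (n + 1) +
        correctedError tr Z Q (un - u) u (pn - p) n) - bulkDefect tr Z Q τ u p du n := by
  simp only [correctedError, bulkDefect, corr]
  generalize shiftedSecondDiff u (n + 2) = s₂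
  generalize shiftedSecondDiff u (n + 1) = s₁
  generalize shiftedSecondDiff u n = s₀
  simp only [secondDiff, Pi.sub_apply, map_add, map_sub, map_smul, ht₀, ht₁, ht₂, add_assoc,
    Nat.reduceAdd]
  module

/-- The error equations in the form needed for the energy estimate. -/
theorem isErrorRecursion (hZ : ∀ x, tr (Z x) = x) (hτ : 0 < τ)
    (htu : ∀ n < N + 3, tr (u n) = Q (p n))
    (htn : ∀ n < N, tr (un (n + 3)) = Q ((2 : ℝ) • pn (n + 2) - pn (n + 1)))
    (htest : ∀ n < N, ∀ v, tr v = Q (pn (n + 3) - p (n + 3)) →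
      inner ℝ (mu v) (mu (((3 : ℝ) • un (n + 3) - (4 : ℝ) • un (n + 2) + un (n + 1)) -
        Z (tr ((3 : ℝ) • un (n + 3) - (4 : ℝ) • un (n + 2) + un (n + 1))) +
        Z (Q ((5 : ℝ) • pn (n + 2) - (8 : ℝ) • pn (n + 1) + (3 : ℝ) • pn n)) - (2 * τ) • du n)) +
      2 * τ * inner ℝ (ku v) (ku (un (n + 3) - u (n + 3))) +
      inner ℝ (mp (pn (n + 3) - p (n + 3))) (mp (((3 : ℝ) • pn (n + 3) - (4 : ℝ) • pn (n + 2) +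
        pn (n + 1)) - (2 * τ) • dp n)) +
      2 * τ * ‖kp (pn (n + 3) - p (n + 3))‖ ^ 2 = 0) :
    IsErrorRecursion mu ku mp kp tr Z Q τ N (un - u) (shiftedSecondDiff u)
      (correctedError tr Z Q (un - u) u (pn - p)) (corr Q (pn - p)) (pn - p)
      (fun n => (1 / (2 * τ)) • mu (bulkDefect tr Z Q τ u p du n))
      (fun n => (1 / (2 * τ)) • mp ((2 * τ) • dp n -
        ((3 : ℝ) • p (n + 3) - (4 : ℝ) • p (n + 2) + p (n + 1)))) where
  corr_zero := rfl
  corr_succ _ := rfl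
  trace_eq n := by simp [correctedError, hZ]
  error_add n hn := by
    have h1 := htn n hn
    have h2 := htu (n + 3) (by omega)
    have h3 := htu (n + 2) (by omega)
    have h4 := htu (n + 1) (by omega)
    simp only [correctedError, shiftedSecondDiff_succ]
    simp only [secondDiff, Pi.sub_apply, map_add, map_sub, map_smul, h1, h2, h3, h4, add_assoc,
      Nat.reduceAdd]
    module
  variational n hn v hv := by
    have h1 := htest n hn v hv
    rw [defect_identity n (htu (n + 1) (by omega)) (htu (n + 2) (by omega))
      (htu (n + 3) (by omega)), map_sub, inner_sub_right] at h1
    have h2 : ((3 : ℝ) • pn (n + 3) - (4 : ℝ) • pn (n + 2) + pn (n + 1)) - (2 * τ) • dp n =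
        ((3 : ℝ) • (pn - p) (n + 3) - (4 : ℝ) • (pn - p) (n + 2) + (pn - p) (n + 1)) -
          ((2 * τ) • dp n - ((3 : ℝ) • p (n + 3) - (4 : ℝ) • p (n + 2) + p (n + 1))) := by
      simp only [Pi.sub_apply]
      module
    rw [h2] at h1
    simp only [← Pi.sub_apply] at h1
    rw [map_sub mp (_ + _), inner_sub_right (mp _)] at h1
    have h3 : 2 * τ * (1 / (2 * τ)) = 1 := by field_simp
    simp only [inner_smul_right, ← mul_assoc, h3, one_mul]
    linarith

theorem norm_smul_half_inv_le (hτ : 0 < τ) {x : H} (hx : ‖x‖ ≤ 24 * (τ * β)) :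
    ‖(1 / (2 * τ)) • x‖ ≤ 12 * β := by
  rw [norm_smul, Real.norm_of_nonneg (by positivity), one_div, inv_mul_le_iff₀ (by positivity)]
  linarith

/-- The error of the splitting scheme in terms of the initial errors `ε` and the consistency errors
`β`. -/
theorem error_estimate_of_consistency (hc : IsCoupling mu ku mp ml tr Z E Q τ θ μ)
    (hZ : ∀ x, tr (Z x) = x) (hτ : 0 < τ) (hτ' : τ ≤ 1 / 2) (hθ₀ : 0 ≤ θ) (hθ : θ ≤ 1 / 48)
    (hμ₀ : 0 ≤ μ) (hμ : μ ≤ 1 / 1000) {ε : ℝ}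
    (htu : ∀ n < N + 3, tr (u n) = Q (p n))
    (htn : ∀ n < N, tr (un (n + 3)) = Q ((2 : ℝ) • pn (n + 2) - pn (n + 1)))
    (htest : ∀ n < N, ∀ v, tr v = Q (pn (n + 3) - p (n + 3)) →
      inner ℝ (mu v) (mu (((3 : ℝ) • un (n + 3) - (4 : ℝ) • un (n + 2) + un (n + 1)) -
        Z (tr ((3 : ℝ) • un (n + 3) - (4 : ℝ) • un (n + 2) + un (n + 1))) +
        Z (Q ((5 : ℝ) • pn (n + 2) - (8 : ℝ) • pn (n + 1) + (3 : ℝ) • pn n)) - (2 * τ) • du n)) +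
      2 * τ * inner ℝ (ku v) (ku (un (n + 3) - u (n + 3))) +
      inner ℝ (mp (pn (n + 3) - p (n + 3))) (mp (((3 : ℝ) • pn (n + 3) - (4 : ℝ) • pn (n + 2) +
        pn (n + 1)) - (2 * τ) • dp n)) +
      2 * τ * ‖kp (pn (n + 3) - p (n + 3))‖ ^ 2 = 0)
    (hti : ∀ n < 3, tr (un n) = Q (pn n)) (hui : ∀ n < 3, ‖mu (un n - u n)‖ ≤ ε)
    (hpi : ∀ n < 3, ‖mp (pn n - p n)‖ ≤ ε)
    (hu₂ : ∀ n < N + 1, ‖mu (secondDiff u n)‖ ≤ β) (hp₂ : ∀ n < N + 1, ‖mp (secondDiff p n)‖ ≤ β)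
    (hk₂ : ∀ n < N + 1, ‖ku (secondDiff u n)‖ ≤ β)
    (hu₃ : ∀ n < N, ‖mu (secondDiff u (n + 1) - secondDiff u n)‖ ≤ τ * β)
    (hp₃ : ∀ n < N, ‖mp (secondDiff p (n + 1) - secondDiff p n)‖ ≤ τ * β)
    (hu₁ : ∀ n < N, ‖mu ((3 : ℝ) • u (n + 3) - (4 : ℝ) • u (n + 2) + u (n + 1) - (2 * τ) • du n)‖ ≤
      12 * (τ * β))
    (hp₁ : ∀ n < N, ‖mp ((3 : ℝ) • p (n + 3) - (4 : ℝ) • p (n + 2) + p (n + 1) - (2 * τ) • dp n)‖ ≤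
      12 * (τ * β)) :
    ‖mu (un (N + 2) - u (N + 2))‖ ^ 2 + ‖mp (pn (N + 2) - p (N + 2))‖ ^ 2 +
        τ * ∑ i ∈ Finset.Icc 1 N, (‖ku (un (i + 2) - u (i + 2))‖ ^ 2 +
          ‖kp (pn (i + 2) - p (i + 2))‖ ^ 2) ≤
      3 * (Real.exp (2 * (N * τ)) *
        (28 * (5 * ε + 2 * β) ^ 2 + N * τ * (24 * (12 * β) ^ 2 + 4 * β ^ 2))) + 3 * β ^ 2 := by
  have hr := isErrorRecursion hZ hτ htu htn htest
  have hβ : 0 ≤ β := (norm_nonneg _).trans (hu₂ 0 (by omega))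
  have hs : ∀ n < N + 2, ‖mu (shiftedSecondDiff u n)‖ ≤ β := fun n hn => hu₂ _ (by omega)
  have htr : ∀ n < N + 1, tr (secondDiff u n) = Q (secondDiff p n) := fun n hn => by
    rw [map_secondDiff, map_secondDiff, htu _ (by omega), htu _ (by omega), htu _ (by omega)]
  have hts : ∀ n < N + 2, ‖ml (tr (shiftedSecondDiff u n))‖ ≤ β := fun n hn => by
    rw [shiftedSecondDiff, htr _ (by omega)]
    exact (hc.proj_le _).trans (hp₂ _ (by omega))
  have hZQ : ∀ x, ‖mu (Z (Q x))‖ ≤ ‖mp x‖ := fun x => by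
    refine le_trans (le_of_sq_le_sq ((hc.mass_zero_le _).trans ?_) (norm_nonneg _)) (hc.proj_le x)
    nlinarith [sq_nonneg ‖ml (Q x)‖]
  have hd : ∀ n < N, ‖mu (shiftedSecondDiff u (n + 1) - shiftedSecondDiff u n)‖ ≤ τ * β ∧
      ‖mu (Z (tr (shiftedSecondDiff u (n + 1) - shiftedSecondDiff u n)))‖ ≤ τ * β := by
    intro n hn
    rcases n with _ | n
    · simp only [shiftedSecondDiff, Nat.sub_self, zero_add, Nat.zero_sub, sub_self, map_zero,
        norm_zero]
      exact ⟨by positivity, by positivity⟩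
    · refine ⟨hu₃ n (by omega), ?_⟩
      rw [map_sub, shiftedSecondDiff_succ, shiftedSecondDiff_succ, htr _ (by omega),
        htr _ (by omega), ← map_sub]
      exact (hZQ _).trans (hp₃ n (by omega))
  refine error_bound hc hr hτ.le hτ' hθ₀ hθ hμ₀ hμ (ε := ε) (fun n => by
    simp only [correctedError, map_add, map_sub, hZ]; abel) (by
    simp only [Pi.sub_apply, map_sub, hti 1 (by omega), htu 1 (by omega)]) (by
    simp only [Pi.sub_apply, map_sub, hti 2 (by omega), htu 2 (by omega)])
    (hui 1 (by omega)) (hui 2 (by omega)) (hpi 0 (by omega)) (hpi 1 (by omega)) (hpi 2 (by omega))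
    hs hts (fun n hn => hk₂ (n + 1) (by omega)) (fun n hn => norm_smul_half_inv_le hτ ?_)
    (fun n hn => norm_smul_half_inv_le hτ ?_)
  · have hA := hu₁ n hn
    have hB := (hZQ _).trans (hp₃ n hn)
    have hC := hu₃ n hn
    have hD := hd n hn
    have hE : ‖mu (Z (tr (secondDiff u (n + 1) - secondDiff u n)))‖ ≤ τ * β := by
      rw [map_sub, htr _ (by omega), htr _ (by omega), ← map_sub]
      exact hB
    rw [← shiftedSecondDiff_succ u (n + 1), ← shiftedSecondDiff_succ u n] at hC hE
    have hsum : mu (bulkDefect tr Z Q τ u p du n) =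
        -mu ((3 : ℝ) • u (n + 3) - (4 : ℝ) • u (n + 2) + u (n + 1) - (2 * τ) • du n) +
        (3 : ℝ) • mu (Z (Q (secondDiff p (n + 1) - secondDiff p n))) +
        (3 : ℝ) • mu (shiftedSecondDiff u (n + 2) - shiftedSecondDiff u (n + 1)) -
        mu (shiftedSecondDiff u (n + 1) - shiftedSecondDiff u n) -
        (3 : ℝ) • mu (Z (tr (shiftedSecondDiff u (n + 2) - shiftedSecondDiff u (n + 1)))) +
        mu (Z (tr (shiftedSecondDiff u (n + 1) - shiftedSecondDiff u n))) := by
      simp only [bulkDefect, map_add, map_sub, map_smul]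
      module
    rw [hsum]
    refine (norm_add_le_of_le (norm_sub_le_of_le (norm_sub_le_of_le (norm_add_le_of_le
      (norm_add_le_of_le (norm_neg _).le (norm_smul_le _ _)) (norm_smul_le _ _)) le_rfl)
      (norm_smul_le _ _)) le_rfl).trans ?_
    rw [Real.norm_of_nonneg (by norm_num : (0 : ℝ) ≤ 3)]
    have : 0 ≤ τ * β := by positivity
    linarith [hD.1, hD.2]
  · have hA := hp₁ n hn
    rw [← norm_neg, ← map_neg, neg_sub]
    have : 0 ≤ τ * β := by positivity
    linarith

end ErrorEquations

/-! ### Norms and extensions of coefficient vectors -/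

section Matrices

open scoped MatrixOrder in
/-- A positive semidefinite matrix is the Gram matrix of a linear map. -/
theorem exists_linearMap_inner_eq {ι : Type} [Fintype ι] {M : Matrix ι ι ℝ}
    (hM : M.PosSemidef) :
    ∃ F : (ι → ℝ) →ₗ[ℝ] EuclideanSpace ℝ ι, ∀ x y, inner ℝ (F x) (F y) = x ⬝ᵥ (M *ᵥ y) := by
  classical
  obtain ⟨B, hB⟩ := CStarAlgebra.nonneg_iff_eq_star_mul_self.mp hM.nonneg
  refine ⟨(WithLp.linearEquiv 2 ℝ (ι → ℝ)).symm.toLinearMap ∘ₗ B.mulVecLin, fun x y => ?_⟩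
  have h : x ⬝ᵥ (M *ᵥ y) = (B *ᵥ x) ⬝ᵥ (B *ᵥ y) := by
    rw [hB, star_eq_conjTranspose, conjTranspose_eq_transpose_of_trivial, ← mulVec_mulVec,
      dotProduct_mulVec, vecMul_transpose]
  rw [h, EuclideanSpace.inner_eq_star_dotProduct]
  simp [dotProduct_comm]

variable {ι₁ ι₂ ιp : Type}

/-- The boundary part of a coefficient vector. -/
def traceMap : (ι₁ ⊕ ι₂ → ℝ) →ₗ[ℝ] (ι₂ → ℝ) := LinearMap.funLeft ℝ ℝ Sum.inr

/-- The extension of boundary coefficients by zero. -/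
def zeroExt : (ι₂ → ℝ) →ₗ[ℝ] (ι₁ ⊕ ι₂ → ℝ) where
  toFun x := Sum.elim 0 x
  map_add' x y := by ext (i | i) <;> simp
  map_smul' c x := by ext (i | i) <;> simp

@[simp] theorem traceMap_apply (v : ι₁ ⊕ ι₂ → ℝ) : traceMap v = v ∘ Sum.inr := rfl

@[simp] theorem zeroExt_apply (x : ι₂ → ℝ) :
    (zeroExt x : ι₁ ⊕ ι₂ → ℝ) = Sum.elim (0 : ι₁ → ℝ) x := rfl

variable [Fintype ι₁] [Fintype ι₂] [Fintype ιp]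

/-- The extension of boundary coefficients that is orthogonal, with respect to the mass matrix, to
all vectors that vanish on the boundary. -/
noncomputable def massExt [DecidableEq ι₁] (M : Matrix (ι₁ ⊕ ι₂) (ι₁ ⊕ ι₂) ℝ) :
    (ι₂ → ℝ) →ₗ[ℝ] (ι₁ ⊕ ι₂ → ℝ) where
  toFun x := Sum.elim (-(M.toBlocks₁₁⁻¹ *ᵥ (M.toBlocks₁₂ *ᵥ x))) x
  map_add' x y := by ext (i | i) <;> simp [mulVec_add, add_comm]
  map_smul' c x := by ext (i | i) <;> simp [mulVec_smul]

/-- The matrix of the `L²`-projection of surface functions onto the trace space. -/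
noncomputable def traceProj [DecidableEq ι₂] (A : FEMatrices ι₁ ι₂ ιp) : (ιp → ℝ) →ₗ[ℝ] (ι₂ → ℝ) :=
  (A.Ml⁻¹ * A.Bp).mulVecLin

/-- The defining property of the orthogonal extension: it is orthogonal to every vector that
vanishes on the boundary. -/
theorem mulVec_massExt_inl [DecidableEq ι₁] {M : Matrix (ι₁ ⊕ ι₂) (ι₁ ⊕ ι₂) ℝ} (hM : M.PosDef) (x : ι₂ → ℝ) :
    (M *ᵥ massExt M x) ∘ Sum.inl = 0 := by
  have h11 : IsUnit M.toBlocks₁₁.det :=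
    (isUnit_iff_isUnit_det _).1 (hM.submatrix Sum.inl_injective).isUnit
  have h : M *ᵥ massExt M x = Sum.elim
      (M.toBlocks₁₁ *ᵥ (-(M.toBlocks₁₁⁻¹ *ᵥ (M.toBlocks₁₂ *ᵥ x))) + M.toBlocks₁₂ *ᵥ x)
      (M.toBlocks₂₁ *ᵥ (-(M.toBlocks₁₁⁻¹ *ᵥ (M.toBlocks₁₂ *ᵥ x))) + M.toBlocks₂₂ *ᵥ x) := by
    conv_lhs => rw [← fromBlocks_toBlocks M, fromBlocks_mulVec]
    simp [massExt]
  rw [h, Sum.elim_comp_inl, mulVec_neg, mulVec_mulVec, mul_nonsing_inv _ h11, one_mulVec,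
    neg_add_cancel]

theorem dotProduct_eq_of_inl_eq_zero {w : ι₁ ⊕ ι₂ → ℝ} (hw : w ∘ Sum.inl = 0) (v : ι₁ ⊕ ι₂ → ℝ) :
    v ⬝ᵥ w = (v ∘ Sum.inr) ⬝ᵥ (w ∘ Sum.inr) := by
  have h : ∀ i, w (Sum.inl i) = 0 := fun i => congrFun hw i
  simp [dotProduct, Fintype.sum_sum_type, h]

theorem mulVec_traceProj [DecidableEq ι₂] {A : FEMatrices ι₁ ι₂ ιp} {a b h : ℝ}
    (hA : IsAdmissible A a b h)
    (y : ιp → ℝ) : A.Ml *ᵥ traceProj A y = A.Bp *ᵥ y := by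
  have : IsUnit A.Ml.det := (isUnit_iff_isUnit_det _).1 hA.posDef_Ml.isUnit
  rw [traceProj, mulVecLin_apply, mulVec_mulVec, ← Matrix.mul_assoc, mul_nonsing_inv _ this,
    Matrix.one_mul]

theorem eq_traceProj [DecidableEq ι₂] {A : FEMatrices ι₁ ι₂ ιp} {a b h : ℝ} (hA : IsAdmissible A a b h)
    {x : ι₂ → ℝ} {y : ιp → ℝ} (hxy : A.Ml *ᵥ x = A.Bp *ᵥ y) : x = traceProj A y := by
  have : IsUnit A.Ml.det := (isUnit_iff_isUnit_det _).1 hA.posDef_Ml.isUnit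
  rw [traceProj, mulVecLin_apply, ← mulVec_mulVec, ← hxy, mulVec_mulVec, nonsing_inv_mul _ this,
    one_mulVec]

theorem mulVec_Bu {A : FEMatrices ι₁ ι₂ ιp} {a b h : ℝ} (hA : IsAdmissible A a b h)
    (v : ι₁ ⊕ ι₂ → ℝ) : A.Bu *ᵥ v = A.Ml *ᵥ (v ∘ Sum.inr) := by
  rw [hA.Bu_eq, fromCols_mulVec, zero_mulVec, zero_add]

/-- The finite element bounds yield the structure used by the energy estimate, with the small
factors `a h` and `τ a b / h`. -/
theorem IsAdmissible.isCoupling [DecidableEq ι₁] [DecidableEq ι₂]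
    {A : FEMatrices ι₁ ι₂ ιp} {a b h τ : ℝ} (hA : IsAdmissible A a b h)
    (hb : 0 ≤ b) (hh : 0 < h) (hτ : 0 ≤ τ) {H Hk Hp Hl : Type*}
    [NormedAddCommGroup H] [InnerProductSpace ℝ H] [NormedAddCommGroup Hk] [InnerProductSpace ℝ Hk]
    [NormedAddCommGroup Hp] [InnerProductSpace ℝ Hp] [NormedAddCommGroup Hl]
    [InnerProductSpace ℝ Hl]
    {mu : (ι₁ ⊕ ι₂ → ℝ) →ₗ[ℝ] H} {ku : (ι₁ ⊕ ι₂ → ℝ) →ₗ[ℝ] Hk} {mp : (ιp → ℝ) →ₗ[ℝ] Hp}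
    {ml : (ι₂ → ℝ) →ₗ[ℝ] Hl}
    (hmu : ∀ x y, inner ℝ (mu x) (mu y) = x ⬝ᵥ (A.Mu *ᵥ y))
    (hku : ∀ x y, inner ℝ (ku x) (ku y) = x ⬝ᵥ (A.Ku *ᵥ y))
    (hmp : ∀ x y, inner ℝ (mp x) (mp y) = x ⬝ᵥ (A.Mp *ᵥ y))
    (hml : ∀ x y, inner ℝ (ml x) (ml y) = x ⬝ᵥ (A.Ml *ᵥ y)) :
    IsCoupling mu ku mp ml traceMap zeroExt (massExt A.Mu) (traceProj A) τ (a * h)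
      (τ * (a * b / h)) := by
  have hort : ∀ x v, inner ℝ (mu (massExt A.Mu x)) (mu v) =
      (v ∘ Sum.inr) ⬝ᵥ ((A.Mu *ᵥ massExt A.Mu x) ∘ Sum.inr) := fun x v => by
    rw [real_inner_comm, hmu, dotProduct_eq_of_inl_eq_zero (mulVec_massExt_inl hA.posDef_Mu x)]
  have htr : ∀ x : ι₂ → ℝ, massExt A.Mu x ∘ Sum.inr = x := fun x => rfl
  have hz : ∀ x, ‖mu (zeroExt x)‖ ^ 2 ≤ a * h * ‖ml x‖ ^ 2 := fun x => by
    rw [← real_inner_self_eq_norm_sq, ← real_inner_self_eq_norm_sq, hmu, hml]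
    exact hA.extension_le x
  -- the orthogonal extension has the smallest mass norm
  have hez : ∀ x, ‖mu (massExt A.Mu x)‖ ^ 2 ≤ ‖mu (zeroExt x)‖ ^ 2 := fun x => by
    have h1 : inner ℝ (mu (massExt A.Mu x)) (mu (massExt A.Mu x)) =
        inner ℝ (mu (massExt A.Mu x)) (mu (zeroExt x)) := by
      rw [hort, hort]; rfl
    rw [real_inner_self_eq_norm_sq] at h1
    have h2 := real_inner_le_norm (mu (massExt A.Mu x)) (mu (zeroExt x))
    nlinarith [sq_nonneg (‖mu (massExt A.Mu x)‖ - ‖mu (zeroExt x)‖)]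
  have hinv : ∀ {v : ι₁ ⊕ ι₂ → ℝ} {x : ι₂ → ℝ}, ‖mu v‖ ^ 2 ≤ a * h * ‖ml x‖ ^ 2 →
      τ * ‖ku v‖ ^ 2 ≤ τ * (a * b / h) * ‖ml x‖ ^ 2 := fun {v x} hv => by
    have h1 := hA.inverse_le v
    rw [sqNorm, sqNorm, ← hku, ← hmu, real_inner_self_eq_norm_sq, real_inner_self_eq_norm_sq] at h1
    rw [mul_assoc]
    refine mul_le_mul_of_nonneg_left ?_ hτ
    have h2 : h ^ 2 * ‖ku v‖ ^ 2 ≤ h ^ 2 * (a * b / h * ‖ml x‖ ^ 2) := by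
      calc h ^ 2 * ‖ku v‖ ^ 2 ≤ b * ‖mu v‖ ^ 2 := h1
        _ ≤ b * (a * h * ‖ml x‖ ^ 2) := by gcongr
        _ = h ^ 2 * (a * b / h * ‖ml x‖ ^ 2) := by field_simp
    exact le_of_mul_le_mul_left h2 (by positivity)
  exact
    { trace_ext := htr
      inner_ext := fun x v => by rw [hort, hort]; rfl
      mass_zero_le := hz
      mass_ext_le := fun x => (hez x).trans (hz x)
      energy_zero_le := fun x => hinv (hz x)
      energy_ext_le := fun x => hinv ((hez x).trans (hz x))
      proj_le := fun y => by
        have h1 := hA.sq_Bp_le (traceProj A y) y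
        rw [← mulVec_traceProj hA, sqNorm, sqNorm, ← hml, ← hmp, real_inner_self_eq_norm_sq,
          real_inner_self_eq_norm_sq] at h1
        by_contra! hlt
        have h2 : 0 < ‖ml (traceProj A y)‖ := (norm_nonneg _).trans_lt hlt
        have h3 : ‖mp y‖ ^ 2 < ‖ml (traceProj A y)‖ ^ 2 := by gcongr
        nlinarith [pow_pos h2 2] }

end Matrices

section Scheme

variable {ι₁ ι₂ ιp : Type} [Fintype ι₁] [Fintype ι₂] [Fintype ιp]

/-- The interior and boundary rows of the scheme, written as one equation for the whole bulk
vector. -/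
theorem mulVec_eq_of_blocks (M K : Matrix (ι₁ ⊕ ι₂) (ι₁ ⊕ ι₂) ℝ) (x y f : ι₁ ⊕ ι₂ → ℝ)
    (l : ι₂ → ℝ)
    (h₁ : M.toBlocks₁₁ *ᵥ (x ∘ Sum.inl) + K.toBlocks₁₁ *ᵥ (y ∘ Sum.inl) =
      f ∘ Sum.inl - M.toBlocks₁₂ *ᵥ (x ∘ Sum.inr) - K.toBlocks₁₂ *ᵥ (y ∘ Sum.inr))
    (h₂ : M.toBlocks₂₁ *ᵥ (x ∘ Sum.inl) + K.toBlocks₂₁ *ᵥ (y ∘ Sum.inl) - l =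
      f ∘ Sum.inr - M.toBlocks₂₂ *ᵥ (x ∘ Sum.inr) - K.toBlocks₂₂ *ᵥ (y ∘ Sum.inr)) :
    M *ᵥ x + K *ᵥ y - Sum.elim (0 : ι₁ → ℝ) l = f := by
  have hM := fromBlocks_mulVec M.toBlocks₁₁ M.toBlocks₁₂ M.toBlocks₂₁ M.toBlocks₂₂ x
  have hK := fromBlocks_mulVec K.toBlocks₁₁ K.toBlocks₁₂ K.toBlocks₂₁ K.toBlocks₂₂ y
  rw [fromBlocks_toBlocks] at hM hK
  rw [hM, hK]
  ext (i | i)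
  · have := congrFun h₁ i
    simp only [Pi.add_apply, Pi.sub_apply, Sum.elim_inl, Function.comp_apply, Pi.zero_apply] at this ⊢
    linarith
  · have := congrFun h₂ i
    simp only [Pi.add_apply, Pi.sub_apply, Sum.elim_inr, Function.comp_apply] at this ⊢
    linarith

/-- The error equation, tested with functions whose bulk trace is the projection of the surface
part; the multiplier drops out. -/
theorem error_equation {A : FEMatrices ι₁ ι₂ ιp} {a b h : ℝ} (hA : IsAdmissible A a b h)
    {x x' y y' f v : ι₁ ⊕ ι₂ → ℝ} {l l' : ι₂ → ℝ} {z z' q q' g w : ιp → ℝ}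
    (h₁ : A.Mu *ᵥ x + A.Ku *ᵥ y - Sum.elim (0 : ι₁ → ℝ) (A.Ml *ᵥ l) = f)
    (h₂ : A.Mp *ᵥ z + A.Kp *ᵥ q + A.Bpᵀ *ᵥ l = g)
    (h₁' : A.Mu *ᵥ x' + A.Ku *ᵥ y' - A.Buᵀ *ᵥ l' = f)
    (h₂' : A.Mp *ᵥ z' + A.Kp *ᵥ q' + A.Bpᵀ *ᵥ l' = g)
    (hv : A.Ml *ᵥ (v ∘ Sum.inr) = A.Bp *ᵥ w) :
    v ⬝ᵥ (A.Mu *ᵥ (x - x')) + v ⬝ᵥ (A.Ku *ᵥ (y - y')) + w ⬝ᵥ (A.Mp *ᵥ (z - z')) +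
      w ⬝ᵥ (A.Kp *ᵥ (q - q')) = 0 := by
  have hsym : A.Mlᵀ = A.Ml := by
    have := hA.posDef_Ml.isHermitian.eq
    rwa [conjTranspose_eq_transpose_of_trivial] at this
  have hBu : ∀ l, v ⬝ᵥ (A.Buᵀ *ᵥ l) = w ⬝ᵥ (A.Bpᵀ *ᵥ l) := fun l => by
    rw [dotProduct_mulVec, vecMul_transpose, dotProduct_mulVec, vecMul_transpose, ← hv, hA.Bu_eq,
      fromCols_mulVec, zero_mulVec, zero_add]
  have hMl : v ⬝ᵥ (Sum.elim (0 : ι₁ → ℝ) (A.Ml *ᵥ l)) = w ⬝ᵥ (A.Bpᵀ *ᵥ l) := by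
    rw [dotProduct_eq_of_inl_eq_zero (by simp), Sum.elim_comp_inr, dotProduct_mulVec,
      dotProduct_mulVec, vecMul_transpose, ← hv]
    conv_lhs => rw [← hsym, vecMul_transpose]
  have e₁ := congrArg (v ⬝ᵥ ·) (h₁.trans h₁'.symm)
  have e₂ := congrArg (w ⬝ᵥ ·) (h₂.trans h₂'.symm)
  simp only [dotProduct_add, dotProduct_sub, hMl, hBu] at e₁ e₂
  simp only [mulVec_sub, dotProduct_sub]
  linarith

end Scheme

/-! ### Convergence -/

section Sampling

/-- The values of `u` at the time levels `-2, -1, 0, …` of a uniform grid. -/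
def sample {V : Type*} (τ : ℝ) (u : ℝ → V) (j : ℕ) : V := u (((j : ℝ) - 2) * τ)

theorem sample_eq {V : Type*} {τ t : ℝ} (u : ℝ → V) {j : ℕ} (h : ((j : ℝ) - 2) * τ = t) :
    sample τ u j = u t := by rw [sample, h]

variable {ι : Type} [Fintype ι] {H : Type*} [NormedAddCommGroup H] [InnerProductSpace ℝ H]
  {F : (ι → ℝ) →ₗ[ℝ] H} {u : ℝ → ι → ℝ} {τ T B : ℝ}

theorem hasDerivWithinAt_map_iteratedDerivWithin (F : (ι → ℝ) →ₗ[ℝ] H) {I : Set ℝ}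
    (hI : UniqueDiffOn ℝ I) (hu : ContDiffOn ℝ 4 u I) {j : ℕ} (hj : j < 4) :
    ∀ t ∈ I, HasDerivWithinAt (fun t => F (iteratedDerivWithin j u I t))
      (F (iteratedDerivWithin (j + 1) u I t)) I t := by
  intro t ht
  have h1 := (hu.differentiableOn_iteratedDerivWithin (m := j) (by exact_mod_cast hj) hI t
    ht).hasDerivWithinAt
  rw [← iteratedDerivWithin_succ] at h1
  exact F.toContinuousLinearMap.hasFDerivAt.comp_hasDerivWithinAt t h1

theorem norm_map_secondDiff_sample_le (hτ : 0 < τ) (hT : 0 ≤ T)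
    (hu : ContDiffOn ℝ 4 u (Icc (-2 * τ) T))
    (hB : ∀ t ∈ Icc (-2 * τ) T, ‖F (iteratedDerivWithin 2 u (Icc (-2 * τ) T) t)‖ ≤ B) {n : ℕ}
    (hn : n * τ ≤ T) : ‖F (secondDiff (sample τ u) n)‖ ≤ τ ^ 2 * B := by
  have hI := uniqueDiffOn_Icc (show -2 * τ < T by linarith)
  have h := norm_second_difference_le hτ.le
    (hasDerivWithinAt_map_iteratedDerivWithin F hI hu (j := 0) (by norm_num))
    (hasDerivWithinAt_map_iteratedDerivWithin F hI hu (j := 1) (by norm_num)) hB (t := n * τ)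
    ⟨by ring_nf; positivity, hn⟩
  rw [map_secondDiff, sample_eq u (t := n * τ) (by push_cast; ring),
    sample_eq u (t := n * τ - τ) (by push_cast; ring),
    sample_eq u (t := n * τ - 2 * τ) (by ring)]
  simpa only [iteratedDerivWithin_zero] using h

theorem norm_map_sub_secondDiff_sample_le (hτ : 0 < τ) (hT : 0 ≤ T)
    (hu : ContDiffOn ℝ 4 u (Icc (-2 * τ) T))
    (hB : ∀ t ∈ Icc (-2 * τ) T, ‖F (iteratedDerivWithin 3 u (Icc (-2 * τ) T) t)‖ ≤ B) {n : ℕ}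
    (hn : (n + 1 : ℕ) * τ ≤ T) :
    ‖F (secondDiff (sample τ u) (n + 1) - secondDiff (sample τ u) n)‖ ≤ τ ^ 3 * B := by
  have hI := uniqueDiffOn_Icc (show -2 * τ < T by linarith)
  have h := norm_third_difference_le hτ.le
    (hasDerivWithinAt_map_iteratedDerivWithin F hI hu (j := 0) (by norm_num))
    (hasDerivWithinAt_map_iteratedDerivWithin F hI hu (j := 1) (by norm_num))
    (hasDerivWithinAt_map_iteratedDerivWithin F hI hu (j := 2) (by norm_num)) hB
    (t := (n + 1 : ℕ) * τ) ⟨by push_cast; ring_nf; linarith [(by positivity : 0 ≤ (n : ℝ) * τ)], hn⟩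
  simp only [iteratedDerivWithin_zero] at h
  refine le_trans (le_of_eq (congrArg _ ?_)) h
  rw [map_sub, map_secondDiff, map_secondDiff]
  simp only [add_assoc, Nat.reduceAdd]
  rw [sample_eq u (j := n + 3) (t := (n + 1 : ℕ) * τ) (by push_cast; ring),
    sample_eq u (j := n + 2) (t := (n + 1 : ℕ) * τ - τ) (by push_cast; ring),
    sample_eq u (j := n + 1) (t := (n + 1 : ℕ) * τ - 2 * τ) (by push_cast; ring),
    sample_eq u (j := n) (t := (n + 1 : ℕ) * τ - 3 * τ) (by push_cast; ring)]
  module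

theorem norm_map_bdf_sample_sub_le (hτ : 0 < τ) (hT : 0 ≤ T)
    (hu : ContDiffOn ℝ 4 u (Icc (-2 * τ) T))
    (hB : ∀ t ∈ Icc (-2 * τ) T, ‖F (iteratedDerivWithin 3 u (Icc (-2 * τ) T) t)‖ ≤ B) {n : ℕ}
    (hn : (n + 1 : ℕ) * τ ≤ T) :
    ‖F ((3 : ℝ) • sample τ u (n + 3) - (4 : ℝ) • sample τ u (n + 2) + sample τ u (n + 1) -
      (2 * τ) • sample τ (derivWithin u (Icc (-2 * τ) T)) (n + 3))‖ ≤ 12 * τ ^ 3 * B := by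
  have hI := uniqueDiffOn_Icc (show -2 * τ < T by linarith)
  have h := norm_bdf_sub_deriv_le hτ.le
    (hasDerivWithinAt_map_iteratedDerivWithin F hI hu (j := 0) (by norm_num))
    (hasDerivWithinAt_map_iteratedDerivWithin F hI hu (j := 1) (by norm_num))
    (hasDerivWithinAt_map_iteratedDerivWithin F hI hu (j := 2) (by norm_num)) hB
    (t := (n + 1 : ℕ) * τ) ⟨by push_cast; ring_nf; positivity, hn⟩
  simp only [iteratedDerivWithin_zero, zero_add, iteratedDerivWithin_one] at h
  refine le_trans (le_of_eq (congrArg _ ?_)) h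
  rw [sample_eq u (j := n + 3) (t := (n + 1 : ℕ) * τ) (by push_cast; ring),
    sample_eq _ (j := n + 3) (t := (n + 1 : ℕ) * τ) (by push_cast; ring),
    sample_eq u (j := n + 2) (t := (n + 1 : ℕ) * τ - τ) (by push_cast; ring),
    sample_eq u (j := n + 1) (t := (n + 1 : ℕ) * τ - 2 * τ) (by push_cast; ring)]
  simp only [map_add, map_sub, map_smul]

end Sampling

section Convergence

variable {ι₁ ι₂ ιp : Type} [Fintype ι₁] [Fintype ι₂] [Fintype ιp]

/-- Second-order convergence of the splitting scheme for matrices with the properties established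
for finite elements. -/
theorem error_estimate_of_isAdmissible {A : FEMatrices ι₁ ι₂ ιp} {a b h : ℝ}
    (hA : IsAdmissible A a b h) (ha : 0 ≤ a) (hb : 0 ≤ b) (hh : 0 < h)
    (hh₀ : h ≤ 1 / (48 * (a + 1))) {T C₀ R τ : ℝ} {fu : ℝ → ι₁ ⊕ ι₂ → ℝ} {fp : ℝ → ιp → ℝ}
    (hτ : 0 < τ) (hτh : τ ≤ 1 / (1000 * (a * b + 1)) * h)
    {u : ℝ → ι₁ ⊕ ι₂ → ℝ} {p : ℝ → ιp → ℝ} {lam : ℝ → ι₂ → ℝ}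
    (hsol : IsSemidiscreteSolution A fu fp (Icc (-2 * τ) T) u p lam)
    (hreg : IsRegular A (Icc (-2 * τ) T) R u p)
    {un : ℤ → ι₁ ⊕ ι₂ → ℝ} {lamn wn : ℤ → ι₂ → ℝ} {pn : ℤ → ιp → ℝ}
    (hsch : IsSplittingScheme A fu fp T τ un lamn wn pn)
    (hcons : ∀ i ∈ Finset.Icc (-2 : ℤ) 0, A.Bu *ᵥ un i = A.Bp *ᵥ pn i)
    (hinit : ∀ i ∈ Finset.Icc (-2 : ℤ) 0, sqNorm A.Mu (un i - u (i * τ)) +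
      τ * sqNorm A.Ku (un i - u (i * τ)) + sqNorm A.Mp (pn i - p (i * τ)) +
      τ * sqNorm A.Kp (pn i - p (i * τ)) ≤ C₀ * τ ^ 5) (n : ℕ) (hn : n * τ ≤ T) :
    sqNorm A.Mu (un n - u (n * τ)) + sqNorm A.Mp (pn n - p (n * τ)) +
      τ * ∑ i ∈ Finset.Icc 1 n,
        (sqNorm A.Ku (un i - u (i * τ)) + sqNorm A.Kp (pn i - p (i * τ))) ≤
    (3 * (Real.exp (2 * T) * (28 * (5 * √C₀ + 2 * √R) ^ 2 + T * (3460 * R))) + 3 * R) *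
      τ ^ 4 := by
  classical
  obtain ⟨mu, hmu⟩ := exists_linearMap_inner_eq hA.posDef_Mu.posSemidef
  obtain ⟨ku, hku⟩ := exists_linearMap_inner_eq hA.posSemidef_Ku
  obtain ⟨mp, hmp⟩ := exists_linearMap_inner_eq hA.posSemidef_Mp
  obtain ⟨kp, hkp⟩ := exists_linearMap_inner_eq hA.posSemidef_Kp
  obtain ⟨ml, hml⟩ := exists_linearMap_inner_eq hA.posDef_Ml.posSemidef
  have nmu : ∀ x, sqNorm A.Mu x = ‖mu x‖ ^ 2 := fun x => by
    rw [← real_inner_self_eq_norm_sq, hmu]; rfl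
  have nku : ∀ x, sqNorm A.Ku x = ‖ku x‖ ^ 2 := fun x => by
    rw [← real_inner_self_eq_norm_sq, hku]; rfl
  have nmp : ∀ x, sqNorm A.Mp x = ‖mp x‖ ^ 2 := fun x => by
    rw [← real_inner_self_eq_norm_sq, hmp]; rfl
  have nkp : ∀ x, sqNorm A.Kp x = ‖kp x‖ ^ 2 := fun x => by
    rw [← real_inner_self_eq_norm_sq, hkp]; rfl
  have hc := hA.isCoupling hb hh hτ.le hmu hku hmp hml
  have hT : 0 ≤ T := le_trans (by positivity) hn
  set I := Icc (-2 * τ) T with hI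
  -- the small factors
  have hθ : a * h ≤ 1 / 48 := by
    rw [le_div_iff₀ (by positivity)] at hh₀
    linarith
  have hτh' : τ * (1000 * (a * b + 1)) ≤ h := by
    rw [one_div, ← div_eq_inv_mul, le_div_iff₀ (by positivity)] at hτh
    exact hτh
  have hμ : τ * (a * b / h) ≤ 1 / 1000 := by
    rw [← mul_div_assoc, div_le_iff₀ hh]
    linarith
  have hτ₁ : τ ≤ 1 / 2 := by
    have h1 : h ≤ 1 := hh₀.trans (by
      rw [div_le_one (by positivity)]
      linarith)
    have h2 : 0 ≤ τ * (a * b) := by positivity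
    linarith
  -- bounds of the derivatives and of the initial errors
  have hu₂ : ∀ t ∈ I, ‖mu (iteratedDerivWithin 2 u I t)‖ ≤ √R := fun t ht =>
    Real.le_sqrt_of_sq_le (by rw [← nmu]; exact hreg.bulk_mass t ht 2 (by simp))
  have hu₃ : ∀ t ∈ I, ‖mu (iteratedDerivWithin 3 u I t)‖ ≤ √R := fun t ht =>
    Real.le_sqrt_of_sq_le (by rw [← nmu]; exact hreg.bulk_mass t ht 3 (by simp))
  have hk₂ : ∀ t ∈ I, ‖ku (iteratedDerivWithin 2 u I t)‖ ≤ √R := fun t ht =>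
    Real.le_sqrt_of_sq_le (by rw [← nku]; exact hreg.bulk_energy t ht 2 (by simp))
  have hp₂ : ∀ t ∈ I, ‖mp (iteratedDerivWithin 2 p I t)‖ ≤ √R := fun t ht =>
    Real.le_sqrt_of_sq_le (by rw [← nmp]; exact hreg.surface_mass t ht 2 (by simp))
  have hp₃ : ∀ t ∈ I, ‖mp (iteratedDerivWithin 3 p I t)‖ ≤ √R := fun t ht =>
    Real.le_sqrt_of_sq_le (by rw [← nmp]; exact hreg.surface_mass t ht 3 (by simp))
  have hR : 0 ≤ R := by
    have h0 := hreg.bulk_mass 0 ⟨by linarith, hT⟩ 2 (by simp)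
    rw [nmu] at h0
    exact le_trans (by positivity) h0
  simp only [nmu, nku, nmp, nkp] at hinit ⊢
  have hC₀ : 0 ≤ C₀ := by
    have h0 := le_trans (by positivity) (hinit 0 (by simp))
    exact nonneg_of_mul_nonneg_left h0 (by positivity)
  have hε : ∀ {x : ℝ}, 0 ≤ x → x ^ 2 ≤ C₀ * τ ^ 5 → x ≤ √C₀ * τ ^ 2 := fun {x} hx h => by
    refine le_of_sq_le_sq (h.trans ?_) (by positivity)
    rw [mul_pow, Real.sq_sqrt hC₀, ← pow_mul, pow_succ τ 4, ← mul_assoc]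
    exact mul_le_of_le_one_right (by positivity) (by linarith)
  -- the time levels, counted from `-2`
  set U := sample τ u with hU
  set P := sample τ p with hP
  set Un : ℕ → ι₁ ⊕ ι₂ → ℝ := fun j => un ((j : ℤ) - 2) with hUn
  set Pn : ℕ → ιp → ℝ := fun j => pn ((j : ℤ) - 2) with hPn
  have hmem : ∀ j < n + 3, ((j : ℝ) - 2) * τ ∈ I := fun j hj => by
    have h1 : (0 : ℝ) ≤ j * τ := by positivity
    have h2 : (j : ℝ) ≤ n + 2 := by exact_mod_cast Nat.lt_succ_iff.1 hj
    refine ⟨by linarith, le_trans ?_ hn⟩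
    gcongr
    linarith
  have hle : ∀ j ≤ n, (j : ℝ) * τ ≤ T := fun j hj => le_trans (by gcongr) hn
  have hinit' : ∀ j < 3, ‖mu (Un j - U j)‖ ^ 2 ≤ C₀ * τ ^ 5 ∧ ‖mp (Pn j - P j)‖ ^ 2 ≤ C₀ * τ ^ 5 :=
    fun j hj => by
    have h1 := hinit ((j : ℤ) - 2) (by simp only [Finset.mem_Icc]; omega)
    have h2 : (((j : ℤ) - 2 : ℤ) : ℝ) = (j : ℝ) - 2 := by push_cast; ring
    rw [h2] at h1
    have h3 : 0 ≤ τ * ‖ku (Un j - U j)‖ ^ 2 := by positivity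
    have h4 : 0 ≤ τ * ‖kp (Pn j - P j)‖ ^ 2 := by positivity
    have h5 := sq_nonneg ‖mu (Un j - U j)‖
    have h6 := sq_nonneg ‖mp (Pn j - P j)‖
    simp only [hU, hP, sample, hUn, hPn] at h3 h4 h5 h6 ⊢
    constructor <;> linarith
  have hscale : ∀ m < n, (((m : ℤ) - 2 + 3 : ℤ) : ℝ) * τ ≤ T := fun m hm => by
    have h1 := hle (m + 1) hm
    have h2 : (((m : ℤ) - 2 + 3 : ℤ) : ℝ) = ((m + 1 : ℕ) : ℝ) := by push_cast; ring
    rwa [h2]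
  have key := error_estimate_of_consistency hc (fun x => rfl) hτ hτ₁ (by positivity) hθ
    (by positivity) hμ (N := n) (un := Un) (u := U) (pn := Pn) (p := P) (kp := kp)
    (du := fun m => sample τ (derivWithin u I) (m + 3))
    (dp := fun m => sample τ (derivWithin p I) (m + 3)) (ε := √C₀ * τ ^ 2) (β := τ ^ 2 * √R)
    ?_ ?_ ?_ ?_ (fun j hj => hε (norm_nonneg _) (hinit' j hj).1)
    (fun j hj => hε (norm_nonneg _) (hinit' j hj).2)
    (fun j hj => norm_map_secondDiff_sample_le hτ hT hreg.contDiffOn_bulk hu₂ (hle j (by omega)))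
    (fun j hj => norm_map_secondDiff_sample_le hτ hT hreg.contDiffOn_surface hp₂ (hle j (by omega)))
    (fun j hj => norm_map_secondDiff_sample_le hτ hT hreg.contDiffOn_bulk hk₂ (hle j (by omega)))
    (fun j hj => (norm_map_sub_secondDiff_sample_le hτ hT hreg.contDiffOn_bulk hu₃
      (hle (j + 1) hj)).trans_eq (by ring))
    (fun j hj => (norm_map_sub_secondDiff_sample_le hτ hT hreg.contDiffOn_surface hp₃
      (hle (j + 1) hj)).trans_eq (by ring))
    (fun j hj => (norm_map_bdf_sample_sub_le hτ hT hreg.contDiffOn_bulk hu₃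
      (hle (j + 1) hj)).trans_eq (by ring))
    (fun j hj => (norm_map_bdf_sample_sub_le hτ hT hreg.contDiffOn_surface hp₃
      (hle (j + 1) hj)).trans_eq (by ring))
  · have hV : ∀ i : ℕ, un i - u (i * τ) = Un (i + 2) - U (i + 2) := fun i => by
      simp [hUn, hU, sample]
    have hW : ∀ i : ℕ, pn i - p (i * τ) = Pn (i + 2) - P (i + 2) := fun i => by
      simp [hPn, hP, sample]
    simp only [hV, hW]
    refine key.trans ?_
    have hexp : Real.exp (2 * (n * τ)) ≤ Real.exp (2 * T) := Real.exp_le_exp.2 (by linarith)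
    have hβ : (τ ^ 2 * √R) ^ 2 = R * τ ^ 4 := by rw [mul_pow, Real.sq_sqrt hR]; ring
    have e1 : 28 * (5 * (√C₀ * τ ^ 2) + 2 * (τ ^ 2 * √R)) ^ 2 +
        n * τ * (24 * (12 * (τ ^ 2 * √R)) ^ 2 + 4 * (τ ^ 2 * √R) ^ 2) =
        (28 * (5 * √C₀ + 2 * √R) ^ 2 + n * τ * (3460 * R)) * τ ^ 4 := by
      rw [mul_pow 12, hβ]; ring
    rw [e1, hβ]
    have e2 : Real.exp (2 * (n * τ)) *
        ((28 * (5 * √C₀ + 2 * √R) ^ 2 + n * τ * (3460 * R)) * τ ^ 4) ≤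
        Real.exp (2 * T) * ((28 * (5 * √C₀ + 2 * √R) ^ 2 + T * (3460 * R)) * τ ^ 4) := by gcongr
    linarith
  · -- the constraint of the semi-discrete problem
    intro j hj
    refine eq_traceProj hA ?_
    rw [traceMap_apply, ← mulVec_Bu hA]
    exact hsol.constraint _ (hmem j hj)
  · -- the constraint of the scheme
    intro m hm
    refine eq_traceProj hA ?_
    have h1 := hsch.constraint ((m : ℤ) - 2) (by omega) (hscale m hm)
    rw [show (m : ℤ) - 2 + 3 = m + 1 by ring, show (m : ℤ) - 2 + 2 = m by ring,
      show (m : ℤ) - 2 + 1 = m - 1 by ring] at h1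
    rw [traceMap_apply]
    simp only [hUn, hPn]
    rw [show ((m + 3 : ℕ) : ℤ) - 2 = m + 1 by push_cast; ring,
      show ((m + 2 : ℕ) : ℤ) - 2 = m by push_cast; ring,
      show ((m + 1 : ℕ) : ℤ) - 2 = m - 1 by push_cast; ring]
    exact h1
  · intro m hm v hv
    have e0 := hscale m hm
    have b1 := hsch.bulk_interior ((m : ℤ) - 2) (by omega) e0
    have b2 := hsch.bulk_boundary ((m : ℤ) - 2) (by omega) e0
    have b3 := hsch.constraint_deriv ((m : ℤ) - 2) (by omega) e0
    have b4 := hsch.surface ((m : ℤ) - 2) (by omega) e0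
    have hidx : ((((m : ℤ) - 2 + 3 : ℤ) : ℝ)) * τ = (((m + 3 : ℕ) : ℝ) - 2) * τ := by
      push_cast; ring
    rw [hidx] at b1 b2 b4
    rw [show (m : ℤ) - 2 + 3 = m + 1 by ring] at b1 b2 b3 b4
    rw [show (m : ℤ) - 2 + 2 = m by ring] at b3
    have s1 := hsol.bulk _ (hmem (m + 3) (by omega))
    have s2 := hsol.surface _ (hmem (m + 3) (by omega))
    have h3 : Un (m + 3) = un (m + 1) := by simp only [hUn]; congr 1; push_cast; ring
    have h2 : Un (m + 2) = un m := by simp only [hUn]; congr 1; push_cast; ring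
    have h1 : Un (m + 1) = un (m - 1) := by simp only [hUn]; congr 1; push_cast; ring
    have q3 : Pn (m + 3) = pn (m + 1) := by simp only [hPn]; congr 1; push_cast; ring
    have q2 : Pn (m + 2) = pn m := by simp only [hPn]; congr 1; push_cast; ring
    have q1 : Pn (m + 1) = pn (m - 1) := by simp only [hPn]; congr 1; push_cast; ring
    have q0 : Pn m = pn (m - 2) := rfl
    have hfull := mulVec_eq_of_blocks A.Mu A.Ku
      (Sum.elim (bdf τ (fun k => un k ∘ Sum.inl) (m + 1)) (wn (m + 1))) (un (m + 1)) _ _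
      (by simpa only [Sum.elim_comp_inl, Sum.elim_comp_inr] using b1)
      (by simpa only [Sum.elim_comp_inl, Sum.elim_comp_inr] using b2)
    have herr := error_equation hA (v := v) (w := Pn (m + 3) - P (m + 3)) hfull b4 s1 s2 (by
      rw [← traceMap_apply, hv, mulVec_traceProj hA])
    rw [← hmu, ← hku, ← hmp, ← hkp] at herr
    have hw := eq_traceProj hA b3
    have hx : (2 * τ) • (Sum.elim (bdf τ (fun k => un k ∘ Sum.inl) (m + 1)) (wn (m + 1)) -
        derivWithin u I ((((m + 3 : ℕ) : ℝ) - 2) * τ)) =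
        ((3 : ℝ) • Un (m + 3) - (4 : ℝ) • Un (m + 2) + Un (m + 1)) -
          zeroExt (traceMap ((3 : ℝ) • Un (m + 3) - (4 : ℝ) • Un (m + 2) + Un (m + 1))) +
          zeroExt (traceProj A ((5 : ℝ) • Pn (m + 2) - (8 : ℝ) • Pn (m + 1) + (3 : ℝ) • Pn m)) -
          (2 * τ) • sample τ (derivWithin u I) (m + 3) := by
      rw [smul_sub]
      congr 1
      rw [hw, altDiff, map_smul, h3, h2, h1, q2, q1, q0]
      ext (i | i)
      · simp only [bdf, Pi.smul_apply, Pi.add_apply, Pi.sub_apply, Sum.elim_inl, smul_eq_mul,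
          zeroExt_apply, Function.comp_apply, Pi.zero_apply]
        rw [show (m : ℤ) + 1 - 1 = m by ring, show (m : ℤ) + 1 - 2 = m - 1 by ring]
        field_simp
        ring
      · simp only [Pi.smul_apply, Pi.add_apply, Pi.sub_apply, Sum.elim_inr, smul_eq_mul,
          zeroExt_apply, traceMap_apply, Function.comp_apply]
        field_simp
        ring
    have hy : (2 * τ) • (bdf τ pn (m + 1) - derivWithin p I ((((m + 3 : ℕ) : ℝ) - 2) * τ)) =
        ((3 : ℝ) • Pn (m + 3) - (4 : ℝ) • Pn (m + 2) + Pn (m + 1)) -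
          (2 * τ) • sample τ (derivWithin p I) (m + 3) := by
      rw [smul_sub]
      congr 1
      rw [bdf, q3, q2, q1, show (m : ℤ) + 1 - 1 = m by ring, show (m : ℤ) + 1 - 2 = m - 1 by ring,
        smul_smul, mul_one_div_cancel (by positivity), one_smul]
    rw [← hx, ← hy, map_smul, map_smul, inner_smul_right, inner_smul_right]
    rw [← h3, ← q3] at herr
    have hfin := congrArg (2 * τ * ·) herr
    simp only [mul_add, mul_zero] at hfin
    rw [← real_inner_self_eq_norm_sq]
    exact hfin
  · -- the consistency of the initial values
    intro j hj
    refine eq_traceProj hA ?_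
    rw [traceMap_apply, ← mulVec_Bu hA]
    exact hcons _ (by simp only [Finset.mem_Icc]; omega)

end Convergence

end BulkSurface

theorem mainTheorem1
    (d : ℕ) (hd : d = 2 ∨ d = 3) (k : ℕ) (hk : 1 ≤ k) (σ α₁ : ℝ) (hσ : 0 < σ) :
    ∃ c > (0 : ℝ), ∃ h₀ > (0 : ℝ), ∀ T C₀ R : ℝ, 0 < T → ∃ C : ℝ,
      -- the domain, the coefficients and the spatial discretization
      ∀ (Ω : Set (EuclideanSpace ℝ (Fin d)))
        (α κ : EuclideanSpace ℝ (Fin d) → ℝ) (α₀ κ₀ κ₁ : ℝ)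
        (K KΓ : Geometry.SimplicialComplex ℝ (EuclideanSpace ℝ (Fin d))) (m N₁ Nl Np : ℕ)
        (node : Fin N₁ ⊕ Fin Nl → EuclideanSpace ℝ (Fin d))
        (φ : Fin N₁ ⊕ Fin Nl → EuclideanSpace ℝ (Fin d) → ℝ)
        (ψ : Fin Np → EuclideanSpace ℝ (Fin d) → ℝ),
        IsOpen Ω →
        AEMeasurable α (MeasureTheory.volume.restrict Ω) →
        0 < α₀ →
        (∀ᵐ x ∂(MeasureTheory.volume.restrict Ω), α₀ ≤ α x ∧ α x ≤ α₁) →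
        AEMeasurable κ
          ((MeasureTheory.Measure.euclideanHausdorffMeasure (d - 1)).restrict (frontier Ω)) →
        0 < κ₀ →
        (∀ᵐ x ∂((MeasureTheory.Measure.euclideanHausdorffMeasure (d - 1)).restrict (frontier Ω)),
          κ₀ ≤ κ x ∧ κ x ≤ κ₁) →
        BulkSurface.IsTriangulation K Ω →
        BulkSurface.IsQuasiUniform K σ →
        BulkSurface.meshWidth K ≤ h₀ →
        BulkSurface.IsMesh KΓ (d - 1) (frontier Ω) →
        BulkSurface.IsNodalBasis K k (frontier Ω) node φ →
        BulkSurface.IsSurfaceBasis KΓ m (frontier Ω) ψ →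
      -- the time step and the right-hand sides
      ∀ (τ : ℝ) (fu : ℝ → Fin N₁ ⊕ Fin Nl → ℝ) (fp : ℝ → Fin Np → ℝ),
        0 < τ →
        τ ≤ c * BulkSurface.meshWidth K →
      -- the semi-discrete solution, extended to negative times
      ∀ (u : ℝ → Fin N₁ ⊕ Fin Nl → ℝ) (p : ℝ → Fin Np → ℝ) (lam : ℝ → Fin Nl → ℝ),
        BulkSurface.IsSemidiscreteSolution (BulkSurface.feMatrices Ω KΓ α κ φ ψ) fu fp
          (Set.Icc (-2 * τ) T) u p lam →
        BulkSurface.IsRegular (BulkSurface.feMatrices Ω KΓ α κ φ ψ) (Set.Icc (-2 * τ) T) R u p →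
      -- the fully discrete approximation
      ∀ (un : ℤ → Fin N₁ ⊕ Fin Nl → ℝ) (lamn wn : ℤ → Fin Nl → ℝ) (pn : ℤ → Fin Np → ℝ),
        BulkSurface.IsSplittingScheme (BulkSurface.feMatrices Ω KΓ α κ φ ψ) fu fp T τ
          un lamn wn pn →
        (∀ i ∈ Finset.Icc (-2 : ℤ) 0,
          (BulkSurface.feMatrices Ω KΓ α κ φ ψ).Bu.mulVec (un i)
            = (BulkSurface.feMatrices Ω KΓ α κ φ ψ).Bp.mulVec (pn i)) →
        (∀ i ∈ Finset.Icc (-2 : ℤ) 0,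
          BulkSurface.sqNorm (BulkSurface.feMatrices Ω KΓ α κ φ ψ).Mu (un i - u (i * τ))
            + τ * BulkSurface.sqNorm (BulkSurface.feMatrices Ω KΓ α κ φ ψ).Ku (un i - u (i * τ))
            + BulkSurface.sqNorm (BulkSurface.feMatrices Ω KΓ α κ φ ψ).Mp (pn i - p (i * τ))
            + τ * BulkSurface.sqNorm (BulkSurface.feMatrices Ω KΓ α κ φ ψ).Kp (pn i - p (i * τ))
          ≤ C₀ * τ ^ 5) →
      -- the error estimate
      ∀ n : ℕ, n * τ ≤ T →
        BulkSurface.sqNorm (BulkSurface.feMatrices Ω KΓ α κ φ ψ).Mu (un n - u (n * τ))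
          + BulkSurface.sqNorm (BulkSurface.feMatrices Ω KΓ α κ φ ψ).Mp (pn n - p (n * τ))
          + τ * ∑ i ∈ Finset.Icc 1 n,
            (BulkSurface.sqNorm (BulkSurface.feMatrices Ω KΓ α κ φ ψ).Ku (un i - u (i * τ))
              + BulkSurface.sqNorm (BulkSurface.feMatrices Ω KΓ α κ φ ψ).Kp (pn i - p (i * τ)))
        ≤ C * τ ^ 4 := by
  obtain ⟨a, b, ha, hb, hadm⟩ := BulkSurface.exists_isAdmissible d (by omega) hk hσ α₁
  refine ⟨1 / (1000 * (a * b + 1)), by positivity, 1 / (48 * (a + 1)), by positivity,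
    fun T C₀ R _ => ⟨3 * (Real.exp (2 * T) * (28 * (5 * √C₀ + 2 * √R) ^ 2 + T * (3460 * R))) + 3 * R,
      ?_⟩⟩
  intro Ω α κ α₀ κ₀ κ₁ K KΓ m N₁ Nl Np node φ ψ hΩ hα hα₀ hα₁ hκ hκ₀ hκ₁ hT hq hh₀ hM hφ hψ τ fu fp
    hτ hτh u p lam hsol hreg un lamn wn pn hsch hcons hinit n hn
  have hh : 0 < BulkSurface.meshWidth K := pos_of_mul_pos_right (hτ.trans_le hτh) (by positivity)
  exact BulkSurface.error_estimate_of_isAdmissible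
    (hadm Ω α κ α₀ κ₀ κ₁ K KΓ m N₁ Nl Np node φ ψ hΩ hα hα₀ hα₁ hκ hκ₀ hκ₁ hT hq hh hM hφ hψ)
    ha hb hh hh₀ hτ hτh hsol hreg hsch hcons hinit n hn
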